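/- Let $\nu_+,\nu_-\in\mathbb R\setminus\{0\}$ and $\alpha_+,\alpha_-\ge 0$. Let $\chi_n$ ($n\ge 0$) be the normalized Hermite functions on $\mathbb R$, and for $U\in L^2(\mathbb R^3)$ write $U\sim\{u_{m,n}\}$ if $U(x,q_+,q_-)=\sum_{m,n\ge 0}u_{m,n}(x)\chi_m(q_+)\chi_n(q_-)$, that is, $u_{m,n}(x)=\int_{\mathbb R^2}U(x,q_+,q_-)\chi_m(q_+)\chi_n(q_-)\,dq_+dq_-$ for a.e. $x$. Put $r_{m,n}=\nu_+^2(m+\tfrac12)+\nu_-^2(n+\tfrac12)$ and $(L_{m,n}u)(x)=-u''(x)+r_{m,n}u(x)$ for $x\ne\pm1$, and let $[u'](o)=u'(o+)-u'(o-)$. Let $\mathcal D_\alpha$ be the set of all $U\sim\{u_{m,n}\}$ in $L^2(\mathbb R^3)$ such that 1. $u_{m,n}\in H^1(\mathbb R)$ for all $m,n$; 2. for all $m,n$ the restriction of $u_{m,n}$ to each of the intervals $(-\infty,-1)$, $(-1,1)$, $(1,\infty)$ lies in $H^2$, and $\sum_{m,n}\int_{\mathbb R}|L_{m,n}u_{m,n}|^2\,dx<\infty$;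 3. for all $m,n$ (a term with the factor $\sqrt 0$ being zero) $$[u_{m,n}'](1)=\frac{\alpha_+}{\sqrt2}\left(\sqrt{m+1}\,u_{m+1,n}(1)+\sqrt m\,u_{m-1,n}(1)\right),$$ $$[u_{m,n}'](-1)=\frac{\alpha_-}{\sqrt2}\left(\sqrt{n+1}\,u_{m,n+1}(-1)+\sqrt n\,u_{m,n-1}(-1)\right).$$ Then there is a well-defined linear operator $\mathbf A_\alpha$ in $L^2(\mathbb R^3)$ with domain exactly $\mathcal D_\alpha$ which maps $U\sim\{u_{m,n}\}$ to the function $\mathbf A_\alpha U\sim\{L_{m,n}u_{m,n}\}$, and $\mathbf A_\alpha$ is self-adjoint. -/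

import Mathlib

open MeasureTheory Set Filter Topology
open scoped ContDiff ENNReal

noncomputable section

namespace Smilansky

/-- The Hilbert space `L²(ℝ³)` of complex functions of `(x, q₊, q₋)`. -/
abbrev H : Type := Lp ℂ 2 (volume : Measure (ℝ × ℝ × ℝ))

/-! ### One-dimensional Sobolev spaces -/

/-- `v` is the weak (distributional) derivative of `u` on the open set `I ⊆ ℝ`. -/
def HasWeakDeriv (I : Set ℝ) (u v : ℝ → ℂ) : Prop :=
  LocallyIntegrableOn u I ∧ LocallyIntegrableOn v I ∧
    ∀ φ : ℝ → ℝ, ContDiff ℝ ∞ φ → HasCompactSupport φ → tsupport φ ⊆ I →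
      ∫ x in I, deriv φ x • u x = -∫ x in I, φ x • v x

/-- `u` restricted to the open set `I` belongs to the Sobolev space `H^k(I)`: `u` and its weak
derivatives up to order `k` are square integrable on `I`. -/
def MemSobolev : ℕ → Set ℝ → (ℝ → ℂ) → Prop
  | 0, I, u => MemLp u 2 (volume.restrict I)
  | k + 1, I, u => MemLp u 2 (volume.restrict I) ∧ ∃ v, HasWeakDeriv I u v ∧ MemSobolev k I v

/-- `J = u'(o+) - u'(o-)`: the function `u` is differentiable at all points near `o` and different
from `o`, its derivative has one-sided limits at `o`, and `J` is their difference. -/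
def HasDerivJump (u : ℝ → ℂ) (o : ℝ) (J : ℂ) : Prop :=
  (∀ᶠ x in 𝓝[≠] o, DifferentiableAt ℝ u x) ∧
    ∃ a b : ℂ, Tendsto (deriv u) (𝓝[>] o) (𝓝 a) ∧ Tendsto (deriv u) (𝓝[<] o) (𝓝 b) ∧ J = a - b

/-! ### Hermite expansions -/

/-- The normalized Hermite function `χ_n(q) = (2ⁿ n! √π)^(-1/2) H_n(q) exp(-q²/2)`. Mathlib's
polynomial `hermite n` is the probabilists' `He_n`, and `H_n(q) = 2^(n/2) He_n(√2 q)`. -/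
def hermiteFun (n : ℕ) (q : ℝ) : ℝ :=
  (√((n.factorial : ℝ) * √Real.pi))⁻¹ * Polynomial.aeval (√2 * q) (Polynomial.hermite n)
    * Real.exp (-q ^ 2 / 2)

/-- The `(m, n)` coefficient of `U` in its expansion in the functions `χ_m(q₊) χ_n(q₋)`,
as a function of `x`. -/
def hermiteCoeff (U : H) (m n : ℕ) (x : ℝ) : ℂ :=
  ∫ q : ℝ × ℝ, U (x, q) * ((hermiteFun m q.1 * hermiteFun n q.2 : ℝ) : ℂ)

/-- The relation `U ∼ {u_{m,n}}`, i.e. `U(x, q₊, q₋) = ∑ u_{m,n}(x) χ_m(q₊) χ_n(q₋)`. -/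
def Represents (U : H) (u : ℕ → ℕ → ℝ → ℂ) : Prop :=
  ∀ m n, hermiteCoeff U m n =ᵐ[volume] u m n

/-! ### The operator -/

/-- `r_{m,n} = ν₊² (m + 1/2) + ν₋² (n + 1/2)`. -/
def level (νp νm : ℝ) (m n : ℕ) : ℝ :=
  νp ^ 2 * ((m : ℝ) + 1 / 2) + νm ^ 2 * ((n : ℝ) + 1 / 2)

/-- `f = -u'' + r u` on `ℝ ∖ {1, -1}`. -/
def IsOscillatorImage (r : ℝ) (u f : ℝ → ℂ) : Prop :=
  ∃ v w : ℝ → ℂ, HasWeakDeriv {1, -1}ᶜ u v ∧ HasWeakDeriv {1, -1}ᶜ v w ∧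
    f =ᵐ[volume] fun x => -w x + (r : ℂ) * u x

/-- The conditions on a sequence `{u_{m,n}}` that define the domain, together with the statement
that `f_{m,n} = L_{m,n} u_{m,n}`. Each `u_{m,n}` is given by its continuous representative, so
that its values at `1` and `-1` are meaningful. -/
structure IsAdmissible (αp αm νp νm : ℝ) (u f : ℕ → ℕ → ℝ → ℂ) : Prop where
  continuous : ∀ m n, Continuous (u m n)
  memH1 : ∀ m n, MemSobolev 1 univ (u m n)
  memH2_left : ∀ m n, MemSobolev 2 (Iio (-1)) (u m n)
  memH2_middle : ∀ m n, MemSobolev 2 (Ioo (-1) 1) (u m n)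
  memH2_right : ∀ m n, MemSobolev 2 (Ioi 1) (u m n)
  image : ∀ m n, IsOscillatorImage (level νp νm m n) (u m n) (f m n)
  sum_lt_top : ∑' (m : ℕ) (n : ℕ), ∫⁻ x, ‖f m n x‖ₑ ^ 2 < ⊤
  jump_right : ∀ m n, HasDerivJump (u m n) 1
    (((αp / √2 : ℝ) : ℂ) * (((√((m : ℝ) + 1) : ℝ) : ℂ) * u (m + 1) n 1
      + ((√(m : ℝ) : ℝ) : ℂ) * u (m - 1) n 1))
  jump_left : ∀ m n, HasDerivJump (u m n) (-1)
    (((αm / √2 : ℝ) : ℂ) * (((√((n : ℝ) + 1) : ℝ) : ℂ) * u m (n + 1) (-1)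
      + ((√(n : ℝ) : ℝ) : ℂ) * u m (n - 1) (-1)))

/-- The domain `𝒟_α ⊆ L²(ℝ³)`. -/
def domainSet (αp αm νp νm : ℝ) : Set H :=
  {U | ∃ u f, Represents U u ∧ IsAdmissible αp αm νp νm u f}

/-! ### Linearity of the conditions -/

theorem integrable_smul_of_tsupport {I : Set ℝ} {u : ℝ → ℂ} (hu : LocallyIntegrableOn u I)
    {φ : ℝ → ℝ} (hφ : Continuous φ) (hc : HasCompactSupport φ) (hs : tsupport φ ⊆ I) :
    Integrable (fun x => φ x • u x) := by
  have h1 : IntegrableOn (fun x => φ x • u x) (tsupport φ) :=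
    (hu.integrableOn_compact_subset hs hc).continuousOn_smul hφ.continuousOn hc
  refine (integrableOn_iff_integrable_of_support_subset ?_).1 h1
  intro x hx
  apply subset_tsupport
  intro h0
  exact hx (by simp [h0])

theorem HasWeakDeriv.zero (I : Set ℝ) : HasWeakDeriv I (fun _ => 0) (fun _ => 0) :=
  ⟨(locallyIntegrable_zero).locallyIntegrableOn _, (locallyIntegrable_zero).locallyIntegrableOn _,
    fun φ _ _ _ => by simp⟩

theorem HasWeakDeriv.add {I : Set ℝ} {u v u' v' : ℝ → ℂ} (h : HasWeakDeriv I u v)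
    (h' : HasWeakDeriv I u' v') :
    HasWeakDeriv I (fun x => u x + u' x) (fun x => v x + v' x) := by
  refine ⟨h.1.add h'.1, h.2.1.add h'.2.1, fun φ hφ hc hs => ?_⟩
  have hd : Continuous (deriv φ) := hφ.continuous_deriv (by simp)
  have hds : tsupport (deriv φ) ⊆ I := tsupport_deriv_subset.trans hs
  simp only [smul_add]
  rw [integral_add (integrable_smul_of_tsupport h.1 hd hc.deriv hds).integrableOn
      (integrable_smul_of_tsupport h'.1 hd hc.deriv hds).integrableOn,
    integral_add (integrable_smul_of_tsupport h.2.1 hφ.continuous hc hs).integrableOn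
      (integrable_smul_of_tsupport h'.2.1 hφ.continuous hc hs).integrableOn,
    h.2.2 φ hφ hc hs, h'.2.2 φ hφ hc hs]
  ring

theorem HasWeakDeriv.const_mul {I : Set ℝ} {u v : ℝ → ℂ} (c : ℂ) (h : HasWeakDeriv I u v) :
    HasWeakDeriv I (fun x => c * u x) (fun x => c * v x) := by
  refine ⟨h.1.smul c, h.2.1.smul c, fun φ hφ hc hs => ?_⟩
  have e : ∀ (a : ℝ) (z : ℂ), a • (c * z) = c * (a • z) := fun a z => by
    simp only [Complex.real_smul]; ring
  simp only [e]
  rw [integral_const_mul, integral_const_mul, h.2.2 φ hφ hc hs]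
  ring

theorem MemSobolev.zero (k : ℕ) (I : Set ℝ) : MemSobolev k I (fun _ => 0) := by
  induction k with
  | zero => exact MemLp.zero'
  | succ k ih => exact ⟨MemLp.zero', _, HasWeakDeriv.zero I, ih⟩

theorem MemSobolev.add {k : ℕ} {I : Set ℝ} {u u' : ℝ → ℂ} (h : MemSobolev k I u)
    (h' : MemSobolev k I u') : MemSobolev k I (fun x => u x + u' x) := by
  induction k generalizing u u' with
  | zero => exact MemLp.add h h'
  | succ k ih =>
    obtain ⟨h1, v, hv, h2⟩ := h
    obtain ⟨h1', v', hv', h2'⟩ := h'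
    exact ⟨h1.add h1', _, hv.add hv', ih h2 h2'⟩

theorem MemSobolev.const_mul {k : ℕ} {I : Set ℝ} {u : ℝ → ℂ} (c : ℂ) (h : MemSobolev k I u) :
    MemSobolev k I (fun x => c * u x) := by
  induction k generalizing u with
  | zero => exact MemLp.const_mul h c
  | succ k ih =>
    obtain ⟨h1, v, hv, h2⟩ := h
    exact ⟨h1.const_mul c, _, hv.const_mul c, ih h2⟩

theorem HasDerivJump.zero (o : ℝ) : HasDerivJump (fun _ => 0) o 0 :=
  ⟨Eventually.of_forall fun _ => differentiableAt_const _, 0, 0, by simp, by simp, by simp⟩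

theorem HasDerivJump.add {u u' : ℝ → ℂ} {o : ℝ} {J J' : ℂ} (h : HasDerivJump u o J)
    (h' : HasDerivJump u' o J') : HasDerivJump (fun x => u x + u' x) o (J + J') := by
  obtain ⟨hd, a, b, ha, hb, rfl⟩ := h
  obtain ⟨hd', a', b', ha', hb', rfl⟩ := h'
  have key : ∀ᶠ x in 𝓝[≠] o, deriv u x + deriv u' x = deriv (fun x => u x + u' x) x := by
    filter_upwards [hd, hd'] with x hx hx'
    exact (deriv_fun_add hx hx').symm
  refine ⟨?_, a + a', b + b', ?_, ?_, by ring⟩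
  · filter_upwards [hd, hd'] with x hx hx'
    exact hx.fun_add hx'
  · exact (ha.add ha').congr' (key.filter_mono (nhdsWithin_mono _ fun x hx => ne_of_gt hx))
  · exact (hb.add hb').congr' (key.filter_mono (nhdsWithin_mono _ fun x hx => ne_of_lt hx))

theorem HasDerivJump.const_mul {u : ℝ → ℂ} {o : ℝ} {J : ℂ} (c : ℂ) (h : HasDerivJump u o J) :
    HasDerivJump (fun x => c * u x) o (c * J) := by
  obtain ⟨hd, a, b, ha, hb, rfl⟩ := h
  have key : ∀ᶠ x in 𝓝[≠] o, c * deriv u x = deriv (fun x => c * u x) x := by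
    filter_upwards [hd] with x hx
    exact (deriv_const_mul c hx).symm
  refine ⟨?_, c * a, c * b, ?_, ?_, by ring⟩
  · filter_upwards [hd] with x hx
    exact hx.const_mul c
  · exact (ha.const_mul c).congr' (key.filter_mono (nhdsWithin_mono _ fun x hx => ne_of_gt hx))
  · exact (hb.const_mul c).congr' (key.filter_mono (nhdsWithin_mono _ fun x hx => ne_of_lt hx))

theorem IsOscillatorImage.zero (r : ℝ) : IsOscillatorImage r (fun _ => 0) (fun _ => 0) :=
  ⟨_, _, HasWeakDeriv.zero _, HasWeakDeriv.zero _, Eventually.of_forall fun x => by simp⟩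

theorem IsOscillatorImage.add {r : ℝ} {u f u' f' : ℝ → ℂ} (h : IsOscillatorImage r u f)
    (h' : IsOscillatorImage r u' f') :
    IsOscillatorImage r (fun x => u x + u' x) (fun x => f x + f' x) := by
  obtain ⟨v, w, hv, hw, hf⟩ := h
  obtain ⟨v', w', hv', hw', hf'⟩ := h'
  refine ⟨_, _, hv.add hv', hw.add hw', ?_⟩
  filter_upwards [hf, hf'] with x h1 h2
  rw [h1, h2]; ring

theorem IsOscillatorImage.const_mul {r : ℝ} {u f : ℝ → ℂ} (c : ℂ) (h : IsOscillatorImage r u f) :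
    IsOscillatorImage r (fun x => c * u x) (fun x => c * f x) := by
  obtain ⟨v, w, hv, hw, hf⟩ := h
  refine ⟨_, _, hv.const_mul c, hw.const_mul c, ?_⟩
  filter_upwards [hf] with x h1
  rw [h1]; ring

theorem IsOscillatorImage.aemeasurable {r : ℝ} {u f : ℝ → ℂ} (hu : Continuous u)
    (h : IsOscillatorImage r u f) : AEMeasurable f := by
  obtain ⟨v, w, hv, hw, hf⟩ := h
  have h0 : ((volume : Measure ℝ).restrict ({1, -1}ᶜ : Set ℝ)) = volume :=
    Measure.restrict_eq_self_of_ae_mem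
      (((Set.toFinite ({1, -1} : Set ℝ)).countable.ae_notMem volume))
  have hm : AEStronglyMeasurable w (volume : Measure ℝ) := by
    have := hw.2.1.aestronglyMeasurable
    rwa [h0] at this
  exact (hm.aemeasurable.neg.add (hu.measurable.const_mul _).aemeasurable).congr hf.symm

theorem IsAdmissible.zero (αp αm νp νm : ℝ) :
    IsAdmissible αp αm νp νm (fun _ _ _ => 0) (fun _ _ _ => 0) where
  continuous _ _ := continuous_const
  memH1 _ _ := MemSobolev.zero _ _
  memH2_left _ _ := MemSobolev.zero _ _
  memH2_middle _ _ := MemSobolev.zero _ _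
  memH2_right _ _ := MemSobolev.zero _ _
  image _ _ := IsOscillatorImage.zero _
  sum_lt_top := by simp
  jump_right _ _ := by simpa using HasDerivJump.zero 1
  jump_left _ _ := by simpa using HasDerivJump.zero (-1)

theorem IsAdmissible.add {αp αm νp νm : ℝ} {u f u' f' : ℕ → ℕ → ℝ → ℂ}
    (h : IsAdmissible αp αm νp νm u f) (h' : IsAdmissible αp αm νp νm u' f') :
    IsAdmissible αp αm νp νm (fun m n x => u m n x + u' m n x)
      (fun m n x => f m n x + f' m n x) where
  continuous m n := (h.continuous m n).add (h'.continuous m n)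
  memH1 m n := (h.memH1 m n).add (h'.memH1 m n)
  memH2_left m n := (h.memH2_left m n).add (h'.memH2_left m n)
  memH2_middle m n := (h.memH2_middle m n).add (h'.memH2_middle m n)
  memH2_right m n := (h.memH2_right m n).add (h'.memH2_right m n)
  image m n := (h.image m n).add (h'.image m n)
  sum_lt_top := by
    have e : ∀ a b : ℂ, ‖a + b‖ₑ ^ 2 ≤ 2 * ‖a‖ₑ ^ 2 + 2 * ‖b‖ₑ ^ 2 := by
      intro a b
      have h1 : ‖a + b‖₊ ^ 2 ≤ 2 * ‖a‖₊ ^ 2 + 2 * ‖b‖₊ ^ 2 := by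
        rw [← NNReal.coe_le_coe]
        push_cast
        have := norm_add_le a b
        nlinarith [norm_nonneg (a + b), norm_nonneg a, norm_nonneg b, sq_nonneg (‖a‖ - ‖b‖)]
      simpa [enorm_eq_nnnorm] using (ENNReal.coe_le_coe.2 h1)
    have hm : ∀ m n, AEMeasurable (fun x => 2 * ‖f m n x‖ₑ ^ 2) := fun m n =>
      (((h.image m n).aemeasurable (h.continuous m n)).enorm.pow_const 2).const_mul 2
    have step : ∀ m n, ∫⁻ x, ‖f m n x + f' m n x‖ₑ ^ 2 ≤
        2 * (∫⁻ x, ‖f m n x‖ₑ ^ 2) + 2 * ∫⁻ x, ‖f' m n x‖ₑ ^ 2 := by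
      intro m n
      calc ∫⁻ x, ‖f m n x + f' m n x‖ₑ ^ 2
          ≤ ∫⁻ x, (2 * ‖f m n x‖ₑ ^ 2 + 2 * ‖f' m n x‖ₑ ^ 2) := lintegral_mono fun x => e _ _
        _ = _ := by
          rw [lintegral_add_left' (hm m n), lintegral_const_mul' _ _ (by simp),
            lintegral_const_mul' _ _ (by simp)]
    refine lt_of_le_of_lt (ENNReal.tsum_le_tsum fun m => ENNReal.tsum_le_tsum fun n => step m n) ?_
    simp only [ENNReal.tsum_add, ENNReal.tsum_mul_left]
    exact ENNReal.add_lt_top.2 ⟨ENNReal.mul_lt_top (by simp) h.sum_lt_top,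
      ENNReal.mul_lt_top (by simp) h'.sum_lt_top⟩
  jump_right m n := by
    convert (h.jump_right m n).add (h'.jump_right m n) using 1
    ring
  jump_left m n := by
    convert (h.jump_left m n).add (h'.jump_left m n) using 1
    ring

theorem IsAdmissible.const_mul {αp αm νp νm : ℝ} {u f : ℕ → ℕ → ℝ → ℂ} (c : ℂ)
    (h : IsAdmissible αp αm νp νm u f) :
    IsAdmissible αp αm νp νm (fun m n x => c * u m n x) (fun m n x => c * f m n x) where
  continuous m n := (h.continuous m n).const_mul c
  memH1 m n := (h.memH1 m n).const_mul c
  memH2_left m n := (h.memH2_left m n).const_mul c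
  memH2_middle m n := (h.memH2_middle m n).const_mul c
  memH2_right m n := (h.memH2_right m n).const_mul c
  image m n := (h.image m n).const_mul c
  sum_lt_top := by
    simp only [enorm_mul, mul_pow]
    have hc : ‖c‖ₑ ^ 2 ≠ ⊤ := by simp
    simp only [lintegral_const_mul' _ _ hc, ENNReal.tsum_mul_left]
    exact ENNReal.mul_lt_top hc.lt_top h.sum_lt_top
  jump_right m n := by
    convert (h.jump_right m n).const_mul c using 1
    ring
  jump_left m n := by
    convert (h.jump_left m n).const_mul c using 1
    ring

theorem memLp_pow_mul_gaussian (k : ℕ) :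
    MemLp (fun q : ℝ => q ^ k * Real.exp (-q ^ 2 / 2)) 2 volume := by
  rw [memLp_two_iff_integrable_sq (by fun_prop)]
  have h := integrable_rpow_mul_exp_neg_mul_sq (b := 1) one_pos (s := ((2 * k : ℕ) : ℝ))
    (by have : (0 : ℝ) ≤ ((2 * k : ℕ) : ℝ) := Nat.cast_nonneg _
        linarith)
  refine h.congr (Eventually.of_forall fun q => ?_)
  simp only [Real.rpow_natCast]
  rw [mul_pow, ← Real.exp_nat_mul, pow_mul']
  congr 2
  push_cast
  ring

theorem memLp_hermiteFun (n : ℕ) : MemLp (hermiteFun n) 2 volume := by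
  have h : MemLp (fun q : ℝ => ∑ k ∈ Finset.range ((Polynomial.hermite n).natDegree + 1),
      ((√((n.factorial : ℝ) * √Real.pi))⁻¹ * ((Polynomial.hermite n).coeff k : ℝ) * √2 ^ k) *
        (q ^ k * Real.exp (-q ^ 2 / 2))) 2 volume :=
    memLp_finsetSum _ fun k _ => (memLp_pow_mul_gaussian k).const_mul _
  convert h using 1
  funext q
  rw [hermiteFun, Polynomial.aeval_eq_sum_range, Finset.mul_sum, Finset.sum_mul]
  refine Finset.sum_congr rfl fun k _ => ?_
  rw [zsmul_eq_mul, mul_pow]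
  ring

theorem ae_integrable_hermite (U : H) (m n : ℕ) : ∀ᵐ x : ℝ, Integrable (fun q : ℝ × ℝ =>
    U (x, q) * ((hermiteFun m q.1 * hermiteFun n q.2 : ℝ) : ℂ)) := by
  have hU : MemLp U 2 ((volume : Measure ℝ).prod (volume : Measure (ℝ × ℝ))) := Lp.memLp U
  have hsq := (memLp_two_iff_integrable_sq_norm hU.1).1 hU
  have hχ : MemLp (fun q : ℝ × ℝ => ((hermiteFun m q.1 * hermiteFun n q.2 : ℝ) : ℂ)) 2
      ((volume : Measure ℝ).prod (volume : Measure ℝ)) := by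
    refine MemLp.ofReal ?_
    have h1 := (memLp_two_iff_integrable_sq (memLp_hermiteFun m).1).1 (memLp_hermiteFun m)
    have h2 := (memLp_two_iff_integrable_sq (memLp_hermiteFun n).1).1 (memLp_hermiteFun n)
    refine (memLp_two_iff_integrable_sq
      ((memLp_hermiteFun m).1.comp_fst.mul (memLp_hermiteFun n).1.comp_snd)).2 ?_
    refine (h1.mul_prod h2).congr (Eventually.of_forall fun q => ?_)
    simp only [Pi.mul_apply, mul_pow]
  filter_upwards [hsq.prod_right_ae, hU.1.prodMk_left] with x h1 h2
  exact ((memLp_two_iff_integrable_sq_norm h2).2 h1).integrable_mul hχ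

theorem Represents.zero : Represents 0 (fun _ _ _ => 0) := by
  intro m n
  have h : ∀ᵐ z : ℝ × ℝ × ℝ ∂((volume : Measure ℝ).prod (volume : Measure (ℝ × ℝ))),
      (0 : H) z = 0 := Lp.coeFn_zero ℂ 2 (volume : Measure (ℝ × ℝ × ℝ))
  filter_upwards [Measure.ae_ae_of_ae_prod h] with x hx
  rw [hermiteCoeff, integral_eq_zero_of_ae]
  filter_upwards with q
  simp

theorem Represents.add {U V : H} {u v : ℕ → ℕ → ℝ → ℂ} (hU : Represents U u)
    (hV : Represents V v) : Represents (U + V) (fun m n x => u m n x + v m n x) := by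
  intro m n
  have h : ∀ᵐ z : ℝ × ℝ × ℝ ∂((volume : Measure ℝ).prod (volume : Measure (ℝ × ℝ))),
      (U + V : H) z = U z + V z := Lp.coeFn_add U V
  filter_upwards [Measure.ae_ae_of_ae_prod h, hU m n, hV m n, ae_integrable_hermite U m n,
    ae_integrable_hermite V m n] with x hx h1 h2 h3 h4
  rw [← h1, ← h2, hermiteCoeff, hermiteCoeff, hermiteCoeff, ← integral_add h3 h4]
  refine integral_congr_ae ?_
  filter_upwards [hx] with q hq
  rw [hq, add_mul]

theorem Represents.smul {U : H} {u : ℕ → ℕ → ℝ → ℂ} (c : ℂ) (hU : Represents U u) :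
    Represents (c • U) (fun m n x => c * u m n x) := by
  intro m n
  have h : ∀ᵐ z : ℝ × ℝ × ℝ ∂((volume : Measure ℝ).prod (volume : Measure (ℝ × ℝ))),
      (c • U : H) z = c * U z := Lp.coeFn_smul c U
  filter_upwards [Measure.ae_ae_of_ae_prod h, hU m n] with x hx h1
  rw [← h1, hermiteCoeff, hermiteCoeff, ← integral_const_mul]
  refine integral_congr_ae ?_
  filter_upwards [hx] with q hq
  rw [hq, mul_assoc]

/-- The graph of `A_α`: the pairs `(U, W)` with `U ∼ {u_{m,n}}` in `𝒟_α` and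
`W ∼ {L_{m,n} u_{m,n}}`. -/
def operatorGraph (αp αm νp νm : ℝ) : Submodule ℂ (H × H) where
  carrier := {P | ∃ u f, Represents P.1 u ∧ IsAdmissible αp αm νp νm u f ∧ Represents P.2 f}
  zero_mem' := ⟨_, _, Represents.zero, IsAdmissible.zero _ _ _ _, Represents.zero⟩
  add_mem' := by
    rintro P Q ⟨u, f, h1, h2, h3⟩ ⟨u', f', h1', h2', h3'⟩
    exact ⟨_, _, h1.add h1', h2.add h2', h3.add h3'⟩
  smul_mem' := by
    rintro c P ⟨u, f, h1, h2, h3⟩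
    exact ⟨_, _, h1.smul c, h2.const_mul c, h3.smul c⟩

/-- The operator `A_α = A_{α₊,α₋;ν₊,ν₋}` in `L²(ℝ³)`, as the partially defined linear operator
with graph `operatorGraph`. -/
def smilanskyOperator (αp αm νp νm : ℝ) : H →ₗ.[ℂ] H :=
  (operatorGraph αp αm νp νm).toLinearPMap

end Smilansky

end

open MeasureTheory Set Filter Topology
open scoped ContDiff ENNReal

noncomputable section

namespace Smilansky

/-! The products of Hermite functions form an orthonormal basis in the variables (q₊, q₋), so L²(ℝ³)
becomes ℓ²(ℕ², L²(ℝ)). There A_α is the family of operators -d²/dx² + r_{m,n}, coupled only through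
the jumps of the derivatives: those at 1 couple neighbours in m, those at -1 couple neighbours in n.
Both couplings are real symmetric Jacobi matrices with off-diagonal entries α√(k+1)/√2.

Symmetry (`inner_eq_of_isAdmissible`). Green's formula on the line expresses each term of ⟨AU, U'⟩ -
⟨U, AU'⟩ by the values and jumps at ±1. Since the Jacobi matrices are symmetric, these terms are
discrete differences, and the sum over the square {0, …, N}² leaves only terms along its two outer
edges. A trace estimate at scale δ = (m+n+1)^(-1/2) shows that |u_{m,n}(±1)|² / √(m+n+1) is
summable, so the edge terms are at most a constant times (N+1) Y_N with Y summable. As ∑ 1/(N+1)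
diverges, they cannot stay away from 0 (`eq_zero_of_telescoping`). This is Carleman's criterion, and
it puts no bound on the size of α.

Maximality (`mem_operatorGraph_of_inner_eq`). Let ⟨W, U⟩ = ⟨V, AU⟩ for all U in the domain. Put a
test function at the index (m, n) and repair the matching conditions at the neighbouring indices
with fixed profiles that vanish at ±1 and have a unit jump. This gives a finite family in the domain
(`greenPairing_add_add_eq_zero`). The relation then says that v_{m,n}'' equals r v_{m,n} - w_{m,n}
plus multiples of δ₁ and δ₋₁. Hence v_{m,n} is piecewise H², and Green's formula identifies the
multiples with the traces of the neighbours, which is the matching condition. So (V, W) lies in the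
graph.

The case V = 0, with single-valuedness of the graph, gives density of the domain; symmetry and
maximality then give A = A*. -/

/-! ### Primitives of locally integrable functions -/

/-- `F` is a primitive of the locally integrable function `f`. -/
structure IsPrim (F f : ℝ → ℂ) : Prop where
  locallyIntegrable : LocallyIntegrable f
  sub_eq : ∀ x y, F y - F x = ∫ t in x..y, f t

/-- Fubini: the square is cut along its diagonal, and each iterated integral is the integral of f(x)
g(y) over one of the two triangles. This is integration by parts for primitives that vanish at a. -/
theorem integral_mul_integral_triangle {f g : ℝ → ℂ} {a b : ℝ} (hab : a ≤ b)
    (hf : IntervalIntegrable f volume a b) (hg : IntervalIntegrable g volume a b) :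
    (∫ x in a..b, f x * ∫ t in a..x, g t) + ∫ x in a..b, (∫ t in a..x, f t) * g x =
      (∫ x in a..b, f x) * ∫ x in a..b, g x := by
  set μ := (volume : Measure ℝ).restrict (Ioc a b) with hμ
  have hf' : Integrable f μ := (intervalIntegrable_iff_integrableOn_Ioc_of_le hab).1 hf
  have hg' : Integrable g μ := (intervalIntegrable_iff_integrableOn_Ioc_of_le hab).1 hg
  have hfg : Integrable (fun z : ℝ × ℝ => f z.1 * g z.2) (μ.prod μ) := hf'.mul_prod hg'
  have hm : MeasurableSet {z : ℝ × ℝ | z.2 ≤ z.1} := measurableSet_le measurable_snd measurable_fst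
  set s : Set (ℝ × ℝ) := {z : ℝ × ℝ | z.2 ≤ z.1} with hs
  have h1 : ∫ x in a..b, f x * ∫ t in a..x, g t =
      ∫ z in s, f z.1 * g z.2 ∂(μ.prod μ) := by
    rw [← integral_indicator hm, integral_prod _ (hfg.indicator hm),
      intervalIntegral.integral_of_le hab]
    refine setIntegral_congr_fun measurableSet_Ioc fun x hx => ?_
    rw [intervalIntegral.integral_of_le hx.1.le, ← integral_const_mul]
    rw [← integral_indicator measurableSet_Ioc, hμ, ← integral_indicator measurableSet_Ioc]
    congr 1
    ext t
    simp only [indicator, s, mem_Ioc, mem_ofPred_eq]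
    by_cases h1 : a < t <;> by_cases h2 : t ≤ x <;> simp [h1, h2]
    intro h3
    exact absurd (h2.trans hx.2) (not_le.2 h3)
  have h2 : ∫ x in a..b, (∫ t in a..x, f t) * g x =
      ∫ z in sᶜ, f z.1 * g z.2 ∂(μ.prod μ) := by
    rw [← integral_indicator hm.compl, integral_prod_symm _ (hfg.indicator hm.compl),
      intervalIntegral.integral_of_le hab]
    refine setIntegral_congr_fun measurableSet_Ioc fun x hx => ?_
    -- The diagonal belongs to the first triangle, so here the inner interval must be open on the
    -- right.
    rw [intervalIntegral.integral_of_le hx.1.le, ← integral_mul_const, integral_Ioc_eq_integral_Ioo]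
    rw [← integral_indicator measurableSet_Ioo, hμ, ← integral_indicator measurableSet_Ioc]
    congr 1
    ext t
    simp only [indicator, s, mem_Ioc, mem_Ioo, mem_ofPred_eq, mem_compl_iff, not_le]
    by_cases h1 : a < t <;> by_cases h2 : t < x <;> simp [h1, h2]
    intro h3
    exact absurd (h2.le.trans hx.2) (not_le.2 h3)
  rw [h1, h2, integral_add_compl hm hfg, integral_prod_mul,
    intervalIntegral.integral_of_le hab, intervalIntegral.integral_of_le hab]

namespace IsPrim

variable {F f G g : ℝ → ℂ}

theorem intervalIntegrable (h : IsPrim F f) (a b : ℝ) : IntervalIntegrable f volume a b :=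
  (h.locallyIntegrable.integrableOn_isCompact isCompact_uIcc).intervalIntegrable

theorem eq_add (h : IsPrim F f) (a x : ℝ) : F x = F a + ∫ t in a..x, f t := by
  rw [← h.sub_eq]; ring

theorem continuous (h : IsPrim F f) : Continuous F := by
  have : F = fun x => F 0 + ∫ t in (0 : ℝ)..x, f t := funext fun x => h.eq_add 0 x
  rw [this]
  exact continuous_const.add (intervalIntegral.continuous_primitive h.intervalIntegrable 0)

theorem of_eq_integral (hf : LocallyIntegrable f) (a : ℝ) (h : ∀ x, F x = F a + ∫ t in a..x, f t) :
    IsPrim F f := by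
  refine ⟨hf, fun x y => ?_⟩
  have hi : ∀ a b, IntervalIntegrable f volume a b := fun a b =>
    (hf.integrableOn_isCompact isCompact_uIcc).intervalIntegrable
  rw [h x, h y, ← intervalIntegral.integral_add_adjacent_intervals (hi a x) (hi x y)]
  ring

theorem of_hasDerivAt {s : Set ℝ} (hs : s.Countable) (hF : Continuous F) (hf : LocallyIntegrable f)
    (h : ∀ x ∉ s, HasDerivAt F (f x) x) : IsPrim F f := by
  refine ⟨hf, fun x y => ?_⟩
  rw [integral_eq_of_hasDerivAt_off_countable F f hs hF.continuousOn
    (fun x hx => h x hx.2)]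
  exact (hf.integrableOn_isCompact isCompact_uIcc).intervalIntegrable

theorem add (h : IsPrim F f) (h' : IsPrim G g) :
    IsPrim (fun x => F x + G x) (fun x => f x + g x) := by
  refine ⟨h.locallyIntegrable.add h'.locallyIntegrable, fun x y => ?_⟩
  rw [intervalIntegral.integral_add (h.intervalIntegrable _ _) (h'.intervalIntegrable _ _),
    ← h.sub_eq, ← h'.sub_eq]
  ring

theorem const_mul (c : ℂ) (h : IsPrim F f) : IsPrim (fun x => c * F x) (fun x => c * f x) := by
  refine ⟨h.locallyIntegrable.smul c, fun x y => ?_⟩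
  rw [intervalIntegral.integral_const_mul, ← h.sub_eq]
  ring

theorem conj (h : IsPrim F f) :
    IsPrim (fun x => (starRingEnd ℂ) (F x)) (fun x => (starRingEnd ℂ) (f x)) := by
  refine ⟨?_, fun x y => ?_⟩
  · have := h.locallyIntegrable
    intro x
    obtain ⟨s, hs, h'⟩ := this x
    exact ⟨s, hs, by
      refine h'.congr' ?_ ?_
      · exact Complex.continuous_conj.comp_aestronglyMeasurable h'.1
      · exact Eventually.of_forall fun x => by simp⟩
  · rw [← map_sub, h.sub_eq, intervalIntegral, intervalIntegral, map_sub, integral_conj,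
      integral_conj]

theorem add_const (h : IsPrim F f) (c : ℂ) : IsPrim (fun x => F x + c) f :=
  ⟨h.locallyIntegrable, fun x y => by rw [← h.sub_eq]; ring⟩

/-- Integration by parts. -/
theorem integral_mul_add_mul (h : IsPrim F f) (h' : IsPrim G g) {a b : ℝ} (hab : a ≤ b) :
    (∫ x in a..b, f x * G x) + ∫ x in a..b, F x * g x = F b * G b - F a * G a := by
  have hi := h.intervalIntegrable a b
  have hi' := h'.intervalIntegrable a b
  have key := integral_mul_integral_triangle hab hi hi'
  have hG : ∫ x in a..b, f x * G x =
      (∫ x in a..b, f x * ∫ t in a..x, g t) + (∫ x in a..b, f x) * G a := by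
    rw [← intervalIntegral.integral_mul_const, ← intervalIntegral.integral_add]
    · refine intervalIntegral.integral_congr fun x _ => ?_
      rw [h'.eq_add a x]; ring
    · exact hi.mul_continuousOn (intervalIntegral.continuous_primitive
        h'.intervalIntegrable a).continuousOn
    · exact hi.mul_const _
  have hF : ∫ x in a..b, F x * g x =
      (∫ x in a..b, (∫ t in a..x, f t) * g x) + F a * (∫ x in a..b, g x) := by
    rw [← intervalIntegral.integral_const_mul, ← intervalIntegral.integral_add]
    · refine intervalIntegral.integral_congr fun x _ => ?_
      rw [h.eq_add a x]; ring
    · exact hi'.continuousOn_mul (intervalIntegral.continuous_primitive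
        h.intervalIntegrable a).continuousOn
    · exact hi'.const_mul _
  rw [← h.sub_eq a b, ← h'.sub_eq a b] at key
  rw [hG, hF, ← h.sub_eq a b, ← h'.sub_eq a b]
  linear_combination key

end IsPrim

/-! ### Functions with a square integrable second derivative off two points -/

/-- `u' = p` and `u'' = w + c₁ δ₁ + c₂ δ₋₁` with square integrable `u`, `p` and `w`. -/
structure PiecewiseH2 (u p w : ℝ → ℂ) (c₁ c₂ : ℂ) : Prop where
  memLp_u : MemLp u 2
  memLp_p : MemLp p 2
  memLp_w : MemLp w 2
  prim_u : IsPrim u p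
  prim_p : IsPrim (fun x => p x - (if 1 < x then c₁ else 0) + (if x < -1 then c₂ else 0)) w

/-- If L were nonzero, |f| would exceed |L|/2 on a half-line, a set of infinite measure. This
disposes of boundary terms at infinity without separate decay estimates for u and p. -/
theorem eq_zero_of_integrable_of_tendsto {f : ℝ → ℂ} {L : ℂ} (hf : Integrable f)
    (h : Tendsto f atTop (𝓝 L)) : L = 0 := by
  by_contra hL
  have hpos : 0 < ‖L‖ / 2 := by positivity
  have h1 : ∀ᶠ x in atTop, ‖L‖ / 2 ≤ ‖f x‖ :=
    (h.norm.eventually (lt_mem_nhds (half_lt_self (by positivity)))).mono fun x hx => le_of_lt hx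
  obtain ⟨a, ha⟩ := eventually_atTop.1 h1
  have h2 := hf.measure_norm_ge_lt_top hpos
  have h3 : volume (Ici a) ≤ volume {x | ‖L‖ / 2 ≤ ‖f x‖} := measure_mono fun x hx => ha x hx
  simp [Real.volume_Ici] at h3
  exact h2.ne h3

theorem integral_ite_one_lt_mul {g : ℝ → ℂ} (c : ℂ) {R : ℝ} (hR : 1 ≤ R) :
    ∫ x in (-R)..R, (if 1 < x then c else 0) * g x = c * ∫ x in (1 : ℝ)..R, g x := by
  rw [intervalIntegral.integral_of_le (by linarith), intervalIntegral.integral_of_le hR,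
    ← integral_const_mul]
  have : (fun x : ℝ => (if 1 < x then c else 0) * g x) = (Ioi 1).indicator fun x => c * g x := by
    ext x; simp [indicator]
  rw [this, setIntegral_indicator measurableSet_Ioi]
  congr 2
  ext x
  simp only [mem_inter_iff, mem_Ioc, mem_Ioi]
  constructor <;> intro h <;> refine ⟨?_, ?_⟩ <;> grind

theorem integral_ite_lt_neg_one_mul {g : ℝ → ℂ} (c : ℂ) {R : ℝ} (hR : 1 ≤ R) :
    ∫ x in (-R)..R, (if x < -1 then c else 0) * g x = c * ∫ x in (-R)..(-1 : ℝ), g x := by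
  rw [intervalIntegral.integral_of_le (by linarith), intervalIntegral.integral_of_le (by linarith),
    ← integral_const_mul, integral_Ioc_eq_integral_Ioo (x := -R) (y := -1)]
  have : (fun x : ℝ => (if x < -1 then c else 0) * g x) = (Iio (-1)).indicator fun x => c * g x := by
    ext x; simp [indicator]
  rw [this, setIntegral_indicator measurableSet_Iio]
  congr 2
  ext x
  simp only [mem_inter_iff, mem_Ioc, mem_Iio, mem_Ioo]
  constructor <;> intro h <;> refine ⟨?_, ?_⟩ <;> grind

theorem intervalIntegrable_ite_mul {g : ℝ → ℂ} (c : ℂ) {s : Set ℝ} (hs : MeasurableSet s)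
    [DecidablePred (· ∈ s)] {a b : ℝ} (hg : IntervalIntegrable g volume a b) :
    IntervalIntegrable (fun x => (if x ∈ s then c else 0) * g x) volume a b := by
  have : (fun x : ℝ => (if x ∈ s then c else 0) * g x) = s.indicator fun x => c * g x := by
    ext x; simp [indicator]
  rw [this, intervalIntegrable_iff]
  exact (intervalIntegrable_iff.1 (hg.const_mul c)).indicator hs

/-- Integration by parts on `[-R, R]` against a derivative with jumps at `1` and `-1`. -/
theorem IsPrim.integral_jump_mul_add_mul {p w G g : ℝ → ℂ} {c₁ c₂ : ℂ}
    (h : IsPrim (fun x => p x - (if 1 < x then c₁ else 0) + (if x < -1 then c₂ else 0)) w)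
    (h' : IsPrim G g) {R : ℝ} (hR : 1 < R) :
    (∫ x in (-R)..R, w x * G x) + ∫ x in (-R)..R, p x * g x =
      p R * G R - p (-R) * G (-R) - c₁ * G 1 - c₂ * G (-1) := by
  have key := h.integral_mul_add_mul h' (show -R ≤ R by linarith)
  have i1 : IntervalIntegrable (fun x => (if 1 < x then c₁ else 0) * g x) volume (-R) R :=
    intervalIntegrable_ite_mul (s := Ioi 1) c₁ measurableSet_Ioi (h'.intervalIntegrable _ _)
  have i2 : IntervalIntegrable (fun x => (if x < -1 then c₂ else 0) * g x) volume (-R) R :=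
    intervalIntegrable_ite_mul (s := Iio (-1)) c₂ measurableSet_Iio (h'.intervalIntegrable _ _)
  have i3 : IntervalIntegrable (fun x => (p x - (if 1 < x then c₁ else 0) +
      (if x < -1 then c₂ else 0)) * g x) volume (-R) R :=
    (h'.intervalIntegrable _ _).continuousOn_mul h.continuous.continuousOn
  have e : ∫ x in (-R)..R, p x * g x = (∫ x in (-R)..R, (p x - (if 1 < x then c₁ else 0) +
      (if x < -1 then c₂ else 0)) * g x) + (∫ x in (-R)..R, (if 1 < x then c₁ else 0) * g x)
      - ∫ x in (-R)..R, (if x < -1 then c₂ else 0) * g x := by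
    rw [← intervalIntegral.integral_add i3 i1, ← intervalIntegral.integral_sub (i3.add i1) i2]
    refine intervalIntegral.integral_congr fun x _ => ?_
    ring
  rw [e, integral_ite_one_lt_mul c₁ hR.le, integral_ite_lt_neg_one_mul c₂ hR.le, ← h'.sub_eq,
    ← h'.sub_eq]
  -- The corrected derivative is p(R) - c₁ at R and p(-R) + c₂ at -R. These constants cancel against
  -- the integrals of g over [1, R] and [-R, -1] and leave the values of G at 1 and -1.
  have n1 : ¬ R < -1 := by linarith
  have n2 : ¬ 1 < -R := by linarith
  have n3 : -R < -1 := by linarith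
  simp only [hR, n1, n2, n3, if_true, if_false] at key
  linear_combination key

theorem memLp_conj {f : ℝ → ℂ} (hf : MemLp f 2) :
    MemLp (fun x => (starRingEnd ℂ) (f x)) 2 := hf.star

namespace PiecewiseH2

variable {u p w u' p' w' : ℝ → ℂ} {c₁ c₂ c₁' c₂' : ℂ}

theorem continuous (h : PiecewiseH2 u p w c₁ c₂) : Continuous u := h.prim_u.continuous

/-- Integration by parts on the line. -/
theorem integral_mul_conj_add (h : PiecewiseH2 u p w c₁ c₂) (h' : PiecewiseH2 u' p' w' c₁' c₂') :
    (∫ x, w x * (starRingEnd ℂ) (u' x)) + ∫ x, p x * (starRingEnd ℂ) (p' x) =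
      - c₁ * (starRingEnd ℂ) (u' 1) - c₂ * (starRingEnd ℂ) (u' (-1)) := by
  have iw : Integrable fun x => w x * (starRingEnd ℂ) (u' x) :=
    h.memLp_w.integrable_mul (memLp_conj h'.memLp_u)
  have ip : Integrable fun x => p x * (starRingEnd ℂ) (p' x) :=
    h.memLp_p.integrable_mul (memLp_conj h'.memLp_p)
  have ib : Integrable fun x => p x * (starRingEnd ℂ) (u' x) :=
    h.memLp_p.integrable_mul (memLp_conj h'.memLp_u)
  have t1 := intervalIntegral_tendsto_integral iw tendsto_neg_atTop_atBot tendsto_id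
  have t2 := intervalIntegral_tendsto_integral ip tendsto_neg_atTop_atBot tendsto_id
  have t3 := ((t1.add t2).add_const (c₁ * (starRingEnd ℂ) (u' 1))).add_const
    (c₂ * (starRingEnd ℂ) (u' (-1)))
  -- The boundary term at ±R is an integrable function of R, and it has a limit because the two
  -- integrals converge; so the limit is 0.
  have z := eq_zero_of_integrable_of_tendsto (ib.sub ib.comp_neg) (t3.congr' (by
    filter_upwards [eventually_gt_atTop (1 : ℝ)] with R hR
    have := h.prim_p.integral_jump_mul_add_mul h'.prim_u.conj hR
    simp only [id, Pi.sub_apply]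
    linear_combination this))
  linear_combination z

theorem green (h : PiecewiseH2 u p w c₁ c₂) (h' : PiecewiseH2 u' p' w' c₁' c₂') :
    (∫ x, w x * (starRingEnd ℂ) (u' x)) - ∫ x, u x * (starRingEnd ℂ) (w' x) =
      u 1 * (starRingEnd ℂ) c₁' + u (-1) * (starRingEnd ℂ) c₂'
        - c₁ * (starRingEnd ℂ) (u' 1) - c₂ * (starRingEnd ℂ) (u' (-1)) := by
  have e1 := h.integral_mul_conj_add h'
  have e2 := congrArg (starRingEnd ℂ) (h'.integral_mul_conj_add h)
  simp only [map_add, map_sub, map_mul, map_neg, ← integral_conj, Complex.conj_conj] at e2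
  simp only [mul_comm] at e1 e2 ⊢
  linear_combination e1 - e2

end PiecewiseH2

/-! ### Trace estimate -/

/-- Cauchy–Schwarz, obtained from the nonnegativity of the variance of h on the interval. -/
theorem sq_intervalIntegral_le {h : ℝ → ℝ} {a δ : ℝ} (hδ : 0 < δ) (hh : MemLp h 2) :
    (∫ x in a..(a + δ), h x) ^ 2 ≤ δ * ∫ x in a..(a + δ), h x ^ 2 := by
  have i2 : Integrable fun x => h x ^ 2 := hh.integrable_sq
  have i1 : IntervalIntegrable h volume a (a + δ) :=
    ((hh.locallyIntegrable (by norm_num)).integrableOn_isCompact isCompact_uIcc).intervalIntegrable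
  set S := ∫ x in a..(a + δ), h x with hS
  have e : ∫ x in a..(a + δ), (h x - S / δ) ^ 2 = (∫ x in a..(a + δ), h x ^ 2) - S ^ 2 / δ := by
    have : ∀ x, (h x - S / δ) ^ 2 = h x ^ 2 + (-(2 * S / δ) * h x + S ^ 2 / δ ^ 2) := fun x => by
      field_simp; ring
    simp only [this]
    rw [intervalIntegral.integral_add i2.intervalIntegrable
      ((i1.const_mul _).add intervalIntegrable_const), intervalIntegral.integral_add
      (i1.const_mul _) intervalIntegrable_const, intervalIntegral.integral_const_mul,
      intervalIntegral.integral_const, ← hS]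
    simp only [add_sub_cancel_left, smul_eq_mul]
    field_simp
    ring
  have pos : 0 ≤ ∫ x in a..(a + δ), (h x - S / δ) ^ 2 :=
    intervalIntegral.integral_nonneg (by linarith) fun x _ => sq_nonneg _
  have : S ^ 2 / δ ≤ ∫ x in a..(a + δ), h x ^ 2 := by linarith
  rw [div_le_iff₀ hδ] at this
  linarith

theorem sq_integral_le {h : ℝ → ℝ} {a δ : ℝ} (hδ : 0 < δ) (hh : MemLp h 2) :
    (∫ x in a..(a + δ), h x) ^ 2 ≤ δ * ∫ x, h x ^ 2 := by
  refine (sq_intervalIntegral_le hδ hh).trans (mul_le_mul_of_nonneg_left ?_ hδ.le)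
  rw [intervalIntegral.integral_of_le (by linarith)]
  exact setIntegral_le_integral hh.integrable_sq (Eventually.of_forall fun x => sq_nonneg _)

/-- Two integrations by parts against ψ(x) = (x-o)(1-(x-o)/δ)². Since ψ(o) = 0 and ψ'(o) = 1, while
ψ and ψ' vanish at o+δ, only u(o) survives and no value of u' enters. Q is a continuous version of
u' to the right of o; its value at o need not be p(o). -/
theorem eval_eq_integral {u p Q w : ℝ → ℂ} (hu : IsPrim u p) (hQ : IsPrim Q w) {o δ : ℝ}
    (hδ : 0 < δ) (h : ∀ x ∈ Ioc o (o + δ), Q x = p x) :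
    u o = (∫ x in o..(o + δ), w x * (((x - o) * (1 - (x - o) / δ) ^ 2 : ℝ) : ℂ)) -
      ∫ x in o..(o + δ), u x * (((6 * ((x - o) / δ) - 4) / δ : ℝ) : ℂ) := by
  have hψ : IsPrim (fun x : ℝ => (((x - o) * (1 - (x - o) / δ) ^ 2 : ℝ) : ℂ))
      (fun x => (((1 - (x - o) / δ) * (1 - 3 * ((x - o) / δ)) : ℝ) : ℂ)) := by
    refine IsPrim.of_hasDerivAt countable_empty (by fun_prop)
      (Continuous.locallyIntegrable (by fun_prop)) fun x _ => HasDerivAt.ofReal_comp ?_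
    have h1 : HasDerivAt (fun x : ℝ => x - o) 1 x := (hasDerivAt_id x).sub_const o
    have h2 := h1.mul (((h1.div_const δ).const_sub 1).pow 2)
    refine h2.congr_deriv ?_
    simp
    field_simp
    ring
  have hψ' : IsPrim (fun x : ℝ => (((1 - (x - o) / δ) * (1 - 3 * ((x - o) / δ)) : ℝ) : ℂ))
      (fun x => (((6 * ((x - o) / δ) - 4) / δ : ℝ) : ℂ)) := by
    refine IsPrim.of_hasDerivAt countable_empty (by fun_prop)
      (Continuous.locallyIntegrable (by fun_prop)) fun x _ => HasDerivAt.ofReal_comp ?_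
    have h1 : HasDerivAt (fun x : ℝ => (x - o) / δ) (1 / δ) x :=
      ((hasDerivAt_id x).sub_const o).div_const δ
    have h2 := (h1.const_sub 1).mul ((h1.const_mul 3).const_sub 1)
    refine h2.congr_deriv ?_
    field_simp
    ring
  have e1 := hQ.integral_mul_add_mul hψ (show o ≤ o + δ by linarith)
  have e2 := hu.integral_mul_add_mul hψ' (show o ≤ o + δ by linarith)
  have e3 : ∫ x in o..(o + δ), Q x * (((1 - (x - o) / δ) * (1 - 3 * ((x - o) / δ)) : ℝ) : ℂ) =
      ∫ x in o..(o + δ), p x * (((1 - (x - o) / δ) * (1 - 3 * ((x - o) / δ)) : ℝ) : ℂ) := by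
    rw [intervalIntegral.integral_of_le (by linarith), intervalIntegral.integral_of_le (by linarith)]
    refine setIntegral_congr_fun measurableSet_Ioc fun x hx => ?_
    rw [h x hx]
  rw [e3] at e1
  simp only [add_sub_cancel_left, sub_self, div_self hδ.ne', zero_mul, mul_zero, zero_div,
    sub_zero, Complex.ofReal_zero, Complex.ofReal_one, mul_one, zero_sub] at e1 e2
  norm_num at e1 e2 ⊢
  linear_combination e2 - e1

/-- On the interval |ψ| ≤ δ and |ψ''| ≤ 4/δ; Cauchy–Schwarz contributes a factor δ to each squared
integral, and 32 = 2·4². The free parameter δ is later matched to the size of the level r_{m,n}. -/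
theorem norm_eval_sq_le {u p Q w : ℝ → ℂ} (hu : IsPrim u p) (hQ : IsPrim Q w) {o δ : ℝ}
    (hδ : 0 < δ) (h : ∀ x ∈ Ioc o (o + δ), Q x = p x) (hu2 : MemLp u 2) (hw2 : MemLp w 2) :
    ‖u o‖ ^ 2 ≤ 2 * δ ^ 3 * (∫ x, ‖w x‖ ^ 2) + 32 / δ * ∫ x, ‖u x‖ ^ 2 := by
  have hs : ∀ x ∈ uIoc o (o + δ), 0 ≤ (x - o) / δ ∧ (x - o) / δ ≤ 1 := by
    intro x hx
    rw [uIoc_of_le (by linarith)] at hx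
    exact ⟨div_nonneg (by linarith [hx.1]) hδ.le, (div_le_one hδ).2 (by linarith [hx.2])⟩
  have iw : IntervalIntegrable (fun x => ‖w x‖) volume o (o + δ) :=
    (hQ.intervalIntegrable _ _).norm
  have iu : IntervalIntegrable (fun x => ‖u x‖) volume o (o + δ) :=
    (hu.continuous.intervalIntegrable _ _).norm
  have b1 : ‖∫ x in o..(o + δ), w x * (((x - o) * (1 - (x - o) / δ) ^ 2 : ℝ) : ℂ)‖ ≤
      δ * ∫ x in o..(o + δ), ‖w x‖ := by
    rw [← intervalIntegral.integral_const_mul]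
    refine intervalIntegral.norm_integral_le_of_norm_le (by linarith) ?_ (iw.const_mul _)
    refine Eventually.of_forall fun x hx => ?_
    obtain ⟨h0, h1⟩ := hs x (by rwa [uIoc_of_le (by linarith)])
    rw [norm_mul, Complex.norm_real, mul_comm, Real.norm_eq_abs]
    refine mul_le_mul_of_nonneg_right ?_ (norm_nonneg _)
    have e : x - o = δ * ((x - o) / δ) := by field_simp
    set s := (x - o) / δ
    rw [e, abs_of_nonneg (by positivity), mul_assoc]
    refine mul_le_of_le_one_right hδ.le ?_
    have : (1 - s) ^ 2 ≤ 1 := by nlinarith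
    nlinarith
  have b2 : ‖∫ x in o..(o + δ), u x * (((6 * ((x - o) / δ) - 4) / δ : ℝ) : ℂ)‖ ≤
      4 / δ * ∫ x in o..(o + δ), ‖u x‖ := by
    rw [← intervalIntegral.integral_const_mul]
    refine intervalIntegral.norm_integral_le_of_norm_le (by linarith) ?_ (iu.const_mul _)
    refine Eventually.of_forall fun x hx => ?_
    obtain ⟨h0, h1⟩ := hs x (by rwa [uIoc_of_le (by linarith)])
    rw [norm_mul, Complex.norm_real, mul_comm, Real.norm_eq_abs]
    refine mul_le_mul_of_nonneg_right ?_ (norm_nonneg _)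
    rw [abs_div, abs_of_pos hδ]
    gcongr
    rw [abs_le]
    constructor <;> linarith
  have c1 := sq_integral_le (a := o) hδ hw2.norm
  have c2 := sq_integral_le (a := o) hδ hu2.norm
  have n1 : 0 ≤ ∫ x in o..(o + δ), ‖w x‖ :=
    intervalIntegral.integral_nonneg (by linarith) fun _ _ => norm_nonneg _
  have n2 : 0 ≤ ∫ x in o..(o + δ), ‖u x‖ :=
    intervalIntegral.integral_nonneg (by linarith) fun _ _ => norm_nonneg _
  set A := ∫ x in o..(o + δ), ‖w x‖
  set B := ∫ x in o..(o + δ), ‖u x‖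
  set A' := ∫ x, ‖w x‖ ^ 2
  set B' := ∫ x, ‖u x‖ ^ 2
  have b3 : ‖u o‖ ≤ δ * A + 4 / δ * B := by
    rw [eval_eq_integral hu hQ hδ h]
    exact (norm_sub_le _ _).trans (add_le_add b1 b2)
  calc ‖u o‖ ^ 2 ≤ (δ * A + 4 / δ * B) ^ 2 := by gcongr
    _ ≤ 2 * (δ * A) ^ 2 + 2 * (4 / δ * B) ^ 2 := by nlinarith [sq_nonneg (δ * A - 4 / δ * B)]
    _ = 2 * δ ^ 2 * A ^ 2 + 32 / δ ^ 2 * B ^ 2 := by field_simp; ring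
    _ ≤ 2 * δ ^ 2 * (δ * A') + 32 / δ ^ 2 * (δ * B') := by gcongr
    _ = 2 * δ ^ 3 * A' + 32 / δ * B' := by field_simp

theorem PiecewiseH2.norm_eval_one_sq_le {u p w : ℝ → ℂ} {c₁ c₂ : ℂ}
    (h : PiecewiseH2 u p w c₁ c₂) {δ : ℝ} (hδ : 0 < δ) :
    ‖u 1‖ ^ 2 ≤ 2 * δ ^ 3 * (∫ x, ‖w x‖ ^ 2) + 32 / δ * ∫ x, ‖u x‖ ^ 2 := by
  -- To the right of 1 the corrected derivative is p - c₁, so the constant c₁ is added back.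
  refine norm_eval_sq_le h.prim_u (h.prim_p.add_const c₁) hδ (fun x hx => ?_) h.memLp_u h.memLp_w
  have h1 : 1 < x := hx.1
  have h2 : ¬ x < -1 := by linarith
  simp [h1, h2]

theorem PiecewiseH2.norm_eval_neg_one_sq_le {u p w : ℝ → ℂ} {c₁ c₂ : ℂ}
    (h : PiecewiseH2 u p w c₁ c₂) {δ : ℝ} (hδ : 0 < δ) (hδ' : δ ≤ 1) :
    ‖u (-1)‖ ^ 2 ≤ 2 * δ ^ 3 * (∫ x, ‖w x‖ ^ 2) + 32 / δ * ∫ x, ‖u x‖ ^ 2 := by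
  -- Between -1 and 1 the corrected derivative is p itself; δ ≤ 1 keeps the interval to the left of
  -- 1.
  refine norm_eval_sq_le h.prim_u h.prim_p hδ (fun x hx => ?_) h.memLp_u h.memLp_w
  have h1 : ¬ 1 < x := by linarith [hx.2]
  have h2 : ¬ x < -1 := by linarith [hx.1]
  simp [h1, h2]

/-! ### The lemma of du Bois-Reymond -/

/-- Integrate ψ from the least point a of its support. The primitive vanishes to the left of a, and
beyond the greatest point b because the total integral is 0; order-connectedness puts [a, b] inside
I. -/
theorem exists_primitive_of_integral_eq_zero {I : Set ℝ} (hI : I.OrdConnected) {ψ : ℝ → ℝ}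
    (hψ : ContDiff ℝ ∞ ψ) (hc : HasCompactSupport ψ) (hs : tsupport ψ ⊆ I) (h0 : ∫ x, ψ x = 0) :
    ∃ φ : ℝ → ℝ, ContDiff ℝ ∞ φ ∧ HasCompactSupport φ ∧ tsupport φ ⊆ I ∧ deriv φ = ψ := by
  rcases (tsupport ψ).eq_empty_or_nonempty with he | hne
  · have hz : ψ = 0 := tsupport_eq_empty_iff.1 he
    refine ⟨0, contDiff_const, HasCompactSupport.zero, by simp, ?_⟩
    rw [hz]; ext x; simp
  obtain ⟨a, ha⟩ := hc.isCompact.exists_isLeast hne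
  obtain ⟨b, hb⟩ := hc.isCompact.exists_isGreatest hne
  have hab : a ≤ b := ha.2 hb.1
  have hIcc : Icc a b ⊆ I := hI.out (hs ha.1) (hs hb.1)
  have zl : ∀ x < a, ψ x = 0 := fun x hx => image_eq_zero_of_notMem_tsupport fun h =>
    absurd (ha.2 h) (not_le.2 hx)
  have zr : ∀ x, b < x → ψ x = 0 := fun x hx => image_eq_zero_of_notMem_tsupport fun h =>
    absurd (hb.2 h) (not_le.2 hx)
  have hd : ∀ x, HasDerivAt (fun x => ∫ t in a..x, ψ t) (ψ x) x := fun x =>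
    intervalIntegral.integral_hasDerivAt_right (hψ.continuous.intervalIntegrable _ _)
      hψ.continuous.stronglyMeasurable.stronglyMeasurableAtFilter hψ.continuous.continuousAt
  have hderiv : deriv (fun x => ∫ t in a..x, ψ t) = ψ := funext fun x => (hd x).deriv
  have hsub : tsupport (fun x => ∫ t in a..x, ψ t) ⊆ Icc a b := by
    refine closure_minimal (fun x hx => ?_) isClosed_Icc
    by_contra hcon
    apply hx
    rw [mem_Icc, not_and_or, not_le, not_le] at hcon
    rcases hcon with h | h
    · have : ∀ t ∈ uIcc a x, ψ t = (fun _ => (0 : ℝ)) t := by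
        intro t ht
        rw [uIcc_of_ge h.le] at ht
        rcases ht.2.eq_or_lt with rfl | h'
        · have : Tendsto ψ (𝓝[<] t) (𝓝 (ψ t)) := hψ.continuous.continuousAt.continuousWithinAt
          refine tendsto_nhds_unique this (tendsto_const_nhds.congr' ?_)
          filter_upwards [self_mem_nhdsWithin] with y hy using (zl y hy).symm
        · exact zl t h'
      change ∫ t in a..x, ψ t = 0
      rw [intervalIntegral.integral_congr this]
      simp
    · change ∫ t in a..x, ψ t = 0
      rw [← h0, intervalIntegral.integral_of_le (hab.trans h.le), integral_Icc_eq_integral_Ioc.symm]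
      refine setIntegral_eq_integral_of_forall_compl_eq_zero fun t ht => ?_
      rw [mem_Icc, not_and_or, not_le, not_le] at ht
      rcases ht with h' | h'
      · exact zl t h'
      · exact zr t (h.trans h')
  refine ⟨fun x => ∫ t in a..x, ψ t, ?_, ?_, hsub.trans hIcc, hderiv⟩
  · rw [contDiff_infty_iff_deriv]
    exact ⟨fun x => (hd x).differentiableAt, by rw [hderiv]; exact hψ⟩
  · exact HasCompactSupport.of_support_subset_isCompact isCompact_Icc
      (subset_closure.trans hsub)

theorem exists_test_integral_eq_one {I : Set ℝ} (hI : IsOpen I) (hne : I.Nonempty) :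
    ∃ η : ℝ → ℝ, ContDiff ℝ ∞ η ∧ HasCompactSupport η ∧ tsupport η ⊆ I ∧ ∫ x, η x = 1 := by
  obtain ⟨x, hx⟩ := hne
  obtain ⟨f, h1, h2, h3, h4, h5⟩ :=
    exists_contDiff_tsupport_subset (n := (⊤ : ℕ∞)) (hI.mem_nhds hx)
  have hpos : 0 < ∫ x, f x := h3.continuous.integral_pos_of_hasCompactSupport_nonneg_nonzero h2
    (fun y => (h4 (mem_range_self y)).1) (x := x) (by simp [h5])
  refine ⟨fun y => (∫ x, f x)⁻¹ * f y, contDiff_const.mul h3, h2.mul_left,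
    (tsupport_mul_subset_right).trans h1, ?_⟩
  rw [integral_const_mul, inv_mul_cancel₀ hpos.ne']

/-- A locally integrable function with vanishing weak derivative on an interval is constant. -/
theorem ae_eq_const_of_integral_deriv_smul_eq_zero {I : Set ℝ} (hI : IsOpen I)
    (hI' : I.OrdConnected) {D : ℝ → ℂ} (hD : LocallyIntegrableOn D I)
    (h : ∀ φ : ℝ → ℝ, ContDiff ℝ ∞ φ → HasCompactSupport φ → tsupport φ ⊆ I →
      ∫ x, deriv φ x • D x = 0) : ∃ C : ℂ, ∀ᵐ x, x ∈ I → D x = C := by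
  rcases I.eq_empty_or_nonempty with rfl | hne
  · exact ⟨0, by simp⟩
  obtain ⟨η, hη, hηc, hηs, hη1⟩ := exists_test_integral_eq_one hI hne
  refine ⟨∫ x, η x • D x, ?_⟩
  have hconst : LocallyIntegrableOn (fun _ : ℝ => ∫ x, η x • D x) I :=
    (locallyIntegrable_const _).locallyIntegrableOn _
  have key := hI.ae_eq_zero_of_integral_contDiff_smul_eq_zero (hD.sub hconst) (μ := volume) ?_
  · filter_upwards [key] with x hx hxI
    exact sub_eq_zero.1 (hx hxI)
  intro g hg hgc hgs
  have ig : Integrable g := hg.continuous.integrable_of_hasCompactSupport hgc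
  have iη : Integrable η := hη.continuous.integrable_of_hasCompactSupport hηc
  -- Subtracting (∫ g) η gives a function of mean zero, hence the derivative of a test function;
  -- this yields ∫ g D = (∫ g) ∫ η D.
  have hsupp : tsupport (fun x => g x - (∫ x, g x) * η x) ⊆ I :=
    (tsupport_sub g _).trans (union_subset hgs ((tsupport_mul_subset_right).trans hηs))
  obtain ⟨φ, hφ, hφc, hφs, hφd⟩ := exists_primitive_of_integral_eq_zero hI'
    (ψ := fun x => g x - (∫ x, g x) * η x) (hg.sub (contDiff_const.mul hη))
    (hgc.sub hηc.mul_left) hsupp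
    (by rw [integral_sub ig (iη.const_mul _), integral_const_mul, hη1]; ring)
  have i1 : Integrable fun x => g x • D x :=
    integrable_smul_of_tsupport hD hg.continuous hgc hgs
  have i2 : Integrable fun x => η x • D x :=
    integrable_smul_of_tsupport hD hη.continuous hηc hηs
  have e := h φ hφ hφc hφs
  rw [hφd] at e
  have i3 : Integrable fun x => (∫ x, g x) • η x • D x := i2.smul (∫ x, g x)
  simp only [sub_smul, mul_smul] at e
  rw [integral_sub i1 i3, integral_smul] at e
  simp only [Pi.sub_apply, smul_sub]
  rw [integral_sub i1 (ig.smul_const _), integral_smul_const]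
  exact e

/-- A locally integrable function with vanishing second weak derivative is affine. -/
theorem ae_eq_affine_of_integral_deriv_deriv_smul_eq_zero {D : ℝ → ℂ} (hD : LocallyIntegrable D)
    (h : ∀ φ : ℝ → ℝ, ContDiff ℝ ∞ φ → HasCompactSupport φ →
      ∫ x, deriv (deriv φ) x • D x = 0) : ∃ A B : ℂ, ∀ᵐ x, D x = A + B * (x : ℂ) := by
  obtain ⟨η, hη, hηc, -, hη1⟩ := exists_test_integral_eq_one isOpen_univ univ_nonempty
  -- For D = A + Bx one has ∫ η' D = -B ∫ η = -B, which dictates the slope.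
  set B : ℂ := -∫ x, deriv η x • D x with hB
  have hlin : Continuous fun x : ℝ => B * (x : ℂ) := by fun_prop
  have hconst := ae_eq_const_of_integral_deriv_smul_eq_zero isOpen_univ ordConnected_univ
    (D := fun x => D x - B * (x : ℂ))
    ((hD.sub hlin.locallyIntegrable).locallyIntegrableOn _) ?_
  · obtain ⟨A, hA⟩ := hconst
    refine ⟨A, B, ?_⟩
    filter_upwards [hA] with x hx
    linear_combination hx (mem_univ _)
  intro ψ hψ hψc _
  have iψ : Integrable ψ := hψ.continuous.integrable_of_hasCompactSupport hψc
  have iη : Integrable η := hη.continuous.integrable_of_hasCompactSupport hηc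
  -- With χ' = ψ - (∫ ψ) η, the hypothesis for χ reads ∫ ψ' D = (∫ ψ) ∫ η' D = -B ∫ ψ, which is also
  -- the value of ∫ ψ'(x) Bx dx.
  obtain ⟨χ, hχ, hχc, -, hχd⟩ := exists_primitive_of_integral_eq_zero ordConnected_univ
    (ψ := fun x => ψ x - (∫ x, ψ x) * η x) (hψ.sub (contDiff_const.mul hη))
    (hψc.sub hηc.mul_left) (subset_univ _)
    (by rw [integral_sub iψ (iη.const_mul _), integral_const_mul, hη1]; ring)
  have e := h χ hχ hχc
  have dψ : Continuous (deriv ψ) := hψ.continuous_deriv (by simp)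
  have dη : Continuous (deriv η) := hη.continuous_deriv (by simp)
  have e2 : ∀ x, deriv (deriv χ) x = deriv ψ x - (∫ x, ψ x) * deriv η x := by
    intro x
    rw [hχd, deriv_fun_sub (hψ.differentiable (by simp) x)
      ((hη.differentiable (by simp) x).const_mul _), deriv_const_mul _
      (hη.differentiable (by simp) x)]
  have hDu := hD.locallyIntegrableOn univ
  have i1 : Integrable fun x => deriv ψ x • D x :=
    integrable_smul_of_tsupport hDu dψ hψc.deriv (subset_univ _)
  have i2 : Integrable fun x => deriv η x • D x :=
    integrable_smul_of_tsupport hDu dη hηc.deriv (subset_univ _)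
  have i3 : Integrable fun x => deriv ψ x • (B * (x : ℂ)) :=
    integrable_smul_of_tsupport (hlin.locallyIntegrable.locallyIntegrableOn _) dψ hψc.deriv
      (subset_univ _)
  have i4 : Integrable fun x => (∫ x, ψ x) • deriv η x • D x := i2.smul (∫ x, ψ x)
  simp only [e2, sub_smul, mul_smul] at e
  rw [integral_sub i1 i4, integral_smul] at e
  have e3 : ∫ x, deriv ψ x * x = -∫ x, ψ x := by
    have := integral_mul_deriv_eq_deriv_mul_of_integrable (u := fun x : ℝ => x)
      (u' := fun _ => 1) (v := ψ) (v' := deriv ψ) (fun x _ => hasDerivAt_id x)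
      (fun x _ => (hψ.differentiable (by simp) x).hasDerivAt)
      ((continuous_id.mul dψ).integrable_of_hasCompactSupport hψc.deriv.mul_left)
      (by convert iψ using 1; ext; simp)
      ((continuous_id.mul hψ.continuous).integrable_of_hasCompactSupport hψc.mul_left)
    simpa [mul_comm] using this
  have e4 : ∫ x, deriv ψ x • (B * (x : ℂ)) = -(B * ((∫ x, ψ x : ℝ) : ℂ)) := by
    have : ∀ x, deriv ψ x • (B * (x : ℂ)) = B * ((deriv ψ x * x : ℝ) : ℂ) := fun x => by
      rw [Complex.real_smul]; push_cast; ring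
    simp only [this]
    rw [integral_const_mul, integral_complex_ofReal, e3]
    push_cast; ring
  simp only [smul_sub]
  rw [integral_sub i1 i3, e4]
  rw [Complex.real_smul] at e
  rw [hB]
  linear_combination e

/-! ### Weak derivatives and primitives -/

/-- This is p' = w + c₁ δ₁ + c₂ δ₋₁ as distributions. The interval [-R, R] is taken large enough to
contain the support of φ and both points ±1. -/
theorem IsPrim.integral_deriv_smul_jump {p w : ℝ → ℂ} {c₁ c₂ : ℂ}
    (h : IsPrim (fun x => p x - (if 1 < x then c₁ else 0) + (if x < -1 then c₂ else 0)) w)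
    {φ : ℝ → ℝ} (hφ : ContDiff ℝ ∞ φ) (hc : HasCompactSupport φ) :
    ∫ x, deriv φ x • p x = -(∫ x, φ x • w x) - c₁ * φ 1 - c₂ * φ (-1) := by
  obtain ⟨r, hr⟩ := hc.isCompact.isBounded.subset_closedBall 0
  set R := max 2 (r + 1) with hR
  have h1 : 1 < R := lt_of_lt_of_le one_lt_two (le_max_left _ _)
  have h2 : r < R := lt_of_lt_of_le (lt_add_one r) (le_max_right _ _)
  have hsub : tsupport φ ⊆ Ioo (-R) R := fun x hx => by
    have := hr hx
    rw [Metric.mem_closedBall, dist_zero_right, Real.norm_eq_abs, abs_le] at this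
    exact ⟨by linarith, by linarith⟩
  have z1 : φ R = 0 := image_eq_zero_of_notMem_tsupport fun h => lt_irrefl _ (hsub h).2
  have z2 : φ (-R) = 0 := image_eq_zero_of_notMem_tsupport fun h => lt_irrefl _ (hsub h).1
  have hG : IsPrim (fun x => (φ x : ℂ)) (fun x => ((deriv φ x : ℝ) : ℂ)) :=
    IsPrim.of_hasDerivAt countable_empty (Complex.continuous_ofReal.comp hφ.continuous)
      (Complex.continuous_ofReal.comp (hφ.continuous_deriv (by simp))).locallyIntegrable
      fun x _ => ((hφ.differentiable (by simp) x).hasDerivAt).ofReal_comp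
  have key := h.integral_jump_mul_add_mul hG h1
  have s1 : ∫ x in (-R)..R, w x * (φ x : ℂ) = ∫ x, φ x • w x := by
    rw [intervalIntegral.integral_eq_integral_of_support_subset]
    · simp only [Complex.real_smul, mul_comm]
    · intro x hx
      refine Ioo_subset_Ioc_self (hsub (subset_tsupport _ fun h => hx ?_))
      simp [h]
  have s2 : ∫ x in (-R)..R, p x * ((deriv φ x : ℝ) : ℂ) = ∫ x, deriv φ x • p x := by
    rw [intervalIntegral.integral_eq_integral_of_support_subset]
    · simp only [Complex.real_smul, mul_comm]
    · intro x hx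
      refine Ioo_subset_Ioc_self (hsub (tsupport_deriv_subset (subset_tsupport _ fun h => hx ?_)))
      simp [h]
  rw [s1, s2, z1, z2] at key
  simp only [Complex.ofReal_zero, mul_zero] at key
  linear_combination key

theorem IsPrim.integral_deriv_smul {V v : ℝ → ℂ} (h : IsPrim V v) {φ : ℝ → ℝ}
    (hφ : ContDiff ℝ ∞ φ) (hc : HasCompactSupport φ) :
    ∫ x, deriv φ x • V x = -∫ x, φ x • v x := by
  have := IsPrim.integral_deriv_smul_jump (p := V) (c₁ := 0) (c₂ := 0) (by simpa using h) hφ hc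
  simpa using this

theorem setIntegral_smul_of_tsupport {I : Set ℝ} {φ : ℝ → ℝ} (hs : tsupport φ ⊆ I) (u : ℝ → ℂ) :
    ∫ x in I, φ x • u x = ∫ x, φ x • u x :=
  setIntegral_eq_integral_of_forall_compl_eq_zero fun x hx => by
    rw [image_eq_zero_of_notMem_tsupport fun h => hx (hs h), zero_smul]

theorem setIntegral_deriv_smul_of_tsupport {I : Set ℝ} {φ : ℝ → ℝ} (hs : tsupport φ ⊆ I)
    (u : ℝ → ℂ) : ∫ x in I, deriv φ x • u x = ∫ x, deriv φ x • u x :=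
  setIntegral_smul_of_tsupport (tsupport_deriv_subset.trans hs) u

theorem HasWeakDeriv.mono {I I' : Set ℝ} {u v : ℝ → ℂ} (h : HasWeakDeriv I u v) (hI : I' ⊆ I) :
    HasWeakDeriv I' u v := by
  refine ⟨h.1.mono_set hI, h.2.1.mono_set hI, fun φ hφ hc hs => ?_⟩
  have := h.2.2 φ hφ hc (hs.trans hI)
  rw [setIntegral_smul_of_tsupport (hs.trans hI),
    setIntegral_deriv_smul_of_tsupport (hs.trans hI)] at this
  rw [setIntegral_smul_of_tsupport hs, setIntegral_deriv_smul_of_tsupport hs, this]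

/-- On an interval a function differs from a primitive of its weak derivative by a constant. -/
theorem HasWeakDeriv.ae_eq_add_const {I : Set ℝ} (hI : IsOpen I) (hI' : I.OrdConnected)
    {u v V v' : ℝ → ℂ} (h : HasWeakDeriv I u v) (hV : IsPrim V v')
    (hv : ∀ᵐ x, x ∈ I → v x = v' x) : ∃ C : ℂ, ∀ᵐ x, x ∈ I → u x = V x + C := by
  have hVl := hV.continuous.locallyIntegrable.locallyIntegrableOn (μ := volume) I
  have hconst := ae_eq_const_of_integral_deriv_smul_eq_zero hI hI' (D := fun x => u x - V x)
    (h.1.sub hVl) fun φ hφ hc hs => ?_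
  · obtain ⟨C, hC⟩ := hconst
    refine ⟨C, ?_⟩
    filter_upwards [hC] with x hx hxI
    rw [← hx hxI]; ring
  have hd : Continuous (deriv φ) := hφ.continuous_deriv (by simp)
  have hds : tsupport (deriv φ) ⊆ I := tsupport_deriv_subset.trans hs
  simp only [smul_sub]
  rw [integral_sub (integrable_smul_of_tsupport h.1 hd hc.deriv hds)
    (integrable_smul_of_tsupport hVl hd hc.deriv hds), hV.integral_deriv_smul hφ hc]
  have e := h.2.2 φ hφ hc hs
  rw [setIntegral_smul_of_tsupport hs, setIntegral_deriv_smul_of_tsupport hs] at e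
  rw [e]
  have : ∫ x, φ x • v x = ∫ x, φ x • v' x := by
    refine integral_congr_ae ?_
    filter_upwards [hv] with x hx
    by_cases hxI : x ∈ I
    · rw [hx hxI]
    · rw [image_eq_zero_of_notMem_tsupport fun h => hxI (hs h), zero_smul, zero_smul]
  rw [this, sub_self]

theorem IsPrim.hasWeakDeriv_of_jump {p w : ℝ → ℂ} {c₁ c₂ : ℂ} (hp : LocallyIntegrable p)
    (h : IsPrim (fun x => p x - (if 1 < x then c₁ else 0) + (if x < -1 then c₂ else 0)) w)
    {I : Set ℝ} (h1 : (1 : ℝ) ∉ I) (h2 : (-1 : ℝ) ∉ I) : HasWeakDeriv I p w := by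
  refine ⟨hp.locallyIntegrableOn _, h.locallyIntegrable.locallyIntegrableOn _,
    fun φ hφ hc hs => ?_⟩
  rw [setIntegral_smul_of_tsupport hs, setIntegral_deriv_smul_of_tsupport hs,
    h.integral_deriv_smul_jump hφ hc, image_eq_zero_of_notMem_tsupport fun h => h1 (hs h),
    image_eq_zero_of_notMem_tsupport fun h => h2 (hs h)]
  simp

theorem IsPrim.hasWeakDeriv {V v : ℝ → ℂ} (h : IsPrim V v) (I : Set ℝ) : HasWeakDeriv I V v := by
  refine ⟨h.continuous.locallyIntegrable.locallyIntegrableOn _,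
    h.locallyIntegrable.locallyIntegrableOn _, fun φ hφ hc hs => ?_⟩
  rw [setIntegral_smul_of_tsupport hs, setIntegral_deriv_smul_of_tsupport hs,
    h.integral_deriv_smul hφ hc]

/-! ### Square integrability of the derivative -/

/-- By Cauchy–Schwarz the square is at most the integral of h² over the window, which is the
convolution of h² with the indicator of [-1, 0) and so integrable. -/
theorem memLp_integral_window {h : ℝ → ℝ} (hh : MemLp h 2) :
    MemLp (fun x => ∫ t in x..(x + 1), h t) 2 := by
  have hl : LocallyIntegrable h := hh.locallyIntegrable (by norm_num)
  have hi : ∀ a b, IntervalIntegrable h volume a b := fun a b =>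
    (hl.integrableOn_isCompact isCompact_uIcc).intervalIntegrable
  have hcont : Continuous fun x => ∫ t in x..(x + 1), h t := by
    have e : (fun x => ∫ t in x..(x + 1), h t) =
        fun x => (∫ t in (0 : ℝ)..(x + 1), h t) - ∫ t in (0 : ℝ)..x, h t := funext fun x =>
      (intervalIntegral.integral_interval_sub_left (hi _ _) (hi _ _)).symm
    rw [e]
    have c := intervalIntegral.continuous_primitive hi 0
    exact (c.comp (continuous_id.add continuous_const)).sub c
  rw [memLp_two_iff_integrable_sq hcont.aestronglyMeasurable]
  have hk : Integrable (indicator (Ico (-1 : ℝ) 0) fun _ => (1 : ℝ)) :=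
    (integrable_indicator_iff measurableSet_Ico).2 (integrableOn_const (by simp))
  have hconv := hh.integrable_sq.integrable_convolution (ContinuousLinearMap.mul ℝ ℝ) hk
  refine hconv.mono' (hcont.pow 2).aestronglyMeasurable (Eventually.of_forall fun x => ?_)
  rw [Real.norm_of_nonneg (sq_nonneg _)]
  refine (sq_intervalIntegral_le one_pos hh).trans (le_of_eq ?_)
  rw [one_mul, intervalIntegral.integral_of_le (by linarith), ← integral_indicator measurableSet_Ioc]
  refine integral_congr_ae (Eventually.of_forall fun t => ?_)
  simp only [ContinuousLinearMap.mul_apply', indicator, mem_Ioc, mem_Ico]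
  by_cases h1 : x < t ∧ t ≤ x + 1
  · rw [if_pos h1, if_pos ⟨by linarith, by linarith⟩, mul_one]
  · rw [if_neg h1, if_neg fun h2 => h1 ⟨by linarith, by linarith⟩, mul_zero]

/-- Averaging p(y) = p(x) + ∫ w over the window [x, x+1] gives p(x) as u(x+1) - u(x) minus an
average of integrals of w. Excluding [-2, 1] ensures that no window meets a jump. -/
theorem norm_le_window {u p w : ℝ → ℂ} {c₁ c₂ : ℂ} (hup : IsPrim u p)
    (hpw : IsPrim (fun x => p x - (if 1 < x then c₁ else 0) + (if x < -1 then c₂ else 0)) w)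
    {x : ℝ} (hx : x ∉ Icc (-2 : ℝ) 1) :
    ‖p x‖ ≤ ‖u (x + 1)‖ + ‖u x‖ + ∫ t in x..(x + 1), ‖w t‖ := by
  rw [mem_Icc, not_and_or, not_le, not_le] at hx
  have hpd : ∀ y ∈ Icc x (x + 1), p y = p x + ∫ t in x..y, w t := by
    intro y hy
    rw [← hpw.sub_eq]
    have a1 : (1 < y ↔ 1 < x) := by
      constructor <;> intro h <;> rcases hx with h' | h' <;> linarith [hy.1, hy.2]
    have a2 : (y < -1 ↔ x < -1) := by
      constructor <;> intro h <;> rcases hx with h' | h' <;> linarith [hy.1, hy.2]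
    simp only [a1, a2]
    ring
  have hiw : IntervalIntegrable w volume x (x + 1) := hpw.intervalIntegrable _ _
  have e : p x = u (x + 1) - u x - ∫ y in x..(x + 1), ∫ t in x..y, w t := by
    rw [hup.sub_eq]
    have : ∫ y in x..(x + 1), p y = ∫ y in x..(x + 1), (p x + ∫ t in x..y, w t) :=
      intervalIntegral.integral_congr fun y hy => hpd y (by rwa [uIcc_of_le (by linarith)] at hy)
    rw [this, intervalIntegral.integral_add intervalIntegrable_const
      ((intervalIntegral.continuous_primitive hpw.intervalIntegrable x).intervalIntegrable _ _)]
    simp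
  have hb2 : ‖∫ y in x..(x + 1), ∫ t in x..y, w t‖ ≤ ∫ t in x..(x + 1), ‖w t‖ := by
    have := intervalIntegral.norm_integral_le_of_norm_le_const (a := x) (b := x + 1)
      (f := fun y => ∫ t in x..y, w t) (C := ∫ t in x..(x + 1), ‖w t‖) fun y hy => ?_
    · simpa using this
    · rw [uIoc_of_le (by linarith)] at hy
      refine (intervalIntegral.norm_integral_le_integral_norm hy.1.le).trans ?_
      exact intervalIntegral.integral_mono_interval le_rfl hy.1.le hy.2
        (Eventually.of_forall fun _ => norm_nonneg _) hiw.norm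
  rw [e]
  exact (norm_sub_le _ _).trans (add_le_add (norm_sub_le _ _) hb2)

theorem exists_bound_of_prim_jump {p w : ℝ → ℂ} {c₁ c₂ : ℂ}
    (hpw : IsPrim (fun x => p x - (if 1 < x then c₁ else 0) + (if x < -1 then c₂ else 0)) w)
    (a b : ℝ) : ∃ M, ∀ x ∈ Icc a b, ‖p x‖ ≤ M := by
  obtain ⟨M, hM⟩ := isCompact_Icc.exists_bound_of_continuousOn (s := Icc a b)
    hpw.continuous.continuousOn
  refine ⟨M + ‖c₁‖ + ‖c₂‖, fun x hx => ?_⟩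
  have e : p x = (p x - (if 1 < x then c₁ else 0) + (if x < -1 then c₂ else 0)) +
      (if 1 < x then c₁ else 0) - (if x < -1 then c₂ else 0) := by ring
  have e1 : ‖(if 1 < x then c₁ else 0 : ℂ)‖ ≤ ‖c₁‖ := by split_ifs <;> simp
  have e2 : ‖(if x < -1 then c₂ else 0 : ℂ)‖ ≤ ‖c₂‖ := by split_ifs <;> simp
  rw [e]
  exact (norm_sub_le _ _).trans
    (add_le_add ((norm_add_le _ _).trans (add_le_add (hM x hx) e1)) e2)

/-- Square integrability of u' is automatic: p is bounded on [-2, 1], and elsewhere it is dominated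
by translates of |u| and a window integral of |w|. -/
theorem PiecewiseH2.of_prim {u p w : ℝ → ℂ} {c₁ c₂ : ℂ} (hu : MemLp u 2) (hw : MemLp w 2)
    (hup : IsPrim u p)
    (hpw : IsPrim (fun x => p x - (if 1 < x then c₁ else 0) + (if x < -1 then c₂ else 0)) w) :
    PiecewiseH2 u p w c₁ c₂ := by
  refine ⟨hu, ?_, hw, hup, hpw⟩
  obtain ⟨M, hM⟩ := exists_bound_of_prim_jump hpw (-2) 1
  have h1 : MemLp ((Icc (-2 : ℝ) 1).indicator fun _ => M) 2 :=
    memLp_indicator_const 2 measurableSet_Icc _ (Or.inr (by simp))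
  have h2 : MemLp (fun x => ‖u (x + 1)‖) 2 :=
    hu.norm.comp_measurePreserving (measurePreserving_add_right volume (1 : ℝ))
  have h3 : MemLp (fun x => ‖u x‖) 2 := hu.norm
  have h4 : MemLp (fun x => ∫ t in x..(x + 1), ‖w t‖) 2 := memLp_integral_window hw.norm
  refine (h1.add ((h2.add h3).add h4)).mono hup.locallyIntegrable.aestronglyMeasurable
    (Eventually.of_forall fun x => ?_)
  refine le_trans ?_ (le_abs_self _)
  simp only [Pi.add_apply]
  have n1 : 0 ≤ ∫ t in x..(x + 1), ‖w t‖ :=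
    intervalIntegral.integral_nonneg (by linarith) fun _ _ => norm_nonneg _
  by_cases hx : x ∈ Icc (-2 : ℝ) 1
  · rw [indicator_of_mem hx]
    linarith [norm_nonneg (u (x + 1)), norm_nonneg (u x), hM x hx]
  · rw [indicator_of_notMem hx, zero_add]
    exact norm_le_window hup hpw hx

/-- A square integrable distribution solution of `u'' = w + c₁ δ₁ + c₂ δ₋₁` is piecewise `H²`. -/
theorem exists_piecewiseH2_of_distribution {u w : ℝ → ℂ} {c₁ c₂ : ℂ} (hu : MemLp u 2)
    (hw : MemLp w 2) (h : ∀ φ : ℝ → ℝ, ContDiff ℝ ∞ φ → HasCompactSupport φ →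
      ∫ x, deriv (deriv φ) x • u x = (∫ x, φ x • w x) + c₁ * φ 1 + c₂ * φ (-1)) :
    ∃ u' p : ℝ → ℂ, u =ᵐ[volume] u' ∧ PiecewiseH2 u' p w c₁ c₂ := by
  have hwl : LocallyIntegrable w := hw.locallyIntegrable (by norm_num)
  have hul : LocallyIntegrable u := hu.locallyIntegrable (by norm_num)
  -- An explicit function with P' = w + c₁ δ₁ + c₂ δ₋₁. Its primitive V has the second derivative
  -- required of u, so u - V is affine.
  set P : ℝ → ℂ := fun x => (∫ t in (0 : ℝ)..x, w t) + (if 1 < x then c₁ else 0) -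
    (if x < -1 then c₂ else 0) with hP
  have hQ : IsPrim (fun x => ∫ t in (0 : ℝ)..x, w t) w :=
    IsPrim.of_eq_integral hwl 0 fun x => by simp
  have hPl : LocallyIntegrable P := by
    refine (hQ.continuous.locallyIntegrable.add ?_).sub ?_
    · have : (fun x : ℝ => if 1 < x then c₁ else 0) = (Ioi 1).indicator fun _ => c₁ := by
        ext x; simp [indicator]
      rw [this]
      exact (locallyIntegrable_const c₁).indicator measurableSet_Ioi
    · have : (fun x : ℝ => if x < -1 then c₂ else 0) = (Iio (-1)).indicator fun _ => c₂ := by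
        ext x; simp [indicator]
      rw [this]
      exact (locallyIntegrable_const c₂).indicator measurableSet_Iio
  have hPw : IsPrim (fun x => P x - (if 1 < x then c₁ else 0) + (if x < -1 then c₂ else 0)) w := by
    convert hQ using 2
    simp only [hP]; ring
  have hV : IsPrim (fun x => ∫ t in (0 : ℝ)..x, P t) P :=
    IsPrim.of_eq_integral hPl 0 fun x => by simp
  set V : ℝ → ℂ := fun x => ∫ t in (0 : ℝ)..x, P t
  obtain ⟨A, B, hAB⟩ := ae_eq_affine_of_integral_deriv_deriv_smul_eq_zero (D := fun x => u x - V x)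
    (hul.sub hV.continuous.locallyIntegrable) fun φ hφ hc => by
      have hφ' : ContDiff ℝ ∞ (deriv φ) := (contDiff_infty_iff_deriv.1 hφ).2
      have hd : Continuous (deriv (deriv φ)) := hφ'.continuous_deriv (by simp)
      simp only [smul_sub]
      rw [integral_sub (integrable_smul_of_tsupport (hul.locallyIntegrableOn univ) hd hc.deriv.deriv
        (subset_univ _)) (integrable_smul_of_tsupport
        (hV.continuous.locallyIntegrable.locallyIntegrableOn univ) hd hc.deriv.deriv
        (subset_univ _)), h φ hφ hc, hV.integral_deriv_smul hφ' hc.deriv,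
        hPw.integral_deriv_smul_jump hφ hc]
      ring
  have hlin : IsPrim (fun x : ℝ => A + B * (x : ℂ)) (fun _ => B) :=
    IsPrim.of_hasDerivAt countable_empty (by fun_prop) (locallyIntegrable_const _) fun x _ => by
      simpa using ((hasDerivAt_id x).ofReal_comp.const_mul B).const_add A
  have hae : u =ᵐ[volume] fun x => V x + (A + B * (x : ℂ)) := by
    filter_upwards [hAB] with x hx
    rw [← hx]; ring
  refine ⟨_, fun x => P x + B, hae, PiecewiseH2.of_prim ((memLp_congr_ae hae).1 hu) hw
    (hV.add hlin) ?_⟩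
  convert hPw.add_const B using 2
  ring

/-! ### The one-dimensional conditions in terms of `PiecewiseH2` -/

theorem continuousAt_ite_lt {P : ℝ → Prop} [DecidablePred P] {c : ℂ} {x : ℝ} {b : Prop}
    (h : ∀ᶠ y in 𝓝 x, (P y ↔ b)) : ContinuousAt (fun y => if P y then c else 0) x := by
  classical
  have : (fun y => if P y then c else 0) =ᶠ[𝓝 x] fun _ => if b then c else 0 := by
    filter_upwards [h] with y hy
    simp only [hy]
  exact continuousAt_const.congr this.symm

theorem eventually_one_lt_iff {x : ℝ} (h : x ≠ 1) : ∀ᶠ y in 𝓝 x, (1 < y ↔ 1 < x) := by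
  rcases lt_or_gt_of_ne h with h | h
  · filter_upwards [gt_mem_nhds h] with y hy
    exact iff_of_false (not_lt.2 hy.le) (not_lt.2 h.le)
  · filter_upwards [lt_mem_nhds h] with y hy
    exact iff_of_true hy h

theorem eventually_lt_neg_one_iff {x : ℝ} (h : x ≠ -1) : ∀ᶠ y in 𝓝 x, (y < -1 ↔ x < -1) := by
  rcases lt_or_gt_of_ne h with h | h
  · filter_upwards [gt_mem_nhds h] with y hy
    exact iff_of_true hy h
  · filter_upwards [lt_mem_nhds h] with y hy
    exact iff_of_false (not_lt.2 hy.le) (not_lt.2 h.le)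

namespace PiecewiseH2

variable {u p w : ℝ → ℂ} {c₁ c₂ : ℂ}

theorem hasDerivAt (h : PiecewiseH2 u p w c₁ c₂) {x : ℝ} (h1 : x ≠ 1) (h2 : x ≠ -1) :
    HasDerivAt u (p x) x := by
  have hc : ContinuousAt p x := by
    have e : p = fun x => (p x - (if 1 < x then c₁ else 0) + (if x < -1 then c₂ else 0)) +
        (if 1 < x then c₁ else 0) - (if x < -1 then c₂ else 0) := by ext x; ring
    rw [e]
    exact (h.prim_p.continuous.continuousAt.add (continuousAt_ite_lt (eventually_one_lt_iff h1))).sub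
      (continuousAt_ite_lt (eventually_lt_neg_one_iff h2))
  have hd := intervalIntegral.integral_hasDerivAt_right (h.prim_u.intervalIntegrable 0 x)
    h.prim_u.locallyIntegrable.aestronglyMeasurable.stronglyMeasurableAtFilter hc
  exact (hd.const_add (u 0)).congr_of_eventuallyEq
    (Eventually.of_forall fun y => h.prim_u.eq_add 0 y)

/-- The corrected derivative is continuous at o, so a one-sided limit of u' is its value plus the
constant b by which p differs from it on that side. -/
theorem hasDerivJump_aux (h : PiecewiseH2 u p w c₁ c₂) {o : ℝ} {s : Set ℝ} {b : ℂ}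
    (h1 : ∀ᶠ x in 𝓝[s] o, x ≠ 1) (h2 : ∀ᶠ x in 𝓝[s] o, x ≠ -1)
    (hb : ∀ᶠ x in 𝓝[s] o, (if 1 < x then c₁ else 0) - (if x < -1 then c₂ else 0) = b) :
    Tendsto (deriv u) (𝓝[s] o) (𝓝 ((p o - (if 1 < o then c₁ else 0) +
      (if o < -1 then c₂ else 0)) + b)) := by
  refine Tendsto.congr' ?_ ((h.prim_p.continuous.continuousAt.continuousWithinAt (s := s)
    (x := o)).add_const b)
  filter_upwards [h1, h2, hb] with x h1 h2 hb
  rw [(h.hasDerivAt h1 h2).deriv, ← hb]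
  ring

theorem hasDerivJump_one (h : PiecewiseH2 u p w c₁ c₂) : HasDerivJump u 1 c₁ := by
  have hm : ∀ᶠ x in 𝓝 (1 : ℝ), x ≠ -1 ∧ ¬ x < -1 := by
    filter_upwards [lt_mem_nhds (show (-1 : ℝ) < 1 by norm_num)] with x hx
    exact ⟨hx.ne', not_lt.2 hx.le⟩
  refine ⟨?_, _, _, h.hasDerivJump_aux (b := c₁) ?_ ?_ ?_,
    h.hasDerivJump_aux (b := 0) ?_ ?_ ?_, by ring⟩
  · filter_upwards [self_mem_nhdsWithin, nhdsWithin_le_nhds hm] with x h1 h2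
    exact (h.hasDerivAt h1 h2.1).differentiableAt
  · filter_upwards [self_mem_nhdsWithin] with x hx using ne_of_gt hx
  · filter_upwards [nhdsWithin_le_nhds hm] with x hx using hx.1
  · filter_upwards [self_mem_nhdsWithin, nhdsWithin_le_nhds hm] with x h1 h2
    rw [if_pos (mem_Ioi.1 h1), if_neg h2.2, sub_zero]
  · filter_upwards [self_mem_nhdsWithin] with x hx using ne_of_lt hx
  · filter_upwards [nhdsWithin_le_nhds hm] with x hx using hx.1
  · filter_upwards [self_mem_nhdsWithin, nhdsWithin_le_nhds hm] with x h1 h2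
    rw [if_neg (not_lt.2 (le_of_lt h1)), if_neg h2.2, sub_zero]

theorem hasDerivJump_neg_one (h : PiecewiseH2 u p w c₁ c₂) : HasDerivJump u (-1) c₂ := by
  have hm : ∀ᶠ x in 𝓝 (-1 : ℝ), x ≠ 1 ∧ ¬ 1 < x := by
    filter_upwards [gt_mem_nhds (show (-1 : ℝ) < 1 by norm_num)] with x hx
    exact ⟨hx.ne, not_lt.2 hx.le⟩
  refine ⟨?_, _, _, h.hasDerivJump_aux (b := 0) ?_ ?_ ?_,
    h.hasDerivJump_aux (b := -c₂) ?_ ?_ ?_, by ring⟩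
  · filter_upwards [self_mem_nhdsWithin, nhdsWithin_le_nhds hm] with x h1 h2
    exact (h.hasDerivAt h2.1 h1).differentiableAt
  · filter_upwards [nhdsWithin_le_nhds hm] with x hx using hx.1
  · filter_upwards [self_mem_nhdsWithin] with x hx using ne_of_gt hx
  · filter_upwards [self_mem_nhdsWithin, nhdsWithin_le_nhds hm] with x h1 h2
    rw [if_neg h2.2, if_neg (not_lt.2 (le_of_lt h1)), sub_zero]
  · filter_upwards [nhdsWithin_le_nhds hm] with x hx using hx.1
  · filter_upwards [self_mem_nhdsWithin] with x hx using ne_of_lt hx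
  · filter_upwards [self_mem_nhdsWithin, nhdsWithin_le_nhds hm] with x h1 h2
    rw [if_neg h2.2, if_pos (mem_Iio.1 h1), zero_sub]

theorem hasWeakDeriv_deriv (h : PiecewiseH2 u p w c₁ c₂) {I : Set ℝ} (h1 : (1 : ℝ) ∉ I)
    (h2 : (-1 : ℝ) ∉ I) : HasWeakDeriv I p w :=
  h.prim_p.hasWeakDeriv_of_jump h.prim_u.locallyIntegrable h1 h2

theorem memSobolev_one (h : PiecewiseH2 u p w c₁ c₂) (I : Set ℝ) : MemSobolev 1 I u :=
  ⟨h.memLp_u.restrict I, p, h.prim_u.hasWeakDeriv I, h.memLp_p.restrict I⟩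

theorem memSobolev_two (h : PiecewiseH2 u p w c₁ c₂) {I : Set ℝ} (h1 : (1 : ℝ) ∉ I)
    (h2 : (-1 : ℝ) ∉ I) : MemSobolev 2 I u :=
  ⟨h.memLp_u.restrict I, p, h.prim_u.hasWeakDeriv I, h.memLp_p.restrict I, w,
    h.hasWeakDeriv_deriv h1 h2, h.memLp_w.restrict I⟩

theorem isOscillatorImage (h : PiecewiseH2 u p w c₁ c₂) {r : ℝ} {f : ℝ → ℂ}
    (hf : f =ᵐ[volume] fun x => -w x + (r : ℂ) * u x) : IsOscillatorImage r u f :=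
  ⟨p, w, h.prim_u.hasWeakDeriv _, h.hasWeakDeriv_deriv (by simp) (by simp), hf⟩

end PiecewiseH2

/-- By du Bois-Reymond twice, v = Q + k and u is a primitive of Q + k, both almost everywhere;
continuity of u makes the second identity pointwise. As Q does not depend on I, passing to another
interval changes only k. -/
theorem eq_on_of_hasWeakDeriv {I : Set ℝ} (hI : IsOpen I) (hI' : I.OrdConnected)
    {u v w Q : ℝ → ℂ} (hu : Continuous u) (huv : HasWeakDeriv I u v) (hvw : HasWeakDeriv I v w)
    (hQ : IsPrim Q w) : ∃ k : ℂ, ∀ x ∈ I, HasDerivAt u (Q x + k) x := by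
  obtain ⟨k, hk⟩ := hvw.ae_eq_add_const hI hI' hQ (Eventually.of_forall fun _ _ => rfl)
  have hc : Continuous fun x => Q x + k := hQ.continuous.add continuous_const
  have hV : IsPrim (fun x => ∫ t in (0 : ℝ)..x, (Q t + k)) (fun x => Q x + k) :=
    IsPrim.of_eq_integral hc.locallyIntegrable 0 fun x => by simp
  obtain ⟨C, hC⟩ := huv.ae_eq_add_const hI hI' hV hk
  have he : EqOn u (fun x => (∫ t in (0 : ℝ)..x, (Q t + k)) + C) I :=
    Measure.eqOn_open_of_ae_eq (μ := volume) ((ae_restrict_iff' hI.measurableSet).2 hC) hI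
      hu.continuousOn (hV.continuous.add continuous_const).continuousOn
  refine ⟨k, fun x hx => ?_⟩
  have hd := (intervalIntegral.integral_hasDerivAt_right (hc.intervalIntegrable 0 x)
    hc.stronglyMeasurable.stronglyMeasurableAtFilter hc.continuousAt).add_const C
  exact hd.congr_of_eventuallyEq (he.eventuallyEq_of_mem (hI.mem_nhds hx))

theorem HasDerivJump.eq_of_hasDerivAt {u Q : ℝ → ℂ} {o : ℝ} {J k k' : ℂ} (h : HasDerivJump u o J)
    (hQ : Continuous Q) (hr : ∀ᶠ x in 𝓝[>] o, HasDerivAt u (Q x + k) x)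
    (hl : ∀ᶠ x in 𝓝[<] o, HasDerivAt u (Q x + k') x) : J = k - k' := by
  obtain ⟨-, a, b, ha, hb, rfl⟩ := h
  have ea : a = Q o + k := tendsto_nhds_unique ha
    (((hQ.continuousAt.continuousWithinAt (s := Ioi o)).add_const k).congr'
      (hr.mono fun x hx => hx.deriv.symm))
  have eb : b = Q o + k' := tendsto_nhds_unique hb
    (((hQ.continuousAt.continuousWithinAt (s := Iio o)).add_const k').congr'
      (hl.mono fun x hx => hx.deriv.symm))
  rw [ea, eb]; ring

/-- One primitive Q of ru - f serves all three intervals, on which u' = Q + k₁, Q + k₂, Q + k₃. The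
jumps are the differences of the constants, so u' is Q + k₂ corrected by J₁ right of 1 and by -J₂
left of -1. -/
theorem IsOscillatorImage.exists_piecewiseH2 {r : ℝ} {u f : ℝ → ℂ} {J₁ J₂ : ℂ}
    (h : IsOscillatorImage r u f) (hc : Continuous u) (hu : MemLp u 2) (hf : MemLp f 2)
    (h1 : HasDerivJump u 1 J₁) (h2 : HasDerivJump u (-1) J₂) :
    ∃ p, PiecewiseH2 u p (fun x => (r : ℂ) * u x - f x) J₁ J₂ := by
  obtain ⟨v, w, huv, hvw, hfw⟩ := h
  have hw2 : MemLp (fun x => (r : ℂ) * u x - f x) 2 := (hu.const_mul _).sub hf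
  have hwe : w =ᵐ[volume] fun x => (r : ℂ) * u x - f x := by
    filter_upwards [hfw] with x hx
    rw [hx]; ring
  set W : ℝ → ℂ := fun x => (r : ℂ) * u x - f x
  have hWl : LocallyIntegrable W := hw2.locallyIntegrable (by norm_num)
  have hvW : HasWeakDeriv {1, -1}ᶜ v W := by
    refine ⟨hvw.1, hWl.locallyIntegrableOn _, fun φ hφ hc hs => ?_⟩
    rw [hvw.2.2 φ hφ hc hs]
    congr 1
    refine integral_congr_ae (ae_restrict_of_ae ?_)
    filter_upwards [hwe] with x hx
    rw [hx]
  set Q : ℝ → ℂ := fun x => ∫ t in (0 : ℝ)..x, W t with hQdef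
  have hQ : IsPrim Q W := IsPrim.of_eq_integral hWl 0 fun x => by simp [hQdef]
  have s1 : Iio (-1 : ℝ) ⊆ {1, -1}ᶜ := fun x hx => by
    simp only [mem_compl_iff, mem_insert_iff, mem_singleton_iff, not_or, mem_Iio] at *
    constructor <;> linarith
  have s2 : Ioo (-1 : ℝ) 1 ⊆ {1, -1}ᶜ := fun x hx => by
    simp only [mem_compl_iff, mem_insert_iff, mem_singleton_iff, not_or, mem_Ioo] at *
    exact ⟨hx.2.ne, hx.1.ne'⟩
  have s3 : Ioi (1 : ℝ) ⊆ {1, -1}ᶜ := fun x hx => by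
    simp only [mem_compl_iff, mem_insert_iff, mem_singleton_iff, not_or, mem_Ioi] at *
    exact ⟨hx.ne', by linarith⟩
  obtain ⟨k₁, hk₁⟩ := eq_on_of_hasWeakDeriv isOpen_Iio ordConnected_Iio hc (huv.mono s1)
    (hvW.mono s1) hQ
  obtain ⟨k₂, hk₂⟩ := eq_on_of_hasWeakDeriv isOpen_Ioo ordConnected_Ioo hc (huv.mono s2)
    (hvW.mono s2) hQ
  obtain ⟨k₃, hk₃⟩ := eq_on_of_hasWeakDeriv isOpen_Ioi ordConnected_Ioi hc (huv.mono s3)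
    (hvW.mono s3) hQ
  have e1 : J₁ = k₃ - k₂ := h1.eq_of_hasDerivAt hQ.continuous
    (by filter_upwards [self_mem_nhdsWithin] with x hx using hk₃ x hx)
    (by filter_upwards [Ioo_mem_nhdsLT (show (-1 : ℝ) < 1 by norm_num)] with x hx using hk₂ x hx)
  have e2 : J₂ = k₂ - k₁ := h2.eq_of_hasDerivAt hQ.continuous
    (by filter_upwards [Ioo_mem_nhdsGT (show (-1 : ℝ) < 1 by norm_num)] with x hx using hk₂ x hx)
    (by filter_upwards [self_mem_nhdsWithin] with x hx using hk₁ x hx)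
  have hP : LocallyIntegrable fun x => Q x + k₂ + (Ioi 1).indicator (fun _ => J₁) x -
      (Iio (-1)).indicator (fun _ => J₂) x :=
    ((hQ.continuous.add continuous_const).locallyIntegrable.add
      ((locallyIntegrable_const _).indicator measurableSet_Ioi)).sub
      ((locallyIntegrable_const _).indicator measurableSet_Iio)
  refine ⟨_, PiecewiseH2.of_prim hu hw2
    (IsPrim.of_hasDerivAt (s := {1, -1}) (Set.toFinite _).countable hc hP fun x hx => ?_) ?_⟩
  · simp only [mem_insert_iff, mem_singleton_iff, not_or] at hx
    rcases lt_or_gt_of_ne hx.2 with h | h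
    · rw [indicator_of_notMem (by simp; linarith), indicator_of_mem (by simpa using h), e2]
      convert hk₁ x h using 1
      ring
    · rcases lt_or_gt_of_ne hx.1 with h' | h'
      · rw [indicator_of_notMem (by simp; linarith), indicator_of_notMem (by simp; linarith)]
        convert hk₂ x ⟨h, h'⟩ using 1
        ring
      · rw [indicator_of_mem (by simpa using h'), indicator_of_notMem (by simp; linarith), e1]
        convert hk₃ x h' using 1
        ring
  · convert hQ.add_const k₂ using 2
    simp only [indicator, mem_Ioi, mem_Iio]
    ring

/-! ### Test functions -/

theorem piecewiseH2_of_test {φ : ℝ → ℝ} (hφ : ContDiff ℝ ∞ φ) (hc : HasCompactSupport φ) :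
    PiecewiseH2 (fun x => (φ x : ℂ)) (fun x => ((deriv φ x : ℝ) : ℂ))
      (fun x => ((deriv (deriv φ) x : ℝ) : ℂ)) 0 0 := by
  have key : ∀ ψ : ℝ → ℝ, ContDiff ℝ ∞ ψ →
      IsPrim (fun x => (ψ x : ℂ)) (fun x => ((deriv ψ x : ℝ) : ℂ)) := fun ψ hψ =>
    IsPrim.of_hasDerivAt countable_empty (Complex.continuous_ofReal.comp hψ.continuous)
      (Complex.continuous_ofReal.comp (hψ.continuous_deriv (by simp))).locallyIntegrable
      fun x _ => ((hψ.differentiable (by simp) x).hasDerivAt).ofReal_comp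
  have hφ' : ContDiff ℝ ∞ (deriv φ) := (contDiff_infty_iff_deriv.1 hφ).2
  have hd : Continuous (deriv (deriv φ)) := hφ'.continuous_deriv (by simp)
  refine ⟨(hφ.continuous.memLp_of_hasCompactSupport hc).ofReal,
    (hφ'.continuous.memLp_of_hasCompactSupport hc.deriv).ofReal,
    (hd.memLp_of_hasCompactSupport hc.deriv.deriv).ofReal, key φ hφ, ?_⟩
  simpa using key _ hφ'

/-- Cutting F off at a zero o keeps it continuous, and the derivative formula fails at most at the
single point o. -/
theorem isPrim_indicator {F f : ℝ → ℂ} {s : Set ℝ} {o : ℝ} (hs : MeasurableSet s)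
    (hso : ∀ x ≠ o, s ∈ 𝓝 x ∨ sᶜ ∈ 𝓝 x) (ho : o ∉ s) (hF : F o = 0)
    (hFc : Continuous F) (hf : Continuous f) (h : ∀ x, HasDerivAt F (f x) x) :
    IsPrim (s.indicator F) (s.indicator f) := by
  have hd : ∀ x ≠ o, HasDerivAt (s.indicator F) (s.indicator f x) x := by
    intro x hx
    rcases hso x hx with hm | hm
    · rw [indicator_of_mem (mem_of_mem_nhds hm)]
      refine (h x).congr_of_eventuallyEq ?_
      filter_upwards [hm] with y hy using indicator_of_mem hy F
    · rw [indicator_of_notMem (mem_of_mem_nhds hm)]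
      refine (hasDerivAt_const x (0 : ℂ)).congr_of_eventuallyEq ?_
      filter_upwards [hm] with y hy using indicator_of_notMem hy F
  refine IsPrim.of_hasDerivAt (s := {o}) (Set.countable_singleton o) ?_
    (hf.locallyIntegrable.indicator hs) fun x hx => hd x hx
  refine continuous_iff_continuousAt.2 fun x => ?_
  by_cases hx : x = o
  · subst hx
    rw [ContinuousAt, indicator_of_notMem ho]
    refine squeeze_zero_norm (a := fun y => ‖F y‖) (fun y => norm_indicator_le_norm_self F y) ?_
    simpa [hF] using (hFc.continuousAt (x := x)).norm.tendsto
  · exact (hd x hx).continuousAt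

theorem exists_test_linear (o c : ℝ) : ∃ F : ℝ → ℝ, ContDiff ℝ ∞ F ∧ HasCompactSupport F ∧
    F o = 0 ∧ deriv F o = c := by
  obtain ⟨f, -, h2, h3, -, h5⟩ :=
    exists_contDiff_tsupport_subset (n := (⊤ : ℕ∞)) (x := o) univ_mem
  refine ⟨fun x => c * (x - o) * f x, (contDiff_const.mul (contDiff_id.sub contDiff_const)).mul h3,
    h2.mul_left, by simp, ?_⟩
  have := (((hasDerivAt_id o).sub_const o).const_mul c).mul (h3.differentiable (by simp) o).hasDerivAt
  have e := this.deriv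
  simp only [id, sub_self, zero_mul, mul_zero, add_zero, mul_one, h5] at e
  exact e

/-- A function vanishing at `1` and `-1` whose derivative has a unit jump at `1` only. -/
theorem exists_piecewiseH2_jump_one : ∃ u p w : ℝ → ℂ, PiecewiseH2 u p w 1 0 ∧ u 1 = 0 ∧
    u (-1) = 0 := by
  -- F vanishes at 1 with slope 1; its restriction to x > 1, extended by 0, has derivative jump 1
  -- there and is zero at -1.
  obtain ⟨F, hF, hFc, h0, h1⟩ := exists_test_linear 1 1
  have T := piecewiseH2_of_test hF hFc
  have hF' : ContDiff ℝ ∞ (deriv F) := (contDiff_infty_iff_deriv.1 hF).2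
  have hd : Continuous (deriv (deriv F)) := hF'.continuous_deriv (by simp)
  have hso : ∀ x ≠ (1 : ℝ), Ioi (1 : ℝ) ∈ 𝓝 x ∨ (Ioi (1 : ℝ))ᶜ ∈ 𝓝 x := by
    intro x hx
    rcases lt_or_gt_of_ne hx with h | h
    · right; rw [compl_Ioi]; exact Iic_mem_nhds h
    · left; exact Ioi_mem_nhds h
  refine ⟨(Ioi 1).indicator fun x => (F x : ℂ), _,
    (Ioi 1).indicator fun x => ((deriv (deriv F) x : ℝ) : ℂ),
    PiecewiseH2.of_prim (T.memLp_u.indicator measurableSet_Ioi)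
      (T.memLp_w.indicator measurableSet_Ioi) (isPrim_indicator (o := 1) measurableSet_Ioi hso
      (by simp) (by simp [h0]) T.continuous (Complex.continuous_ofReal.comp hF'.continuous)
      fun x => ((hF.differentiable (by simp) x).hasDerivAt).ofReal_comp) ?_, by simp,
    indicator_of_notMem (by norm_num) _⟩
  have := isPrim_indicator (o := 1) (s := Ioi 1) (F := fun x => ((deriv F x : ℝ) : ℂ) - 1)
    (f := fun x => ((deriv (deriv F) x : ℝ) : ℂ))
    measurableSet_Ioi hso (by simp) (by simp [h1])
    ((Complex.continuous_ofReal.comp hF'.continuous).sub continuous_const)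
    (Complex.continuous_ofReal.comp hd)
    fun x => (((hF'.differentiable (by simp) x).hasDerivAt).ofReal_comp).sub_const 1
  convert this using 2 with x
  by_cases hx : 1 < x <;> simp [indicator, hx]

/-- A function vanishing at `1` and `-1` whose derivative has a unit jump at `-1` only. -/
theorem exists_piecewiseH2_jump_neg_one : ∃ u p w : ℝ → ℂ, PiecewiseH2 u p w 0 1 ∧ u 1 = 0 ∧
    u (-1) = 0 := by
  -- The slope is -1 because F is kept to the left of -1: the jump is then 0 - (-1) = 1.
  obtain ⟨F, hF, hFc, h0, h1⟩ := exists_test_linear (-1) (-1)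
  have T := piecewiseH2_of_test hF hFc
  have hF' : ContDiff ℝ ∞ (deriv F) := (contDiff_infty_iff_deriv.1 hF).2
  have hd : Continuous (deriv (deriv F)) := hF'.continuous_deriv (by simp)
  have hso : ∀ x ≠ (-1 : ℝ), Iio (-1 : ℝ) ∈ 𝓝 x ∨ (Iio (-1 : ℝ))ᶜ ∈ 𝓝 x := by
    intro x hx
    rcases lt_or_gt_of_ne hx with h | h
    · left; exact Iio_mem_nhds h
    · right; rw [compl_Iio]; exact Ici_mem_nhds h
  refine ⟨(Iio (-1)).indicator fun x => (F x : ℂ), _,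
    (Iio (-1)).indicator fun x => ((deriv (deriv F) x : ℝ) : ℂ),
    PiecewiseH2.of_prim (T.memLp_u.indicator measurableSet_Iio)
      (T.memLp_w.indicator measurableSet_Iio) (isPrim_indicator (o := -1) measurableSet_Iio hso
      (by simp) (by simp [h0]) T.continuous (Complex.continuous_ofReal.comp hF'.continuous)
      fun x => ((hF.differentiable (by simp) x).hasDerivAt).ofReal_comp) ?_,
    indicator_of_notMem (by norm_num) _, by simp⟩
  have := isPrim_indicator (o := -1) (s := Iio (-1)) (F := fun x => ((deriv F x : ℝ) : ℂ) + 1)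
    (f := fun x => ((deriv (deriv F) x : ℝ) : ℂ))
    measurableSet_Iio hso (by simp) (by simp [h1])
    ((Complex.continuous_ofReal.comp hF'.continuous).add continuous_const)
    (Complex.continuous_ofReal.comp hd)
    fun x => (((hF'.differentiable (by simp) x).hasDerivAt).ofReal_comp).add_const 1
  convert this using 2 with x
  by_cases hx : x < -1 <;> simp [indicator, hx]

/-! ### Orthonormality of the Hermite functions -/

open Polynomial in
theorem integrable_polynomial_mul_gaussian (p : ℝ[X]) :
    Integrable fun y : ℝ => p.eval y * Real.exp (-y ^ 2 / 2) := by
  have h : ∀ k : ℕ, Integrable fun y : ℝ => y ^ k * Real.exp (-y ^ 2 / 2) := fun k => by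
    have := integrable_rpow_mul_exp_neg_mul_sq (b := 1 / 2) (by norm_num) (s := (k : ℝ))
      (by have : (0 : ℝ) ≤ k := Nat.cast_nonneg _
          linarith)
    refine this.congr (Eventually.of_forall fun y => ?_)
    simp only [Real.rpow_natCast]
    congr 2
    ring
  have e : (fun y : ℝ => p.eval y * Real.exp (-y ^ 2 / 2)) = fun y =>
      ∑ k ∈ Finset.range (p.natDegree + 1), p.coeff k * (y ^ k * Real.exp (-y ^ 2 / 2)) := by
    ext y
    rw [eval_eq_sum_range, Finset.sum_mul]
    exact Finset.sum_congr rfl fun k _ => by ring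
  rw [e]
  exact integrable_finsetSum _ fun k _ => (h k).const_mul _

/-- The probabilists' Hermite polynomial with real coefficients. -/
def realHermite (n : ℕ) : Polynomial ℝ := (Polynomial.hermite n).map (Int.castRingHom ℝ)

theorem hermiteFun_eq (n : ℕ) (q : ℝ) : hermiteFun n q =
    (√((n.factorial : ℝ) * √Real.pi))⁻¹ * (realHermite n).eval (√2 * q) * Real.exp (-q ^ 2 / 2) := by
  rw [hermiteFun, realHermite, Polynomial.aeval_def, Polynomial.eval_map]
  rfl

theorem realHermite_monic (n : ℕ) : (realHermite n).Monic :=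
  (Polynomial.hermite_monic n).map _

theorem natDegree_realHermite (n : ℕ) : (realHermite n).natDegree = n := by
  rw [realHermite, (Polynomial.hermite_monic n).natDegree_map, Polynomial.natDegree_hermite]

open Polynomial in
theorem realHermite_succ (n : ℕ) :
    realHermite (n + 1) = X * realHermite n - derivative (realHermite n) := by
  simp [realHermite, hermite_succ, derivative_map]

open Polynomial in
-- Rodrigues' formula in the form (He_n e^{-y²/2})' = -He_{n+1} e^{-y²/2}, followed by integration
-- by parts.
theorem integral_mul_realHermite_succ (p : ℝ[X]) (n : ℕ) :
    ∫ y : ℝ, p.eval y * (realHermite (n + 1)).eval y * Real.exp (-y ^ 2 / 2) =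
      ∫ y : ℝ, (derivative p).eval y * (realHermite n).eval y * Real.exp (-y ^ 2 / 2) := by
  have hg : ∀ y : ℝ, HasDerivAt (fun y : ℝ => (realHermite n).eval y * Real.exp (-y ^ 2 / 2))
      (-((realHermite (n + 1)).eval y * Real.exp (-y ^ 2 / 2))) y := by
    intro y
    have h1 := (realHermite n).hasDerivAt y
    have h2 : HasDerivAt (fun y : ℝ => Real.exp (-y ^ 2 / 2)) (Real.exp (-y ^ 2 / 2) * (-y)) y := by
      have : HasDerivAt (fun y : ℝ => -y ^ 2 / 2) (-y) y := by
        refine (((hasDerivAt_id y).pow 2).neg.div_const 2).congr_deriv ?_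
        simp
        ring
      exact this.exp
    refine (h1.mul h2).congr_deriv ?_
    rw [realHermite_succ]
    simp
    ring
  have key := integral_mul_deriv_eq_deriv_mul_of_integrable (u := fun y => p.eval y)
    (u' := fun y => (derivative p).eval y) (fun y _ => p.hasDerivAt y) (fun y _ => hg y) ?_ ?_ ?_
  · simp only [mul_neg, integral_neg, neg_inj, ← mul_assoc] at key
    exact key
  · convert (integrable_polynomial_mul_gaussian (p * realHermite (n + 1))).neg using 1
    ext y; simp; ring
  · convert integrable_polynomial_mul_gaussian (derivative p * realHermite n) using 1
    ext y; simp; ring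
  · convert integrable_polynomial_mul_gaussian (p * realHermite n) using 1
    ext y; simp; ring

open Polynomial in
theorem integral_mul_realHermite (p : ℝ[X]) (n : ℕ) :
    ∫ y : ℝ, p.eval y * (realHermite n).eval y * Real.exp (-y ^ 2 / 2) =
      ∫ y : ℝ, (derivative^[n] p).eval y * Real.exp (-y ^ 2 / 2) := by
  induction n generalizing p with
  | zero => simp [realHermite]
  | succ n ih => rw [integral_mul_realHermite_succ, ih, Function.iterate_succ_apply]

theorem integral_gaussian_half : ∫ y : ℝ, Real.exp (-y ^ 2 / 2) = √2 * √Real.pi := by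
  have := integral_gaussian (1 / 2)
  rw [← Real.sqrt_mul (by norm_num)]
  convert this using 3
  · ring_nf
  · field_simp

open Polynomial in
-- Moving n derivatives onto a monic polynomial of degree m gives 0 for m < n and the constant n!
-- for m = n; the remaining case follows by exchanging the factors.
theorem integral_realHermite_mul (m n : ℕ) :
    ∫ y : ℝ, (realHermite m).eval y * (realHermite n).eval y * Real.exp (-y ^ 2 / 2) =
      if m = n then (n.factorial : ℝ) * (√2 * √Real.pi) else 0 := by
  have lt : ∀ m n, m < n → ∫ y : ℝ, (realHermite m).eval y * (realHermite n).eval y *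
      Real.exp (-y ^ 2 / 2) = 0 := fun m n h => by
    rw [integral_mul_realHermite, iterate_derivative_eq_zero (by rwa [natDegree_realHermite])]
    simp
  rcases lt_trichotomy m n with h | rfl | h
  · rw [lt m n h, if_neg h.ne]
  · have hc : derivative^[m] (realHermite m) = C (m.factorial : ℝ) := by
      have hd : (derivative^[m] (realHermite m)).natDegree ≤ 0 :=
        (natDegree_iterate_derivative _ _).trans (by rw [natDegree_realHermite, Nat.sub_self])
      rw [eq_C_of_natDegree_le_zero hd, coeff_iterate_derivative, zero_add,
        Nat.descFactorial_self]
      have : (realHermite m).coeff m = 1 := by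
        have := (realHermite_monic m).coeff_natDegree
        rwa [natDegree_realHermite] at this
      rw [this, nsmul_eq_mul, mul_one]
    rw [integral_mul_realHermite, hc, if_pos rfl]
    simp only [eval_C]
    rw [integral_const_mul, integral_gaussian_half]
  · rw [if_neg h.ne', ← lt n m h]
    simp only [mul_comm]

theorem integral_hermiteFun_mul (m n : ℕ) :
    ∫ q : ℝ, hermiteFun m q * hermiteFun n q = if m = n then 1 else 0 := by
  have e : ∀ q : ℝ, hermiteFun m q * hermiteFun n q =
      (√((m.factorial : ℝ) * √Real.pi))⁻¹ * (√((n.factorial : ℝ) * √Real.pi))⁻¹ *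
      (fun y : ℝ => (realHermite m).eval y * (realHermite n).eval y * Real.exp (-y ^ 2 / 2))
        (√2 * q) := by
    intro q
    have : Real.exp (-(√2 * q) ^ 2 / 2) = Real.exp (-q ^ 2 / 2) * Real.exp (-q ^ 2 / 2) := by
      rw [← Real.exp_add, mul_pow, Real.sq_sqrt (by norm_num)]
      congr 1; ring
    simp only [this]
    rw [hermiteFun_eq, hermiteFun_eq]
    ring
  simp only [e]
  -- The substitution y = √2 q contributes 1/√2, which cancels the √2 of the Gaussian integral.
  rw [integral_const_mul, Measure.integral_comp_mul_left (fun y : ℝ =>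
    (realHermite m).eval y * (realHermite n).eval y * Real.exp (-y ^ 2 / 2)), integral_realHermite_mul]
  split_ifs with h
  · subst h
    have : (√((m.factorial : ℝ) * √Real.pi)) * √((m.factorial : ℝ) * √Real.pi) =
      (m.factorial : ℝ) * √Real.pi := Real.mul_self_sqrt (by positivity)
    have h0 : (m.factorial : ℝ) * √Real.pi ≠ 0 := by positivity
    rw [← mul_inv, this, abs_of_pos (by positivity), smul_eq_mul]
    field_simp
  · simp

/-! ### Completeness of the Hermite functions -/

theorem MemLp_mul_prod {f g : ℝ → ℝ} (hf : MemLp f 2) (hg : MemLp g 2) :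
    MemLp (fun q : ℝ × ℝ => f q.1 * g q.2) 2 := by
  have h1 := (memLp_two_iff_integrable_sq hf.1).1 hf
  have h2 := (memLp_two_iff_integrable_sq hg.1).1 hg
  refine (memLp_two_iff_integrable_sq (μ := (volume : Measure ℝ).prod volume)
    (hf.1.comp_fst.mul hg.1.comp_snd)).2 ?_
  refine (h1.mul_prod h2).congr (Eventually.of_forall fun q => ?_)
  simp only [Pi.mul_apply, mul_pow]

open Polynomial in
theorem memLp_polynomial_mul_gaussian (p : ℝ[X]) :
    MemLp (fun q : ℝ => p.eval q * Real.exp (-q ^ 2 / 2)) 2 := by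
  have e : (fun y : ℝ => p.eval y * Real.exp (-y ^ 2 / 2)) = fun y =>
      ∑ k ∈ Finset.range (p.natDegree + 1), p.coeff k * (y ^ k * Real.exp (-y ^ 2 / 2)) := by
    ext y
    rw [eval_eq_sum_range, Finset.sum_mul]
    exact Finset.sum_congr rfl fun k _ => by ring
  rw [e]
  exact memLp_finsetSum _ fun k _ => (memLp_pow_mul_gaussian k).const_mul _

theorem memLp_exp_abs_mul_gaussian (a : ℝ) :
    MemLp (fun q : ℝ => Real.exp (a * |q|) * Real.exp (-q ^ 2 / 2)) 2 := by
  rw [memLp_two_iff_integrable_sq (by fun_prop)]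
  have h := (integrable_exp_neg_mul_sq (b := 1 / 2) (by norm_num)).const_mul (Real.exp (2 * a ^ 2))
  refine h.mono' (by fun_prop) (Eventually.of_forall fun q => ?_)
  rw [Real.norm_of_nonneg (sq_nonneg _), ← Real.exp_add, ← Real.exp_add, ← Real.exp_nat_mul,
    Real.exp_le_exp]
  -- This is 2a|q| ≤ q²/2 + 2a²: half of the Gaussian decay absorbs the exponential.
  have := sq_nonneg (|q| - 2 * a)
  have h2 : |q| ^ 2 = q ^ 2 := sq_abs q
  push_cast
  nlinarith

open Polynomial in
/-- The Hermite polynomials span all polynomials. -/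
theorem span_range_realHermite : Submodule.span ℝ (range realHermite) = ⊤ := by
  let S : Polynomial.Sequence ℝ := ⟨realHermite, fun n => by
    rw [degree_eq_natDegree (realHermite_monic n).ne_zero, natDegree_realHermite]⟩
  exact S.span fun i => by
    change IsUnit (realHermite i).leadingCoeff
    rw [realHermite_monic i]
    exact isUnit_one

/-- The product of two one-dimensional Gaussians. -/
def gaussianWeight (q : ℝ × ℝ) : ℝ := Real.exp (-q.1 ^ 2 / 2) * Real.exp (-q.2 ^ 2 / 2)

open Polynomial in
theorem integrable_mul_polynomial {g : ℝ × ℝ → ℝ} (hg : MemLp g 2) (p r : ℝ[X]) :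
    Integrable fun q : ℝ × ℝ => g q * (p.eval q.1 * r.eval q.2 * gaussianWeight q) := by
  have := hg.integrable_mul
    (MemLp_mul_prod (memLp_polynomial_mul_gaussian p) (memLp_polynomial_mul_gaussian r))
  refine this.congr (Eventually.of_forall fun q => ?_)
  simp only [gaussianWeight, Pi.mul_apply]
  ring

open Polynomial in
-- Hermite polynomials span all polynomials, so orthogonality extends by linearity, first in q₊ and
-- then in q₋. The Hermite functions involve the argument √2 q, hence the invertible rescaling T.
theorem integral_mul_polynomial_eq_zero {g : ℝ × ℝ → ℝ} (hg : MemLp g 2)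
    (h : ∀ m n, ∫ q : ℝ × ℝ, g q * (hermiteFun m q.1 * hermiteFun n q.2) = 0) (p r : ℝ[X]) :
    ∫ q : ℝ × ℝ, g q * (p.eval q.1 * r.eval q.2 * gaussianWeight q) = 0 := by
  set T : ℝ[X] → ℝ[X] := fun p => p.comp (C √2 * X) with hT
  have base : ∀ m n, ∫ q : ℝ × ℝ, g q * ((T (realHermite m)).eval q.1 *
      (T (realHermite n)).eval q.2 * gaussianWeight q) = 0 := by
    intro m n
    have h1 := h m n
    set a := (√((m.factorial : ℝ) * √Real.pi))⁻¹ with ha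
    set b := (√((n.factorial : ℝ) * √Real.pi))⁻¹ with hb
    have e : ∀ q : ℝ × ℝ, g q * (hermiteFun m q.1 * hermiteFun n q.2) = (a * b) *
        (g q * ((T (realHermite m)).eval q.1 * (T (realHermite n)).eval q.2 *
          gaussianWeight q)) := by
      intro q
      rw [hermiteFun_eq, hermiteFun_eq, ← ha, ← hb]
      simp only [hT, eval_comp, eval_mul, eval_C, eval_X, gaussianWeight]
      ring
    simp only [e] at h1
    rw [integral_const_mul] at h1
    refine (mul_eq_zero.1 h1).resolve_left ?_
    positivity
  have s1 : ∀ (n : ℕ) (p : ℝ[X]), ∫ q : ℝ × ℝ, g q * ((T p).eval q.1 *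
      (T (realHermite n)).eval q.2 * gaussianWeight q) = 0 := by
    intro n p
    have hp : p ∈ Submodule.span ℝ (range realHermite) := by rw [span_range_realHermite]; trivial
    induction hp using Submodule.span_induction with
    | mem x hx => obtain ⟨m, rfl⟩ := hx; exact base m n
    | zero => simp [hT]
    | add x y _ _ hx hy =>
      have := integral_add (integrable_mul_polynomial hg (T x) (T (realHermite n)))
        (integrable_mul_polynomial hg (T y) (T (realHermite n)))
      rw [hx, hy, add_zero] at this
      rw [← this]
      refine integral_congr_ae (Eventually.of_forall fun q => ?_)
      simp only [hT, add_comp, eval_add]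
      ring
    | smul c x _ hx =>
      have := integral_const_mul (μ := (volume : Measure (ℝ × ℝ))) c fun q : ℝ × ℝ => g q * ((T x).eval q.1 *
        (T (realHermite n)).eval q.2 * gaussianWeight q)
      rw [hx, mul_zero] at this
      rw [← this]
      refine integral_congr_ae (Eventually.of_forall fun q => ?_)
      simp only [hT, smul_comp, eval_smul, smul_eq_mul]
      ring
  have s2 : ∀ p r : ℝ[X], ∫ q : ℝ × ℝ, g q * ((T p).eval q.1 *
      (T r).eval q.2 * gaussianWeight q) = 0 := by
    intro p r
    have hr : r ∈ Submodule.span ℝ (range realHermite) := by rw [span_range_realHermite]; trivial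
    induction hr using Submodule.span_induction with
    | mem x hx => obtain ⟨m, rfl⟩ := hx; exact s1 m p
    | zero => simp [hT]
    | add x y _ _ hx hy =>
      have := integral_add (integrable_mul_polynomial hg (T p) (T x))
        (integrable_mul_polynomial hg (T p) (T y))
      rw [hx, hy, add_zero] at this
      rw [← this]
      refine integral_congr_ae (Eventually.of_forall fun q => ?_)
      simp only [hT, add_comp, eval_add]
      ring
    | smul c x _ hx =>
      have := integral_const_mul (μ := (volume : Measure (ℝ × ℝ))) c fun q : ℝ × ℝ => g q * ((T p).eval q.1 *
        (T x).eval q.2 * gaussianWeight q)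
      rw [hx, mul_zero] at this
      rw [← this]
      refine integral_congr_ae (Eventually.of_forall fun q => ?_)
      simp only [hT, smul_comp, eval_smul, smul_eq_mul]
      ring
  have inv : ∀ p : ℝ[X], T (p.comp (C (√2)⁻¹ * X)) = p := by
    intro p
    simp only [hT, comp_assoc, mul_comp, C_comp, X_comp]
    rw [← mul_assoc, ← C_mul, inv_mul_cancel₀ (by positivity), C_1, one_mul, comp_X]
  have := s2 (p.comp (C (√2)⁻¹ * X)) (r.comp (C (√2)⁻¹ * X))
  rwa [inv, inv] at this

open Polynomial in
theorem integral_mul_linear_pow_eq_zero {g : ℝ × ℝ → ℝ} (hg : MemLp g 2)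
    (h : ∀ m n, ∫ q : ℝ × ℝ, g q * (hermiteFun m q.1 * hermiteFun n q.2) = 0) (s t : ℝ) (k : ℕ) :
    ∫ q : ℝ × ℝ, g q * gaussianWeight q * (s * q.1 + t * q.2) ^ k = 0 := by
  have e : ∀ q : ℝ × ℝ, g q * gaussianWeight q * (s * q.1 + t * q.2) ^ k =
      ∑ j ∈ Finset.range (k + 1), (s ^ j * t ^ (k - j) * (k.choose j : ℝ)) *
        (g q * ((X ^ j : ℝ[X]).eval q.1 * (X ^ (k - j) : ℝ[X]).eval q.2 * gaussianWeight q)) := by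
    intro q
    rw [add_pow, Finset.mul_sum]
    refine Finset.sum_congr rfl fun j _ => ?_
    simp only [eval_pow, eval_X]
    ring
  simp only [e]
  rw [integral_finsetSum _ fun j _ => (integrable_mul_polynomial hg _ _).const_mul _]
  refine Finset.sum_eq_zero fun j _ => ?_
  rw [integral_const_mul, integral_mul_polynomial_eq_zero hg h, mul_zero]

theorem integrable_mul_exp_abs {g : ℝ × ℝ → ℝ} (hg : MemLp g 2) (s t : ℝ) :
    Integrable fun q : ℝ × ℝ => ‖g q * gaussianWeight q‖ * Real.exp (|s * q.1 + t * q.2|) := by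
  have h1 := hg.norm.integrable_mul
    (MemLp_mul_prod (memLp_exp_abs_mul_gaussian |s|) (memLp_exp_abs_mul_gaussian |t|))
  have hw : Continuous gaussianWeight := by unfold gaussianWeight; fun_prop
  refine h1.mono' ?_ (Eventually.of_forall fun q => ?_)
  · refine (hg.1.mul hw.aestronglyMeasurable).norm.mul ?_
    exact (by fun_prop : Continuous fun q : ℝ × ℝ =>
      Real.exp (|s * q.1 + t * q.2|)).aestronglyMeasurable
  · have hpos : 0 < gaussianWeight q := by unfold gaussianWeight; positivity
    have hle : Real.exp |s * q.1 + t * q.2| ≤ Real.exp (|s| * |q.1|) * Real.exp (|t| * |q.2|) := by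
      rw [← Real.exp_add, Real.exp_le_exp, ← abs_mul, ← abs_mul]
      exact abs_add_le _ _
    rw [Real.norm_of_nonneg (by positivity), norm_mul, Real.norm_of_nonneg hpos.le]
    simp only [Pi.mul_apply]
    calc ‖g q‖ * gaussianWeight q * Real.exp |s * q.1 + t * q.2|
        ≤ ‖g q‖ * gaussianWeight q * (Real.exp (|s| * |q.1|) * Real.exp (|t| * |q.2|)) := by gcongr
      _ = _ := by unfold gaussianWeight; ring

theorem integrable_mul_gaussianWeight {g : ℝ × ℝ → ℝ} (hg : MemLp g 2) :
    Integrable fun q : ℝ × ℝ => g q * gaussianWeight q := by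
  have := integrable_mul_polynomial hg 1 1
  simpa using this

/-- The Fourier transform of `g` times the Gaussian vanishes if `g` is orthogonal to all Hermite
functions. -/
theorem integral_mul_cexp_eq_zero {g : ℝ × ℝ → ℝ} (hg : MemLp g 2)
    (h : ∀ m n, ∫ q : ℝ × ℝ, g q * (hermiteFun m q.1 * hermiteFun n q.2) = 0) (s t : ℝ) :
    ∫ q : ℝ × ℝ, ((g q * gaussianWeight q : ℝ) : ℂ) *
      Complex.exp (((s * q.1 + t * q.2 : ℝ) : ℂ) * Complex.I) = 0 := by
  -- Terms of the exponential series. Their absolute values sum to |g| times the weight times e^{|s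
  -- q₊ + t q₋|}, which is integrable, so the series may be integrated term by term; each term is
  -- the integral of g against a polynomial times the weight.
  set F : ℕ → ℝ × ℝ → ℂ := fun k q => ((g q * gaussianWeight q : ℝ) : ℂ) *
    ((((s * q.1 + t * q.2 : ℝ) : ℂ) * Complex.I) ^ k / (k.factorial : ℂ)) with hF
  have hG := integrable_mul_gaussianWeight hg
  have hb : ∀ q : ℝ × ℝ, HasSum (fun k : ℕ => ‖g q * gaussianWeight q‖ *
      (|s * q.1 + t * q.2| ^ k / (k.factorial : ℝ)))
      (‖g q * gaussianWeight q‖ * Real.exp (|s * q.1 + t * q.2|)) := by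
    intro q
    have := NormedSpace.expSeries_div_hasSum_exp (𝔸 := ℝ) (|s * q.1 + t * q.2|)
    rw [← Real.exp_eq_exp_ℝ] at this
    exact this.mul_left _
  have key := hasSum_integral_of_dominated_convergence (μ := (volume : Measure (ℝ × ℝ))) (F := F)
    (f := fun q => ((g q * gaussianWeight q : ℝ) : ℂ) *
      Complex.exp (((s * q.1 + t * q.2 : ℝ) : ℂ) * Complex.I))
    (fun k q => ‖g q * gaussianWeight q‖ * (|s * q.1 + t * q.2| ^ k / (k.factorial : ℝ)))
    (fun k => hG.ofReal.1.mul
      (by fun_prop : Continuous fun q : ℝ × ℝ => (((s * q.1 + t * q.2 : ℝ) : ℂ) * Complex.I) ^ k /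
        (k.factorial : ℂ)).aestronglyMeasurable)
    (fun k => Eventually.of_forall fun q => by
      simp only [hF]
      rw [norm_mul, norm_div, norm_pow, norm_mul, Complex.norm_I, mul_one, Complex.norm_real,
        Complex.norm_real, Complex.norm_natCast, Real.norm_eq_abs (s * q.1 + t * q.2)])
    (Eventually.of_forall fun q => (hb q).summable)
    ((integrable_mul_exp_abs hg s t).congr (Eventually.of_forall fun q => (hb q).tsum_eq.symm))
    (Eventually.of_forall fun q => by
      have := NormedSpace.expSeries_div_hasSum_exp (𝔸 := ℂ)
        (((s * q.1 + t * q.2 : ℝ) : ℂ) * Complex.I)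
      rw [← Complex.exp_eq_exp_ℂ] at this
      exact this.mul_left _)
  have hz : ∀ k, ∫ q, F k q = 0 := by
    intro k
    have e : ∀ q, F k q = (Complex.I ^ k / (k.factorial : ℂ)) *
        ((g q * gaussianWeight q * (s * q.1 + t * q.2) ^ k : ℝ) : ℂ) := by
      intro q
      simp only [hF]
      push_cast
      rw [mul_pow]
      ring
    simp only [e]
    rw [integral_const_mul, integral_complex_ofReal, integral_mul_linear_pow_eq_zero hg h]
    simp
  simp only [hz] at key
  exact (key.unique hasSum_zero)

/-- An integrable function on the plane is determined by its Fourier transform. -/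
theorem ae_eq_zero_of_integral_mul_cexp {G : ℝ × ℝ → ℝ} (hG : Integrable G)
    (h : ∀ s t : ℝ, ∫ q : ℝ × ℝ, (G q : ℂ) *
      Complex.exp (((s * q.1 + t * q.2 : ℝ) : ℂ) * Complex.I) = 0) : G =ᵐ[volume] 0 := by
  -- The positive and negative parts of G are densities of finite measures with equal characteristic
  -- functions, so the two measures and then the two densities coincide.
  set f₁ : ℝ × ℝ → ℝ≥0∞ := fun q => ENNReal.ofReal (G q)
  set f₂ : ℝ × ℝ → ℝ≥0∞ := fun q => ENNReal.ofReal (-G q)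
  have m1 : AEMeasurable f₁ := hG.1.aemeasurable.ennreal_ofReal
  have m2 : AEMeasurable f₂ := hG.1.aemeasurable.neg.ennreal_ofReal
  have i1 : ∫⁻ q, f₁ q ≠ ⊤ := hG.lintegral_lt_top.ne
  have i2 : ∫⁻ q, f₂ q ≠ ⊤ := hG.neg.lintegral_lt_top.ne
  have : IsFiniteMeasure ((volume : Measure (ℝ × ℝ)).withDensity f₁) := isFiniteMeasure_withDensity
    i1
  have : IsFiniteMeasure ((volume : Measure (ℝ × ℝ)).withDensity f₂) := isFiniteMeasure_withDensity
    i2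
  have hμ : (volume : Measure (ℝ × ℝ)).withDensity f₁ = volume.withDensity f₂ := by
    refine Measure.ext_of_charFunDual ?_
    ext L
    rw [charFunDual_apply, charFunDual_apply, integral_withDensity_eq_integral_toReal_smul₀ m1
      (Eventually.of_forall fun q => ENNReal.ofReal_lt_top),
      integral_withDensity_eq_integral_toReal_smul₀ m2
      (Eventually.of_forall fun q => ENNReal.ofReal_lt_top)]
    have hL : ∀ q : ℝ × ℝ, L q = L (1, 0) * q.1 + L (0, 1) * q.2 := by
      intro q
      have : q = q.1 • ((1 : ℝ), (0 : ℝ)) + q.2 • ((0 : ℝ), (1 : ℝ)) := by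
        ext <;> simp
      conv_lhs => rw [this]
      rw [map_add, map_smul, map_smul, smul_eq_mul, smul_eq_mul]
      ring
    have hn : ∀ q : ℝ × ℝ, ‖Complex.exp ((L q : ℂ) * Complex.I)‖ ≤ 1 := fun q => by
      rw [Complex.norm_exp_ofReal_mul_I]
    have hm : AEStronglyMeasurable (fun q : ℝ × ℝ => Complex.exp ((L q : ℂ) * Complex.I)) volume :=
      (by fun_prop : Continuous fun q : ℝ × ℝ =>
        Complex.exp ((L q : ℂ) * Complex.I)).aestronglyMeasurable
    have j1 : Integrable fun q => (f₁ q).toReal • Complex.exp ((L q : ℂ) * Complex.I) :=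
      Integrable.smul_bdd (integrable_toReal_of_lintegral_ne_top m1 i1) 1 hm
        (Eventually.of_forall hn)
    have j2 : Integrable fun q => (f₂ q).toReal • Complex.exp ((L q : ℂ) * Complex.I) :=
      Integrable.smul_bdd (integrable_toReal_of_lintegral_ne_top m2 i2) 1 hm
        (Eventually.of_forall hn)
    rw [← sub_eq_zero, ← integral_sub j1 j2, ← h (L (1, 0)) (L (0, 1))]
    refine integral_congr_ae (Eventually.of_forall fun q => ?_)
    simp only [f₁, f₂, ENNReal.toReal_ofReal']
    rw [← sub_smul, hL q, max_zero_sub_eq_self, Complex.real_smul]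
  have := (withDensity_eq_iff m1 m2 i1).1 hμ
  filter_upwards [this] with q hq
  simp only [f₁, f₂] at hq
  have := congrArg ENNReal.toReal hq
  rw [ENNReal.toReal_ofReal', ENNReal.toReal_ofReal'] at this
  have e := max_zero_sub_eq_self (G q)
  rw [this, sub_self] at e
  exact e.symm

theorem ae_eq_zero_of_integral_mul_hermiteFun_real {g : ℝ × ℝ → ℝ} (hg : MemLp g 2)
    (h : ∀ m n, ∫ q : ℝ × ℝ, g q * (hermiteFun m q.1 * hermiteFun n q.2) = 0) :
    g =ᵐ[volume] 0 := by
  filter_upwards [ae_eq_zero_of_integral_mul_cexp (integrable_mul_gaussianWeight hg)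
    (integral_mul_cexp_eq_zero hg h)] with q hq
  refine (mul_eq_zero.1 hq).resolve_right ?_
  unfold gaussianWeight
  positivity

/-- The products of two Hermite functions are complete in `L²(ℝ²)`. -/
theorem ae_eq_zero_of_integral_mul_hermiteFun {g : ℝ × ℝ → ℂ} (hg : MemLp g 2)
    (h : ∀ m n, ∫ q : ℝ × ℝ, g q * ((hermiteFun m q.1 * hermiteFun n q.2 : ℝ) : ℂ) = 0) :
    g =ᵐ[volume] 0 := by
  have hi : ∀ m n, Integrable fun q : ℝ × ℝ =>
      g q * ((hermiteFun m q.1 * hermiteFun n q.2 : ℝ) : ℂ) := fun m n =>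
    hg.integrable_mul (MemLp_mul_prod (memLp_hermiteFun m) (memLp_hermiteFun n)).ofReal
  have hre := ae_eq_zero_of_integral_mul_hermiteFun_real hg.re fun m n => by
    have := integral_re (hi m n)
    rw [h m n] at this
    simpa using this
  have him := ae_eq_zero_of_integral_mul_hermiteFun_real hg.im fun m n => by
    have := integral_im (hi m n)
    rw [h m n] at this
    simpa using this
  filter_upwards [hre, him] with q h1 h2
  exact Complex.ext h1 h2

/-! ### The decomposition of `L²(ℝ³)` along the Hermite functions -/

/-- The product `χ_m(q₊) χ_n(q₋)`, with `i = (m, n)`. -/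
def hermiteProd (i : ℕ × ℕ) (q : ℝ × ℝ) : ℂ := ((hermiteFun i.1 q.1 * hermiteFun i.2 q.2 : ℝ) : ℂ)

theorem memLp_hermiteProd (i : ℕ × ℕ) : MemLp (hermiteProd i) 2 :=
  (MemLp_mul_prod (memLp_hermiteFun i.1) (memLp_hermiteFun i.2)).ofReal

theorem conj_hermiteProd (i : ℕ × ℕ) (q : ℝ × ℝ) :
    (starRingEnd ℂ) (hermiteProd i q) = hermiteProd i q := Complex.conj_ofReal _

theorem integral_hermiteProd_mul (i j : ℕ × ℕ) :
    ∫ q, hermiteProd i q * hermiteProd j q = if i = j then 1 else 0 := by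
  have e : ∀ q : ℝ × ℝ, hermiteProd i q * hermiteProd j q =
      (((hermiteFun i.1 q.1 * hermiteFun j.1 q.1) * (hermiteFun i.2 q.2 * hermiteFun j.2 q.2) : ℝ) :
        ℂ) := fun q => by
    simp only [hermiteProd]
    push_cast
    ring
  simp only [e]
  have e2 := integral_prod_mul (μ := (volume : Measure ℝ)) (ν := (volume : Measure ℝ))
    (fun x => hermiteFun i.1 x * hermiteFun j.1 x) (fun x => hermiteFun i.2 x * hermiteFun j.2 x)
  rw [integral_complex_ofReal, Measure.volume_eq_prod, e2, integral_hermiteFun_mul,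
    integral_hermiteFun_mul]
  obtain ⟨i1, i2⟩ := i
  obtain ⟨j1, j2⟩ := j
  simp only [Prod.mk.injEq]
  by_cases h1 : i1 = j1 <;> by_cases h2 : i2 = j2 <;> simp [h1, h2]

theorem hermiteCoeff_eq (U : H) (m n : ℕ) (x : ℝ) :
    hermiteCoeff U m n x = ∫ q : ℝ × ℝ, U (x, q) * hermiteProd (m, n) q := rfl

theorem memLp_mul_hermiteProd {φ : ℝ → ℂ} (hφ : MemLp φ 2) (i : ℕ × ℕ) :
    MemLp (fun z : ℝ × ℝ × ℝ => φ z.1 * hermiteProd i z.2) 2 := by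
  have h1 := (memLp_two_iff_integrable_sq_norm hφ.1).1 hφ
  have h2 := (memLp_two_iff_integrable_sq_norm (memLp_hermiteProd i).1).1 (memLp_hermiteProd i)
  refine (memLp_two_iff_integrable_sq_norm (μ := (volume : Measure ℝ).prod
    (volume : Measure (ℝ × ℝ))) (hφ.1.comp_fst.mul (memLp_hermiteProd i).1.comp_snd)).2 ?_
  refine (h1.mul_prod h2).congr (Eventually.of_forall fun q => ?_)
  simp only [Pi.mul_apply, norm_mul, mul_pow]

theorem ae_comp_fst {φ ψ : ℝ → ℂ} (h : φ =ᵐ[volume] ψ) :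
    ∀ᵐ z : ℝ × ℝ × ℝ, φ z.1 = ψ z.1 :=
  (Measure.quasiMeasurePreserving_fst (μ := (volume : Measure ℝ))
    (ν := (volume : Measure (ℝ × ℝ)))).ae h

/-- The map `φ ↦ φ(x) χ_m(q₊) χ_n(q₋)` from `L²(ℝ)` to `L²(ℝ³)`. -/
def hermiteTensorLin (i : ℕ × ℕ) : Lp ℂ 2 (volume : Measure ℝ) →ₗ[ℂ] H where
  toFun φ := (memLp_mul_hermiteProd (Lp.memLp φ) i).toLp
  map_add' φ ψ := by
    rw [← MemLp.toLp_add, MemLp.toLp_eq_toLp_iff]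
    filter_upwards [ae_comp_fst (Lp.coeFn_add φ ψ)] with z hz
    simp only [Pi.add_apply] at hz ⊢
    rw [hz]; ring
  map_smul' c φ := by
    rw [RingHom.id_apply, ← MemLp.toLp_const_smul, MemLp.toLp_eq_toLp_iff]
    filter_upwards [ae_comp_fst (Lp.coeFn_smul c φ)] with z hz
    simp only [Pi.smul_apply] at hz ⊢
    rw [hz, smul_eq_mul, smul_eq_mul]; ring

theorem coeFn_hermiteTensorLin (i : ℕ × ℕ) (φ : Lp ℂ 2 (volume : Measure ℝ)) :
    hermiteTensorLin i φ =ᵐ[volume] fun z => φ z.1 * hermiteProd i z.2 :=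
  MemLp.coeFn_toLp (memLp_mul_hermiteProd (Lp.memLp φ) i)

theorem inner_hermiteTensorLin_integrand (i : ℕ × ℕ) (φ : Lp ℂ 2 (volume : Measure ℝ)) (U : H) :
    (fun z => inner ℂ (hermiteTensorLin i φ z) (U z)) =ᵐ[volume]
      fun z => (starRingEnd ℂ) (φ z.1) * (U z * hermiteProd i z.2) := by
  filter_upwards [coeFn_hermiteTensorLin i φ] with z hz
  rw [hz, RCLike.inner_apply, map_mul, conj_hermiteProd]
  ring

theorem integrable_inner_hermiteTensorLin (i : ℕ × ℕ) (φ : Lp ℂ 2 (volume : Measure ℝ)) (U : H) :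
    Integrable (fun z : ℝ × ℝ × ℝ => (starRingEnd ℂ) (φ z.1) * (U z * hermiteProd i z.2))
      ((volume : Measure ℝ).prod (volume : Measure (ℝ × ℝ))) :=
  (L2.integrable_inner (𝕜 := ℂ) (hermiteTensorLin i φ) U).congr
    (inner_hermiteTensorLin_integrand i φ U)

theorem integrable_conj_mul_hermiteCoeff (i : ℕ × ℕ) (φ : Lp ℂ 2 (volume : Measure ℝ)) (U : H) :
    Integrable fun x => (starRingEnd ℂ) (φ x) * hermiteCoeff U i.1 i.2 x := by
  refine (integrable_inner_hermiteTensorLin i φ U).integral_prod_left.congr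
    (Eventually.of_forall fun x => ?_)
  simp only
  rw [integral_const_mul]
  rfl

theorem inner_hermiteTensorLin (i : ℕ × ℕ) (φ : Lp ℂ 2 (volume : Measure ℝ)) (U : H) :
    inner ℂ (hermiteTensorLin i φ) U =
      ∫ x, (starRingEnd ℂ) (φ x) * hermiteCoeff U i.1 i.2 x := by
  rw [L2.inner_def, integral_congr_ae (inner_hermiteTensorLin_integrand i φ U)]
  refine (integral_prod _ (integrable_inner_hermiteTensorLin i φ U)).trans ?_
  refine integral_congr_ae (Eventually.of_forall fun x => ?_)
  simp only
  rw [integral_const_mul]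
  rfl

theorem hermiteCoeff_hermiteTensorLin (i j : ℕ × ℕ) (φ : Lp ℂ 2 (volume : Measure ℝ)) :
    hermiteCoeff (hermiteTensorLin j φ) i.1 i.2 =ᵐ[volume]
      fun x => if i = j then φ x else 0 := by
  have h : ∀ᵐ z : ℝ × ℝ × ℝ ∂((volume : Measure ℝ).prod (volume : Measure (ℝ × ℝ))),
      hermiteTensorLin j φ z = φ z.1 * hermiteProd j z.2 := coeFn_hermiteTensorLin j φ
  filter_upwards [Measure.ae_ae_of_ae_prod h] with x hx
  rw [hermiteCoeff_eq]
  have : ∫ q, hermiteTensorLin j φ (x, q) * hermiteProd (i.1, i.2) q =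
      ∫ q, φ x * (hermiteProd i q * hermiteProd j q) := by
    refine integral_congr_ae ?_
    filter_upwards [hx] with q hq
    rw [hq]; ring
  rw [this, integral_const_mul, integral_hermiteProd_mul]
  split_ifs <;> simp

theorem inner_hermiteTensorLin_hermiteTensorLin (i j : ℕ × ℕ)
    (φ ψ : Lp ℂ 2 (volume : Measure ℝ)) :
    inner ℂ (hermiteTensorLin i φ) (hermiteTensorLin j ψ) = if i = j then inner ℂ φ ψ else 0 := by
  rw [inner_hermiteTensorLin]
  have : ∫ x, (starRingEnd ℂ) (φ x) * hermiteCoeff (hermiteTensorLin j ψ) i.1 i.2 x =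
      ∫ x, (starRingEnd ℂ) (φ x) * (if i = j then ψ x else 0) := by
    refine integral_congr_ae ?_
    filter_upwards [hermiteCoeff_hermiteTensorLin i j ψ] with x hx
    rw [hx]
  rw [this]
  split_ifs
  · rw [L2.inner_def]
    refine integral_congr_ae (Eventually.of_forall fun x => ?_)
    simp only [RCLike.inner_apply, mul_comm]
  · simp

/-- The isometry `φ ↦ φ(x) χ_m(q₊) χ_n(q₋)` from `L²(ℝ)` to `L²(ℝ³)`. -/
def hermiteTensor (i : ℕ × ℕ) : Lp ℂ 2 (volume : Measure ℝ) →ₗᵢ[ℂ] H where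
  toLinearMap := hermiteTensorLin i
  norm_map' φ := by
    rw [@norm_eq_sqrt_re_inner ℂ, @norm_eq_sqrt_re_inner ℂ _ _ _ _ φ,
      inner_hermiteTensorLin_hermiteTensorLin, if_pos rfl]

/-- Square integrability of c is not assumed. Indicators of compact sets as φ give local
integrability, and smooth φ then identify c with d. It is applied to coefficients, which are given
as integrals for each x. -/
theorem ae_eq_of_forall_inner_eq {c : ℝ → ℂ} {d : Lp ℂ 2 (volume : Measure ℝ)}
    (hi : ∀ φ : Lp ℂ 2 (volume : Measure ℝ), Integrable fun x => (starRingEnd ℂ) (φ x) * c x)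
    (h : ∀ φ : Lp ℂ 2 (volume : Measure ℝ), inner ℂ φ d = ∫ x, (starRingEnd ℂ) (φ x) * c x) :
    d =ᵐ[volume] c := by
  have hc : LocallyIntegrable c := by
    rw [locallyIntegrable_iff]
    intro k hk
    have h1 := hi (indicatorConstLp 2 hk.measurableSet hk.measure_lt_top.ne (1 : ℂ))
    rw [← integrable_indicator_iff hk.measurableSet]
    refine h1.congr ?_
    filter_upwards [indicatorConstLp_coeFn (p := 2) (hs := hk.measurableSet)
      (hμs := hk.measure_lt_top.ne) (c := (1 : ℂ))] with x hx
    rw [hx]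
    by_cases hxk : x ∈ k <;> simp [hxk]
  have hd : LocallyIntegrable d := (Lp.memLp d).locallyIntegrable (by norm_num)
  refine ae_eq_of_integral_contDiff_smul_eq hd hc fun g hg hgc => ?_
  have hgm : MemLp (fun x => (g x : ℂ)) 2 := (hg.continuous.memLp_of_hasCompactSupport hgc).ofReal
  set φ : Lp ℂ 2 (volume : Measure ℝ) := hgm.toLp
  have e := h φ
  rw [L2.inner_def] at e
  have e1 : ∫ x, inner ℂ (φ x) (d x) = ∫ x, g x • d x := by
    refine integral_congr_ae ?_
    filter_upwards [hgm.coeFn_toLp] with x hx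
    rw [hx, RCLike.inner_apply, Complex.conj_ofReal, Complex.real_smul, mul_comm]
  have e2 : ∫ x, (starRingEnd ℂ) (φ x) * c x = ∫ x, g x • c x := by
    refine integral_congr_ae ?_
    filter_upwards [hgm.coeFn_toLp] with x hx
    rw [hx, Complex.conj_ofReal, Complex.real_smul]
  rw [← e1, e, e2]

/-- A function in `L²(ℝ³)` with vanishing Hermite coefficients is zero. -/
theorem eq_zero_of_hermiteCoeff {U : H} (h : ∀ m n, hermiteCoeff U m n =ᵐ[volume] 0) : U = 0 := by
  have hU : MemLp U 2 ((volume : Measure ℝ).prod (volume : Measure (ℝ × ℝ))) := Lp.memLp U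
  have hsq := (memLp_two_iff_integrable_sq_norm hU.1).1 hU
  have hall : ∀ᵐ x, ∀ m n, hermiteCoeff U m n x = 0 :=
    ae_all_iff.2 fun m => ae_all_iff.2 fun n => h m n
  refine Lp.ext ?_
  -- For almost every x the slice U(x, ·) is square integrable and orthogonal to all products of
  -- Hermite functions; completeness applies slice by slice.
  have key : ∀ᵐ x : ℝ, ∀ᵐ q : ℝ × ℝ, U (x, q) = 0 := by
    filter_upwards [hsq.prod_right_ae, hU.1.prodMk_left, hall] with x h1 h2 h3
    exact ae_eq_zero_of_integral_mul_hermiteFun ((memLp_two_iff_integrable_sq_norm h2).2 h1)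
      fun m n => h3 m n
  have hz := Lp.coeFn_zero ℂ 2 (volume : Measure (ℝ × ℝ × ℝ))
  have key2 : ∀ᵐ z ∂((volume : Measure ℝ).prod (volume : Measure (ℝ × ℝ))), U z = 0 := by
    have hm := (Lp.stronglyMeasurable U).measurable
    exact (Measure.ae_prod_iff_ae_ae (measurableSet_eq_fun hm measurable_const)).2 key
  have key3 : ∀ᵐ z : ℝ × ℝ × ℝ, U z = 0 := key2
  filter_upwards [key3, hz] with z h1 h2
  rw [h1, h2]; rfl

/-- Orthonormality of the Hermite products makes the ranges orthogonal. A vector orthogonal to all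
of them has vanishing coefficients, hence is zero. -/
theorem isHilbertSum_hermiteTensor :
    IsHilbertSum ℂ (fun _ : ℕ × ℕ => Lp ℂ 2 (volume : Measure ℝ)) hermiteTensor := by
  refine IsHilbertSum.mk (fun i j hij v w => ?_) (top_le_iff.2 ?_)
  · exact (inner_hermiteTensorLin_hermiteTensorLin i j v w).trans (if_neg hij)
  · rw [Submodule.topologicalClosure_eq_top_iff, Submodule.eq_bot_iff]
    intro U hU
    refine eq_zero_of_hermiteCoeff fun m n => ?_
    have hz := ae_eq_of_forall_inner_eq (c := hermiteCoeff U m n) (d := 0)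
      (fun φ => integrable_conj_mul_hermiteCoeff (m, n) φ U) fun φ => by
        rw [inner_zero_right, ← inner_hermiteTensorLin (m, n) φ U]
        exact ((Submodule.mem_orthogonal _ _).1 hU _ (Submodule.mem_iSup_of_mem (m, n)
          ⟨φ, rfl⟩)).symm
    exact hz.symm.trans (Lp.coeFn_zero ℂ 2 (volume : Measure ℝ))

/-- The Hermite expansion as an isometry of `L²(ℝ³)` onto `ℓ²(ℕ², L²(ℝ))`. -/
def hermiteExpansion : H ≃ₗᵢ[ℂ] lp (fun _ : ℕ × ℕ => Lp ℂ 2 (volume : Measure ℝ)) 2 :=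
  isHilbertSum_hermiteTensor.linearIsometryEquiv

/-- The inverse isometry sends the sequence with single entry φ at i to φ ⊗ χ_i. Pairing with such
sequences thus shows that the abstract components are the concrete coefficients. -/
theorem hermiteExpansion_ae_eq (U : H) (i : ℕ × ℕ) :
    hermiteExpansion U i =ᵐ[volume] hermiteCoeff U i.1 i.2 := by
  refine ae_eq_of_forall_inner_eq (fun φ => integrable_conj_mul_hermiteCoeff i φ U) fun φ => ?_
  rw [← inner_hermiteTensorLin i φ U]
  refine (lp.inner_single_left (𝕜 := ℂ) i φ (hermiteExpansion U)).symm.trans ?_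
  rw [← LinearIsometryEquiv.inner_map_map hermiteExpansion.symm]
  congr 1
  · exact isHilbertSum_hermiteTensor.linearIsometryEquiv_symm_apply_single φ
  · exact hermiteExpansion.symm_apply_apply U

theorem represents_iff {U : H} {u : ℕ → ℕ → ℝ → ℂ} :
    Represents U u ↔ ∀ i : ℕ × ℕ, hermiteExpansion U i =ᵐ[volume] u i.1 i.2 :=
  ⟨fun h i => (hermiteExpansion_ae_eq U i).trans (h i.1 i.2),
    fun h m n => (hermiteExpansion_ae_eq U (m, n)).symm.trans (h (m, n))⟩

namespace Represents

variable {U V : H} {u v : ℕ → ℕ → ℝ → ℂ}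

theorem memLp (h : Represents U u) (m n : ℕ) : MemLp (u m n) 2 :=
  (memLp_congr_ae (represents_iff.1 h (m, n))).1 (Lp.memLp _)

theorem eq (hU : Represents U u) (hV : Represents V u) : U = V := by
  refine hermiteExpansion.injective (lp.ext (funext fun i => Lp.ext ?_))
  exact (represents_iff.1 hU i).trans (represents_iff.1 hV i).symm

theorem hasSum_inner (hU : Represents U u) (hV : Represents V v) :
    HasSum (fun i : ℕ × ℕ => ∫ x, (starRingEnd ℂ) (u i.1 i.2 x) * v i.1 i.2 x) (inner ℂ U V) := by
  have h := lp.hasSum_inner (𝕜 := ℂ) (hermiteExpansion U) (hermiteExpansion V)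
  rw [LinearIsometryEquiv.inner_map_map] at h
  refine h.congr_fun fun i => ?_
  rw [L2.inner_def]
  refine integral_congr_ae ?_
  filter_upwards [represents_iff.1 hU i, represents_iff.1 hV i] with x h1 h2
  rw [h1, h2, RCLike.inner_apply, mul_comm]

theorem summable_integral_sq (hU : Represents U u) :
    Summable fun i : ℕ × ℕ => ∫ x, ‖u i.1 i.2 x‖ ^ 2 := by
  have h := (hU.hasSum_inner hU).summable
  have e : ∀ i : ℕ × ℕ, ∫ x, (starRingEnd ℂ) (u i.1 i.2 x) * u i.1 i.2 x =
      ((∫ x, ‖u i.1 i.2 x‖ ^ 2 : ℝ) : ℂ) := fun i => by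
    rw [← integral_complex_ofReal]
    refine integral_congr_ae (Eventually.of_forall fun x => ?_)
    simp only
    rw [mul_comm, Complex.mul_conj, Complex.normSq_eq_norm_sq]
  simp only [e] at h
  exact_mod_cast h

end Represents

/-- The Riesz–Fischer theorem for Hermite expansions. -/
theorem exists_represents {f : ℕ → ℕ → ℝ → ℂ} (hf : ∀ m n, MemLp (f m n) 2)
    (hs : ∑' (m : ℕ) (n : ℕ), ∫⁻ x, ‖f m n x‖ₑ ^ 2 < ⊤) : ∃ W : H, Represents W f := by
  set g : ∀ _ : ℕ × ℕ, Lp ℂ 2 (volume : Measure ℝ) := fun i => (hf i.1 i.2).toLp with hg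
  have hn : ∀ i, ENNReal.ofReal (‖g i‖ ^ 2) = ∫⁻ x, ‖f i.1 i.2 x‖ₑ ^ 2 := by
    intro i
    rw [hg, Lp.norm_toLp, ENNReal.ofReal_pow ENNReal.toReal_nonneg,
      ENNReal.ofReal_toReal (hf _ _).2.ne, eLpNorm_eq_lintegral_rpow_enorm_toReal (by norm_num) (by norm_num)]
    simp only [ENNReal.toReal_ofNat, one_div]
    rw [← ENNReal.rpow_natCast, ← ENNReal.rpow_mul]
    norm_num
  have hm : Memℓp g 2 := by
    refine memℓp_gen ?_
    have h1 : ∑' i : ℕ × ℕ, ENNReal.ofReal (‖g i‖ ^ 2) ≠ ⊤ := by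
      rw [ENNReal.tsum_prod']
      simp only [hn]
      exact hs.ne
    have h2 := ENNReal.summable_toReal h1
    refine h2.congr fun i => ?_
    rw [ENNReal.toReal_ofReal (by positivity)]
    norm_num
  refine ⟨hermiteExpansion.symm ⟨g, hm⟩, represents_iff.2 fun i => ?_⟩
  rw [LinearIsometryEquiv.apply_symm_apply]
  exact (hf i.1 i.2).coeFn_toLp

/-! ### Admissible families -/

/-- The right-hand side of the matching condition at `1`. -/
def jumpRight (αp : ℝ) (u : ℕ → ℕ → ℝ → ℂ) (m n : ℕ) : ℂ :=
  ((αp / √2 : ℝ) : ℂ) * (((√((m : ℝ) + 1) : ℝ) : ℂ) * u (m + 1) n 1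
    + ((√(m : ℝ) : ℝ) : ℂ) * u (m - 1) n 1)

/-- The right-hand side of the matching condition at `-1`. -/
def jumpLeft (αm : ℝ) (u : ℕ → ℕ → ℝ → ℂ) (m n : ℕ) : ℂ :=
  ((αm / √2 : ℝ) : ℂ) * (((√((n : ℝ) + 1) : ℝ) : ℂ) * u m (n + 1) (-1)
    + ((√(n : ℝ) : ℝ) : ℂ) * u m (n - 1) (-1))

theorem memLp_two_iff_lintegral {f : ℝ → ℂ} (hf : AEStronglyMeasurable f) :
    MemLp f 2 ↔ ∫⁻ x, ‖f x‖ₑ ^ 2 < ⊤ := by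
  have := eLpNorm_lt_top_iff_lintegral_rpow_enorm_lt_top (μ := (volume : Measure ℝ)) (f := f)
    (p := 2) (by norm_num) (by norm_num)
  simp only [ENNReal.toReal_ofNat, ENNReal.rpow_ofNat] at this
  rw [← this]
  exact ⟨fun h => h.2, fun h => ⟨hf, h⟩⟩

theorem lintegral_enorm_sq_eq {f : ℝ → ℂ} (hf : MemLp f 2) :
    ∫⁻ x, ‖f x‖ₑ ^ 2 = ENNReal.ofReal (∫ x, ‖f x‖ ^ 2) := by
  rw [ofReal_integral_eq_lintegral_ofReal ((memLp_two_iff_integrable_sq_norm hf.1).1 hf)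
    (Eventually.of_forall fun x => sq_nonneg _)]
  refine lintegral_congr fun x => ?_
  rw [ENNReal.ofReal_pow (norm_nonneg _), ofReal_norm]

variable {αp αm νp νm : ℝ} {u f u' f' : ℕ → ℕ → ℝ → ℂ} {U F U' F' V W : H}

theorem IsAdmissible.memLp (h : IsAdmissible αp αm νp νm u f) (m n : ℕ) : MemLp (f m n) 2 := by
  have hm := (h.image m n).aemeasurable (h.continuous m n)
  rw [memLp_two_iff_lintegral hm.aestronglyMeasurable]
  exact lt_of_le_of_lt ((ENNReal.le_tsum n).trans (ENNReal.le_tsum (f := fun m =>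
    ∑' n, ∫⁻ x, ‖f m n x‖ₑ ^ 2) m)) h.sum_lt_top

theorem IsAdmissible.exists_piecewiseH2 (h : IsAdmissible αp αm νp νm u f) (m n : ℕ) :
    ∃ p, PiecewiseH2 (u m n) p (fun x => (level νp νm m n : ℂ) * u m n x - f m n x)
      (jumpRight αp u m n) (jumpLeft αm u m n) := by
  refine (h.image m n).exists_piecewiseH2 (h.continuous m n) ?_ (h.memLp m n)
    (h.jump_right m n) (h.jump_left m n)
  have := (h.memH1 m n).1
  rwa [Measure.restrict_univ] at this

theorem isAdmissible_of_piecewiseH2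
    (h : ∀ m n, ∃ p, PiecewiseH2 (u m n) p (fun x => (level νp νm m n : ℂ) * u m n x - f m n x)
      (jumpRight αp u m n) (jumpLeft αm u m n))
    (hs : ∑' (m : ℕ) (n : ℕ), ∫⁻ x, ‖f m n x‖ₑ ^ 2 < ⊤) : IsAdmissible αp αm νp νm u f := by
  choose p hp using h
  exact
    { continuous := fun m n => (hp m n).continuous
      memH1 := fun m n => (hp m n).memSobolev_one _
      memH2_left := fun m n => (hp m n).memSobolev_two (by norm_num) (by norm_num)
      memH2_middle := fun m n => (hp m n).memSobolev_two (by norm_num) (by norm_num)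
      memH2_right := fun m n => (hp m n).memSobolev_two (by norm_num) (by norm_num)
      image := fun m n => (hp m n).isOscillatorImage (Eventually.of_forall fun x => by ring)
      sum_lt_top := hs
      jump_right := fun m n => (hp m n).hasDerivJump_one
      jump_left := fun m n => (hp m n).hasDerivJump_neg_one }

theorem Represents.tsum_lt_top (h : Represents U u) :
    ∑' (m : ℕ) (n : ℕ), ∫⁻ x, ‖u m n x‖ₑ ^ 2 < ⊤ := by
  simp only [fun m n => lintegral_enorm_sq_eq (h.memLp m n)]
  rw [← ENNReal.tsum_prod (f := fun m n => ENNReal.ofReal (∫ x, ‖u m n x‖ ^ 2))]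
  exact (h.summable_integral_sq).tsum_ofReal_lt_top

theorem PiecewiseH2.integral_deriv_deriv_smul {u p w : ℝ → ℂ} {c₁ c₂ : ℂ}
    (h : PiecewiseH2 u p w c₁ c₂) {φ : ℝ → ℝ} (hφ : ContDiff ℝ ∞ φ) (hc : HasCompactSupport φ) :
    ∫ x, deriv (deriv φ) x • u x = (∫ x, φ x • w x) + c₁ * φ 1 + c₂ * φ (-1) := by
  rw [h.prim_u.integral_deriv_smul (contDiff_infty_iff_deriv.1 hφ).2 hc.deriv,
    h.prim_p.integral_deriv_smul_jump hφ hc]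
  ring

/-- Test functions supported away from ±1 do not see the delta terms, so w is the distributional
second derivative of 0 off a null set. -/
theorem PiecewiseH2.ae_eq_zero {u p w : ℝ → ℂ} {c₁ c₂ : ℂ} (h : PiecewiseH2 u p w c₁ c₂)
    (hu : u =ᵐ[volume] 0) : w =ᵐ[volume] 0 := by
  have hopen : IsOpen ({1, -1}ᶜ : Set ℝ) := (Set.toFinite _).isClosed.isOpen_compl
  have key := hopen.ae_eq_zero_of_integral_contDiff_smul_eq_zero (μ := volume)
    (h.prim_p.locallyIntegrable.locallyIntegrableOn _) fun g hg hgc hgs => by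
      have e := h.integral_deriv_deriv_smul hg hgc
      rw [image_eq_zero_of_notMem_tsupport fun h => hgs h (by simp),
        image_eq_zero_of_notMem_tsupport fun h => hgs h (by simp)] at e
      have e0 : ∫ x, deriv (deriv g) x • u x = 0 := integral_eq_zero_of_ae (by
        filter_upwards [hu] with x hx
        rw [hx]; simp)
      rw [e0] at e
      simpa using e.symm
  filter_upwards [key, ((Set.toFinite ({1, -1} : Set ℝ)).countable.ae_notMem volume)] with x h1 h2
  exact h1 h2

/-- The graph of the operator is single-valued. -/
theorem operatorGraph_snd_eq_zero {P : H × H} (hP : P ∈ operatorGraph αp αm νp νm)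
    (h0 : P.1 = 0) : P.2 = 0 := by
  obtain ⟨u, f, h1, h2, h3⟩ := hP
  rw [h0] at h1
  refine h3.eq fun m n => ?_
  have hu : u m n =ᵐ[volume] 0 := (h1 m n).symm.trans (Represents.zero m n)
  obtain ⟨p, hp⟩ := h2.exists_piecewiseH2 m n
  refine (Represents.zero m n).trans ?_
  filter_upwards [hp.ae_eq_zero hu, hu] with x e1 e2
  simp only [e2, Pi.zero_apply, mul_zero, zero_sub, neg_eq_zero] at e1
  exact e1.symm

/-! ### Symmetry -/

/-- A Carleman type criterion for the vanishing of a telescoping double series. -/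
theorem eq_zero_of_telescoping {g : ℕ × ℕ → ℂ} {S : ℂ} (hg : HasSum g S) {T R : ℕ → ℕ → ℂ}
    (hgT : ∀ m n, g (m, n) = (T (m + 1) n - T m n) + (R m (n + 1) - R m n))
    (hT : ∀ n, T 0 n = 0) (hR : ∀ m, R m 0 = 0) {X : ℕ × ℕ → ℝ} (hX : Summable X)
    (hX0 : ∀ i, 0 ≤ X i) {C : ℝ} (hC : 0 < C)
    (hTX : ∀ N n, n ≤ N → ‖T (N + 1) n‖ ≤ C * (N + 1) * (X (N, n) + X (N + 1, n)))
    (hRX : ∀ N m, m ≤ N → ‖R m (N + 1)‖ ≤ C * (N + 1) * (X (m, N) + X (m, N + 1))) : S = 0 := by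
  by_contra hS
  have hX' : Summable fun i : ℕ × ℕ => X i.swap := (Equiv.prodComm ℕ ℕ).summable_iff.2 hX
  set row : ℕ → ℝ := fun m => ∑' n, X (m, n) with hrow
  set col : ℕ → ℝ := fun n => ∑' m, X (m, n) with hcol
  have srow : Summable row := hX.prod
  have scol : Summable col := hX'.prod
  have frow : ∀ m, Summable fun n => X (m, n) := fun m => hX.prod_factor m
  have fcol : ∀ n, Summable fun m => X (m, n) := fun n => hX'.prod_factor n
  -- A summable majorant: the outer edges of the square involve only the rows and columns of indices
  -- N and N+1.
  set Y : ℕ → ℝ := fun N => (row N + row (N + 1)) + (col N + col (N + 1)) with hY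
  have sY : Summable Y := (srow.add ((summable_nat_add_iff 1).2 srow)).add
    (scol.add ((summable_nat_add_iff 1).2 scol))
  have hsum : ∀ N, ∑ i ∈ Finset.range (N + 1) ×ˢ Finset.range (N + 1), g i =
      (∑ n ∈ Finset.range (N + 1), T (N + 1) n) + ∑ m ∈ Finset.range (N + 1), R m (N + 1) := by
    intro N
    rw [Finset.sum_product]
    simp only [hgT, Finset.sum_add_distrib]
    congr 1
    · rw [Finset.sum_comm]
      refine Finset.sum_congr rfl fun n _ => ?_
      rw [Finset.sum_range_sub (fun m => T m n), hT, sub_zero]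
    · refine Finset.sum_congr rfl fun m _ => ?_
      rw [Finset.sum_range_sub (fun n => R m n), hR, sub_zero]
  have hbound : ∀ N : ℕ, ‖∑ i ∈ Finset.range (N + 1) ×ˢ Finset.range (N + 1), g i‖ ≤
      C * (N + 1) * Y N := by
    intro N
    rw [hsum]
    have b1 : ‖∑ n ∈ Finset.range (N + 1), T (N + 1) n‖ ≤ C * (N + 1) * (row N + row (N + 1)) := by
      refine (norm_sum_le_of_le _ fun n hn => hTX N n (by simpa [Nat.lt_succ_iff] using hn)).trans ?_
      rw [← Finset.mul_sum, Finset.sum_add_distrib]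
      gcongr
      · exact (frow N).sum_le_tsum _ fun n _ => hX0 _
      · exact (frow (N + 1)).sum_le_tsum _ fun n _ => hX0 _
    have b2 : ‖∑ m ∈ Finset.range (N + 1), R m (N + 1)‖ ≤ C * (N + 1) * (col N + col (N + 1)) := by
      refine (norm_sum_le_of_le _ fun m hm => hRX N m (by simpa [Nat.lt_succ_iff] using hm)).trans ?_
      rw [← Finset.mul_sum, Finset.sum_add_distrib]
      gcongr
      · exact (fcol N).sum_le_tsum _ fun n _ => hX0 _
      · exact (fcol (N + 1)).sum_le_tsum _ fun n _ => hX0 _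
    calc _ ≤ _ := norm_add_le _ _
      _ ≤ _ := add_le_add b1 b2
      _ = _ := by rw [hY]; ring
  have htend : Tendsto (fun N : ℕ => ∑ i ∈ Finset.range (N + 1) ×ˢ Finset.range (N + 1), g i)
      atTop (𝓝 S) := by
    refine hg.comp (tendsto_atTop_finset_of_monotone (fun a b hab => ?_) fun i => ?_)
    · exact Finset.product_subset_product (Finset.range_mono (by omega))
        (Finset.range_mono (by omega))
    · refine ⟨max i.1 i.2, ?_⟩
      simp only [Finset.mem_product, Finset.mem_range]
      omega
  have hpos : 0 < ‖S‖ / 2 := by positivity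
  have hev : ∀ᶠ N : ℕ in atTop, ‖S‖ / 2 ≤
      ‖∑ i ∈ Finset.range (N + 1) ×ˢ Finset.range (N + 1), g i‖ :=
    (htend.norm.eventually (lt_mem_nhds (half_lt_self (by positivity)))).mono fun x hx => le_of_lt hx
  -- If S ≠ 0, the partial sums stay above |S|/2, so 1/(N+1) is eventually dominated by a multiple
  -- of Y_N. This would make the harmonic series converge.
  have hev2 : ∀ᶠ N : ℕ in atTop, ‖(1 / ((N : ℝ) + 1))‖ ≤ (C / (‖S‖ / 2)) * Y N := by
    filter_upwards [hev] with N hN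
    have := hN.trans (hbound N)
    rw [Real.norm_of_nonneg (by positivity), div_mul_eq_mul_div, div_le_div_iff₀ (by positivity) hpos]
    linarith
  have hs : Summable fun N : ℕ => 1 / ((N : ℝ) + 1) :=
    Summable.of_norm_bounded_eventually_nat (sY.mul_left _) hev2
  have := (summable_nat_add_iff (f := fun n : ℕ => 1 / (n : ℝ)) 1).1 (by simpa using hs)
  exact Real.not_summable_one_div_natCast this

theorem level_nonneg (m n : ℕ) : 0 ≤ level νp νm m n := by
  unfold level; positivity

theorem level_le (m n : ℕ) : level νp νm m n ≤ (νp ^ 2 + νm ^ 2) * ((m : ℝ) + n + 1) := by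
  unfold level
  have hm : (0 : ℝ) ≤ m := Nat.cast_nonneg _
  have hn : (0 : ℝ) ≤ n := Nat.cast_nonneg _
  nlinarith [sq_nonneg νp, sq_nonneg νm, mul_nonneg (sq_nonneg νp) hn,
    mul_nonneg (sq_nonneg νm) hm]

theorem integral_norm_sub_sq_le {r : ℝ} {a b : ℝ → ℂ} (ha : MemLp a 2) (hb : MemLp b 2) :
    ∫ x, ‖(r : ℂ) * a x - b x‖ ^ 2 ≤ 2 * r ^ 2 * (∫ x, ‖a x‖ ^ 2) + 2 * ∫ x, ‖b x‖ ^ 2 := by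
  have ia := (memLp_two_iff_integrable_sq_norm ha.1).1 ha
  have ib := (memLp_two_iff_integrable_sq_norm hb.1).1 hb
  have hc : MemLp (fun x => (r : ℂ) * a x - b x) 2 := (ha.const_mul _).sub hb
  rw [← integral_const_mul, ← integral_const_mul, ← integral_add (ia.const_mul _) (ib.const_mul _)]
  refine integral_mono ((memLp_two_iff_integrable_sq_norm hc.1).1 hc)
    ((ia.const_mul _).add (ib.const_mul _)) fun x => ?_
  have h1 := norm_sub_le ((r : ℂ) * a x) (b x)
  have h2 : ‖(r : ℂ) * a x‖ ^ 2 = r ^ 2 * ‖a x‖ ^ 2 := by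
    rw [norm_mul, mul_pow, Complex.norm_real, Real.norm_eq_abs, sq_abs]
  simp only
  nlinarith [norm_nonneg ((r : ℂ) * a x - b x), sq_nonneg (‖(r : ℂ) * a x‖ - ‖b x‖)]

/-- The traces of an admissible family at `1` and `-1`. -/
theorem IsAdmissible.norm_eval_sq_le (h : IsAdmissible αp αm νp νm u f) (hU : Represents U u)
    (m n : ℕ) {o : ℝ} (ho : o = 1 ∨ o = -1) :
    ‖u m n o‖ ^ 2 / √((m : ℝ) + n + 1) ≤ (4 * (νp ^ 2 + νm ^ 2) ^ 2 + 32) * (∫ x, ‖u m n x‖ ^ 2) +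
      4 * ∫ x, ‖f m n x‖ ^ 2 := by
  obtain ⟨p, hp⟩ := h.exists_piecewiseH2 m n
  have ht : (1 : ℝ) ≤ (m : ℝ) + n + 1 := by
    have hm : (0 : ℝ) ≤ m := Nat.cast_nonneg _
    have hn : (0 : ℝ) ≤ n := Nat.cast_nonneg _
    linarith
  have hlev := level_le (νp := νp) (νm := νm) m n
  have hlev0 := level_nonneg (νp := νp) (νm := νm) m n
  have hw := integral_norm_sub_sq_le (r := level νp νm m n) (hU.memLp m n) (h.memLp m n)
  set t : ℝ := (m : ℝ) + n + 1
  set c := νp ^ 2 + νm ^ 2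
  set s := √t with hs
  have hs1 : 1 ≤ s := Real.one_le_sqrt.2 ht
  have hst : s ^ 2 = t := Real.sq_sqrt (by linarith)
  have hs0 : 0 < s := by linarith
  -- With t = m+n+1 and s = √t, the scale δ = 1/s balances the trace estimate: the level is O(s²),
  -- so δ³ r² and 1/δ are both O(s).
  have hδ : 0 < 1 / s := by positivity
  have key : ‖u m n o‖ ^ 2 ≤ 2 * (1 / s) ^ 3 *
      (∫ x, ‖(level νp νm m n : ℂ) * u m n x - f m n x‖ ^ 2) +
      32 / (1 / s) * ∫ x, ‖u m n x‖ ^ 2 := by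
    rcases ho with rfl | rfl
    · exact hp.norm_eval_one_sq_le hδ
    · exact hp.norm_eval_neg_one_sq_le hδ ((div_le_one hs0).2 hs1)
  set A := ∫ x, ‖u m n x‖ ^ 2 with hA
  set B := ∫ x, ‖f m n x‖ ^ 2
  have hA0 : 0 ≤ A := integral_nonneg fun _ => sq_nonneg _
  have hB0 : 0 ≤ B := integral_nonneg fun _ => sq_nonneg _
  rw [div_le_iff₀ hs0]
  have hr : level νp νm m n ^ 2 ≤ c ^ 2 * s ^ 4 := by
    calc level νp νm m n ^ 2 ≤ (c * t) ^ 2 := by gcongr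
      _ = c ^ 2 * s ^ 4 := by rw [← hst]; ring
  calc ‖u m n o‖ ^ 2 ≤ 2 * (1 / s) ^ 3 * (2 * (c ^ 2 * s ^ 4) * A + 2 * B) + 32 / (1 / s) * A := by
        refine key.trans ?_
        gcongr
        refine hw.trans ?_
        gcongr
    _ = 4 * c ^ 2 * s * A + 4 * B * (1 / s) ^ 3 + 32 * s * A := by
        field_simp
        ring
    _ ≤ 4 * c ^ 2 * s * A + 4 * B * s + 32 * s * A := by
        have : (1 / s) ^ 3 ≤ s := by
          calc (1 / s) ^ 3 ≤ 1 := pow_le_one₀ hδ.le ((div_le_one hs0).2 hs1)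
            _ ≤ s := hs1
        gcongr
    _ = _ := by ring

/-! ### Edge terms and the symmetry of the operator -/

variable {αp αm νp νm : ℝ} {u f u' f' : ℕ → ℕ → ℝ → ℂ} {U F U' F' V W : H}

/-- The matrix entry and the trace bounds contribute √(N+1) each, and their product N+1 is exactly
the growth that Carleman's criterion allows. -/
theorem norm_cross_le {a : ℝ} {N : ℕ} {x y : ℝ} {p q p' q' : ℂ}
    (hp : ‖p‖ ^ 2 + ‖p'‖ ^ 2 ≤ 2 * √((N : ℝ) + 1) * x)
    (hq : ‖q‖ ^ 2 + ‖q'‖ ^ 2 ≤ 2 * √((N : ℝ) + 1) * y) :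
    ‖(a : ℂ) * ((√((N + 1 : ℕ) : ℝ) : ℝ) : ℂ) *
      (p' * (starRingEnd ℂ) q - q' * (starRingEnd ℂ) p)‖ ≤ |a| * (N + 1) * (x + y) := by
  have hs : √((N : ℝ) + 1) ^ 2 = N + 1 := Real.sq_sqrt (by positivity)
  have hs0 := Real.sqrt_nonneg ((N : ℝ) + 1)
  rw [norm_mul, norm_mul, Complex.norm_real, Complex.norm_real, Real.norm_eq_abs,
    Real.norm_of_nonneg (Real.sqrt_nonneg _), Nat.cast_add_one, mul_assoc, mul_assoc]
  refine mul_le_mul_of_nonneg_left ?_ (abs_nonneg a)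
  have h1 : ‖p' * (starRingEnd ℂ) q - q' * (starRingEnd ℂ) p‖ ≤ √((N : ℝ) + 1) * (x + y) := by
    refine (norm_sub_le _ _).trans ?_
    rw [norm_mul, norm_mul, RCLike.norm_conj, RCLike.norm_conj]
    nlinarith [sq_nonneg (‖p'‖ - ‖q‖), sq_nonneg (‖q'‖ - ‖p‖)]
  calc _ ≤ √((N : ℝ) + 1) * (√((N : ℝ) + 1) * (x + y)) := mul_le_mul_of_nonneg_left h1 hs0
    _ = _ := by rw [← mul_assoc, ← sq, hs]

/-- The weighted traces of two admissible families. -/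
def traceWeight (u u' : ℕ → ℕ → ℝ → ℂ) (i : ℕ × ℕ) : ℝ :=
  ((‖u i.1 i.2 1‖ ^ 2 + ‖u' i.1 i.2 1‖ ^ 2) + (‖u i.1 i.2 (-1)‖ ^ 2 + ‖u' i.1 i.2 (-1)‖ ^ 2)) /
    √((i.1 : ℝ) + i.2 + 1)

theorem traceWeight_nonneg (i : ℕ × ℕ) : 0 ≤ traceWeight u u' i := by
  unfold traceWeight; positivity

/-- Here m+n+1 ≤ 4(N+1). The bound 2N+1 covers both indices of an edge term: one coordinate is N or
N+1, the other at most N. -/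
theorem sq_add_sq_le_traceWeight {N m n : ℕ} (h : m + n ≤ 2 * N + 1) {o : ℝ}
    (ho : o = 1 ∨ o = -1) :
    ‖u m n o‖ ^ 2 + ‖u' m n o‖ ^ 2 ≤ 2 * √((N : ℝ) + 1) * traceWeight u u' (m, n) := by
  have h0 : 0 < √((m : ℝ) + n + 1) := by positivity
  have h1 : √((m : ℝ) + n + 1) ≤ 2 * √((N : ℝ) + 1) := by
    rw [Real.sqrt_le_left (by positivity), mul_pow, Real.sq_sqrt (by positivity)]
    have : (m : ℝ) + n ≤ 2 * N + 1 := by exact_mod_cast h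
    have hN : (0 : ℝ) ≤ N := Nat.cast_nonneg N
    linarith
  refine le_trans ?_ (mul_le_mul_of_nonneg_right h1 (traceWeight_nonneg _))
  rw [traceWeight, mul_div_cancel₀ _ h0.ne']
  rcases ho with rfl | rfl
  · exact le_add_of_nonneg_right (by positivity)
  · exact le_add_of_nonneg_left (by positivity)

theorem summable_traceWeight (h : IsAdmissible αp αm νp νm u f) (hU : Represents U u)
    (hF : Represents F f) (h' : IsAdmissible αp αm νp νm u' f') (hU' : Represents U' u')
    (hF' : Represents F' f') : Summable (traceWeight u u') := by
  set K := 4 * (νp ^ 2 + νm ^ 2) ^ 2 + 32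
  have s1 := (hU.summable_integral_sq.mul_left K).add (hF.summable_integral_sq.mul_left 4)
  have s2 := (hU'.summable_integral_sq.mul_left K).add (hF'.summable_integral_sq.mul_left 4)
  refine Summable.of_nonneg_of_le traceWeight_nonneg (fun i => ?_) ((s1.add s2).add (s1.add s2))
  rw [traceWeight, add_div, add_div, add_div]
  exact add_le_add
    (add_le_add (h.norm_eval_sq_le hU _ _ (.inl rfl)) (h'.norm_eval_sq_le hU' _ _ (.inl rfl)))
    (add_le_add (h.norm_eval_sq_le hU _ _ (.inr rfl)) (h'.norm_eval_sq_le hU' _ _ (.inr rfl)))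

theorem integrable_conj_mul_of_memLp {a b : ℝ → ℂ} (ha : MemLp a 2) (hb : MemLp b 2) :
    Integrable fun x => (starRingEnd ℂ) (a x) * b x :=
  (memLp_conj ha).integrable_mul hb

/-- Green's formula for the operators `-d²/dx² + r`. -/
theorem PiecewiseH2.green_sub {r : ℝ} {a p f a' p' f' : ℝ → ℂ} {c₁ c₂ c₁' c₂' : ℂ}
    (h : PiecewiseH2 a p (fun x => (r : ℂ) * a x - f x) c₁ c₂) (hf : MemLp f 2)
    (h' : PiecewiseH2 a' p' (fun x => (r : ℂ) * a' x - f' x) c₁' c₂') (hf' : MemLp f' 2) :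
    (∫ x, (starRingEnd ℂ) (f x) * a' x) - ∫ x, (starRingEnd ℂ) (a x) * f' x =
      a' 1 * (starRingEnd ℂ) c₁ + a' (-1) * (starRingEnd ℂ) c₂ - c₁' * (starRingEnd ℂ) (a 1)
        - c₂' * (starRingEnd ℂ) (a (-1)) := by
  rw [← h'.green h]
  have i1 := integrable_conj_mul_of_memLp h.memLp_u h'.memLp_u
  have i2 := integrable_conj_mul_of_memLp h.memLp_u hf'
  have i3 := integrable_conj_mul_of_memLp hf h'.memLp_u
  have e1 : ∫ x, ((r : ℂ) * a' x - f' x) * (starRingEnd ℂ) (a x) =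
      r * (∫ x, (starRingEnd ℂ) (a x) * a' x) - ∫ x, (starRingEnd ℂ) (a x) * f' x := by
    rw [← integral_const_mul, ← integral_sub (i1.const_mul _) i2]
    exact integral_congr_ae (Eventually.of_forall fun x => by simp only; ring)
  have e2 : ∫ x, a' x * (starRingEnd ℂ) ((r : ℂ) * a x - f x) =
      r * (∫ x, (starRingEnd ℂ) (a x) * a' x) - ∫ x, (starRingEnd ℂ) (f x) * a' x := by
    rw [← integral_const_mul, ← integral_sub (i1.const_mul _) i3]
    exact integral_congr_ae (Eventually.of_forall fun x => by
      simp only [map_sub, map_mul, Complex.conj_ofReal]; ring)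
  rw [e1, e2]
  ring

/-- Green's formula removes the real level r_{m,n}; inserting the matching conditions turns the
boundary terms into differences of the Wronskians T in m and R in n of the two Jacobi matrices. -/
theorem inner_eq_of_isAdmissible (h : IsAdmissible αp αm νp νm u f) (hU : Represents U u)
    (hF : Represents F f) (h' : IsAdmissible αp αm νp νm u' f') (hU' : Represents U' u')
    (hF' : Represents F' f') : inner ℂ F U' = inner ℂ U F' := by
  rw [← sub_eq_zero]
  set a := αp / √2 with ha
  set b := αm / √2 with hb
  refine eq_zero_of_telescoping ((hF.hasSum_inner hU').sub (hU.hasSum_inner hF'))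
    -- At m = 0 the truncated index m - 1 is 0, but the factor √0 makes T vanish; likewise for R at
    -- n = 0.
    (T := fun m n => (a : ℂ) * ((√(m : ℝ) : ℝ) : ℂ) *
      (u' (m - 1) n 1 * (starRingEnd ℂ) (u m n 1) - u' m n 1 * (starRingEnd ℂ) (u (m - 1) n 1)))
    (R := fun m n => (b : ℂ) * ((√(n : ℝ) : ℝ) : ℂ) *
      (u' m (n - 1) (-1) * (starRingEnd ℂ) (u m n (-1)) -
        u' m n (-1) * (starRingEnd ℂ) (u m (n - 1) (-1))))
    (fun m n => ?_) (fun n => by simp) (fun m => by simp)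
    (summable_traceWeight h hU hF h' hU' hF') traceWeight_nonneg
    -- One constant for both edges; the summand 1 keeps it positive when both couplings vanish.
    (C := |a| + |b| + 1) (by positivity) (fun N n hn => ?_) (fun N m hm => ?_)
  · obtain ⟨p, hp⟩ := h.exists_piecewiseH2 m n
    obtain ⟨p', hp'⟩ := h'.exists_piecewiseH2 m n
    rw [hp.green_sub (h.memLp m n) hp' (h'.memLp m n)]
    simp only [jumpRight, jumpLeft, map_mul, map_add, Complex.conj_ofReal, Nat.add_sub_cancel,
      Nat.cast_add_one, ← ha, ← hb]
    ring
  · refine (norm_cross_le (sq_add_sq_le_traceWeight (by omega) (.inl rfl))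
      (sq_add_sq_le_traceWeight (by omega) (.inl rfl))).trans ?_
    simp only [Nat.add_sub_cancel]
    have := traceWeight_nonneg (u := u) (u' := u') (N, n)
    have := traceWeight_nonneg (u := u) (u' := u') (N + 1, n)
    gcongr
    linarith [abs_nonneg b]
  · refine (norm_cross_le (sq_add_sq_le_traceWeight (by omega) (.inr rfl))
      (sq_add_sq_le_traceWeight (by omega) (.inr rfl))).trans ?_
    simp only [Nat.add_sub_cancel]
    have := traceWeight_nonneg (u := u) (u' := u') (m, N)
    have := traceWeight_nonneg (u := u) (u' := u') (m, N + 1)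
    gcongr
    linarith [abs_nonneg a]

/-! ### Self-adjointness -/

variable {αp αm νp νm : ℝ} {u f u' f' v w : ℕ → ℕ → ℝ → ℂ} {U F U' F' V W : H}

theorem PiecewiseH2.add {u p w u' p' w' : ℝ → ℂ} {c₁ c₂ c₁' c₂' : ℂ} (h : PiecewiseH2 u p w c₁ c₂)
    (h' : PiecewiseH2 u' p' w' c₁' c₂') : PiecewiseH2 (fun x => u x + u' x) (fun x => p x + p' x)
      (fun x => w x + w' x) (c₁ + c₁') (c₂ + c₂') where
  memLp_u := h.memLp_u.add h'.memLp_u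
  memLp_p := h.memLp_p.add h'.memLp_p
  memLp_w := h.memLp_w.add h'.memLp_w
  prim_u := h.prim_u.add h'.prim_u
  prim_p := by
    convert h.prim_p.add h'.prim_p using 2 with x
    split_ifs <;> ring

theorem PiecewiseH2.const_mul {u p w : ℝ → ℂ} {c₁ c₂ : ℂ} (c : ℂ) (h : PiecewiseH2 u p w c₁ c₂) :
    PiecewiseH2 (fun x => c * u x) (fun x => c * p x) (fun x => c * w x) (c * c₁) (c * c₂) where
  memLp_u := h.memLp_u.const_mul c
  memLp_p := h.memLp_p.const_mul c
  memLp_w := h.memLp_w.const_mul c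
  prim_u := h.prim_u.const_mul c
  prim_p := by
    convert h.prim_p.const_mul c using 2 with x
    split_ifs <;> ring

theorem hasSum_ite_mul (k : ℕ × ℕ) (y : ℕ × ℕ → ℂ) :
    HasSum (fun i => (if i = k then 1 else 0) * y i) (y k) := by
  convert hasSum_ite_eq k (y k) using 2 with i
  split_ifs with h <;> simp [h]

/-- The unit vector at `(m, n)`, as a family of constant functions. -/
def unitFamily (m n : ℕ) (i j : ℕ) (_ : ℝ) : ℂ := if (i, j) = (m, n) then 1 else 0

/-- Symmetry of the Jacobi matrix: its column at m has the entries of its row at m, so the nonzero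
entries sit at m ± 1. The truncated indices at 0 carry the factor √0. -/
theorem jumpRight_unitFamily (m n i j : ℕ) : jumpRight αp (unitFamily m n) i j =
    ((αp / √2 : ℝ) : ℂ) * (((√((m : ℝ) + 1) : ℝ) : ℂ) * (if (i, j) = (m + 1, n) then 1 else 0)
      + ((√(m : ℝ) : ℝ) : ℂ) * (if (i, j) = (m - 1, n) then 1 else 0)) := by
  have e1 : ((√((i : ℝ) + 1) : ℝ) : ℂ) * unitFamily m n (i + 1) j 1 =
      ((√(m : ℝ) : ℝ) : ℂ) * (if (i, j) = (m - 1, n) then 1 else 0) := by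
    cases m with
    | zero => simp [unitFamily]
    | succ m =>
      by_cases h : i = m <;> simp [unitFamily, h]
  have e2 : ((√(i : ℝ) : ℝ) : ℂ) * unitFamily m n (i - 1) j 1 =
      ((√((m : ℝ) + 1) : ℝ) : ℂ) * (if (i, j) = (m + 1, n) then 1 else 0) := by
    cases i with
    | zero => simp
    | succ i =>
      by_cases h : i = m <;> simp [unitFamily, h]
  rw [jumpRight, e1, e2, add_comm]

theorem jumpLeft_unitFamily (m n i j : ℕ) : jumpLeft αm (unitFamily m n) i j =
    ((αm / √2 : ℝ) : ℂ) * (((√((n : ℝ) + 1) : ℝ) : ℂ) * (if (i, j) = (m, n + 1) then 1 else 0)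
      + ((√(n : ℝ) : ℝ) : ℂ) * (if (i, j) = (m, n - 1) then 1 else 0)) := by
  have e1 : ((√((j : ℝ) + 1) : ℝ) : ℂ) * unitFamily m n i (j + 1) (-1) =
      ((√(n : ℝ) : ℝ) : ℂ) * (if (i, j) = (m, n - 1) then 1 else 0) := by
    cases n with
    | zero => simp [unitFamily]
    | succ n =>
      by_cases h : j = n <;> simp [unitFamily, h]
  have e2 : ((√(j : ℝ) : ℝ) : ℂ) * unitFamily m n i (j - 1) (-1) =
      ((√((n : ℝ) + 1) : ℝ) : ℂ) * (if (i, j) = (m, n + 1) then 1 else 0) := by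
    cases j with
    | zero => simp
    | succ j =>
      by_cases h : j = n <;> simp [unitFamily, h]
  rw [jumpLeft, e1, e2, add_comm]

/-- Transposition: pairing y with a column of the symmetric matrix is the same as applying the
matrix to y. -/
theorem hasSum_jumpRight_unitFamily (m n : ℕ) (y : ℕ → ℕ → ℂ) :
    HasSum (fun i : ℕ × ℕ => jumpRight αp (unitFamily m n) i.1 i.2 * y i.1 i.2)
      (jumpRight αp (fun k l _ => y k l) m n) := by
  have h1 := (hasSum_ite_mul (m + 1, n) fun i => y i.1 i.2).mul_left
    (((αp / √2 : ℝ) : ℂ) * ((√((m : ℝ) + 1) : ℝ) : ℂ))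
  have h2 := (hasSum_ite_mul (m - 1, n) fun i => y i.1 i.2).mul_left
    (((αp / √2 : ℝ) : ℂ) * ((√(m : ℝ) : ℝ) : ℂ))
  have e : jumpRight αp (fun k l _ => y k l) m n = _ + _ := mul_add _ _ _
  rw [e, ← mul_assoc, ← mul_assoc]
  refine (h1.add h2).congr_fun fun i => ?_
  rw [jumpRight_unitFamily]
  ring

theorem hasSum_jumpLeft_unitFamily (m n : ℕ) (y : ℕ → ℕ → ℂ) :
    HasSum (fun i : ℕ × ℕ => jumpLeft αm (unitFamily m n) i.1 i.2 * y i.1 i.2)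
      (jumpLeft αm (fun k l _ => y k l) m n) := by
  have h1 := (hasSum_ite_mul (m, n + 1) fun i => y i.1 i.2).mul_left
    (((αm / √2 : ℝ) : ℂ) * ((√((n : ℝ) + 1) : ℝ) : ℂ))
  have h2 := (hasSum_ite_mul (m, n - 1) fun i => y i.1 i.2).mul_left
    (((αm / √2 : ℝ) : ℂ) * ((√(n : ℝ) : ℝ) : ℂ))
  have e : jumpLeft αm (fun k l _ => y k l) m n = _ + _ := mul_add _ _ _
  rw [e, ← mul_assoc, ← mul_assoc]
  refine (h1.add h2).congr_fun fun i => ?_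
  rw [jumpLeft_unitFamily]
  ring

theorem integral_conj_mul_add_add {g x y z : ℝ → ℂ} (hg : MemLp g 2) (hx : MemLp x 2)
    (hy : MemLp y 2) (hz : MemLp z 2) (a b c : ℂ) :
    ∫ t, (starRingEnd ℂ) (g t) * (a * x t + b * y t + c * z t) =
      a * (∫ t, (starRingEnd ℂ) (g t) * x t) + b * (∫ t, (starRingEnd ℂ) (g t) * y t) +
        c * ∫ t, (starRingEnd ℂ) (g t) * z t := by
  have ix := (integrable_conj_mul_of_memLp hg hx).const_mul a
  have iy := (integrable_conj_mul_of_memLp hg hy).const_mul b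
  have iz := (integrable_conj_mul_of_memLp hg hz).const_mul c
  rw [← integral_const_mul, ← integral_const_mul, ← integral_const_mul, ← integral_add ix iy,
    ← integral_add (f := fun t => _ + _) (ix.add iy) iz]
  exact integral_congr_ae (Eventually.of_forall fun t => by simp only; ring)

/-- The pairing `⟨w, a⟩ - ⟨v, r a - q⟩`. -/
def greenPairing (r : ℝ) (v w a q : ℝ → ℂ) : ℂ :=
  (∫ x, (starRingEnd ℂ) (w x) * a x) - ∫ x, (starRingEnd ℂ) (v x) * ((r : ℂ) * a x - q x)

/-- The orthogonality relation to the graph, tested with families that have one nonzero trace. -/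
theorem greenPairing_add_add_eq_zero (hV : Represents V v) (hW : Represents W w)
    (h : ∀ P ∈ operatorGraph αp αm νp νm, inner ℂ W P.1 = inner ℂ V P.2)
    {a₀ p₀ q₀ a₁ p₁ q₁ a₂ p₂ q₂ : ℝ → ℂ} (h₀ : PiecewiseH2 a₀ p₀ q₀ 0 0)
    (h₁ : PiecewiseH2 a₁ p₁ q₁ 1 0) (h₁₁ : a₁ 1 = 0) (h₁₂ : a₁ (-1) = 0)
    (h₂ : PiecewiseH2 a₂ p₂ q₂ 0 1) (h₂₁ : a₂ 1 = 0) (h₂₂ : a₂ (-1) = 0) (m n : ℕ) :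
    greenPairing (level νp νm m n) (v m n) (w m n) a₀ q₀ +
      a₀ 1 * jumpRight αp
        (fun i j _ => greenPairing (level νp νm i j) (v i j) (w i j) a₁ q₁) m n +
      a₀ (-1) * jumpLeft αm
        (fun i j _ => greenPairing (level νp νm i j) (v i j) (w i j) a₂ q₂) m n = 0 := by
  set A : ℕ → ℕ → ℂ := fun i j => unitFamily m n i j 0 with hA
  set c : ℕ → ℕ → ℂ := fun i j => a₀ 1 * jumpRight αp (unitFamily m n) i j with hc
  set d : ℕ → ℕ → ℂ := fun i j => a₀ (-1) * jumpLeft αm (unitFamily m n) i j with hd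
  -- The function a₀ sits at (m, n) and has no jumps, but its traces require jumps at the
  -- neighbours. Multiples of a₁ and a₂ supply these; as both vanish at ±1, they produce no new
  -- traces and the matching conditions hold.
  set u : ℕ → ℕ → ℝ → ℂ := fun i j x => A i j * a₀ x + c i j * a₁ x + d i j * a₂ x with hu
  set r : ℕ → ℕ → ℂ := fun i j => (level νp νm i j : ℂ) with hr
  set f : ℕ → ℕ → ℝ → ℂ := fun i j x => A i j * (r i j * a₀ x - q₀ x) +
    c i j * (r i j * a₁ x - q₁ x) + d i j * (r i j * a₂ x - q₂ x) with hf
  have m₀ : ∀ i j, MemLp (fun x => r i j * a₀ x - q₀ x) 2 := fun i j =>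
    (h₀.memLp_u.const_mul _).sub h₀.memLp_w
  have m₁ : ∀ i j, MemLp (fun x => r i j * a₁ x - q₁ x) 2 := fun i j =>
    (h₁.memLp_u.const_mul _).sub h₁.memLp_w
  have m₂ : ∀ i j, MemLp (fun x => r i j * a₂ x - q₂ x) 2 := fun i j =>
    (h₂.memLp_u.const_mul _).sub h₂.memLp_w
  have hup : ∀ i j, PiecewiseH2 (u i j) (fun x => A i j * p₀ x + c i j * p₁ x + d i j * p₂ x)
      (fun x => (level νp νm i j : ℂ) * u i j x - f i j x) (jumpRight αp u i j)
      (jumpLeft αm u i j) := by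
    intro i j
    have e := ((h₀.const_mul (A i j)).add (h₁.const_mul (c i j))).add (h₂.const_mul (d i j))
    have e1 : jumpRight αp u i j = A i j * 0 + c i j * 1 + d i j * 0 := by
      simp only [jumpRight, hu, hc, hA, h₁₁, h₂₁, unitFamily]
      ring
    have e2 : jumpLeft αm u i j = A i j * 0 + c i j * 0 + d i j * 1 := by
      simp only [jumpLeft, hu, hd, hA, h₁₂, h₂₂, unitFamily]
      ring
    rw [e1, e2]
    convert e using 2 with x
    simp only [hu, hf, hr]
    ring
  -- Only (m, n) and its neighbours carry anything, so the family is finite and all sums converge.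
  have hzero : ∀ i j, i ∉ Finset.range (m + 2) ∨ j ∉ Finset.range (n + 2) →
      A i j = 0 ∧ c i j = 0 ∧ d i j = 0 := by
    intro i j hij
    simp only [Finset.mem_range, not_lt] at hij
    refine ⟨if_neg ?_, ?_, ?_⟩
    · simp only [Prod.mk.injEq]; omega
    · simp only [hc, jumpRight_unitFamily]
      rw [if_neg (by simp only [Prod.mk.injEq]; omega), if_neg (by simp only [Prod.mk.injEq]; omega)]
      simp
    · simp only [hd, jumpLeft_unitFamily]
      rw [if_neg (by simp only [Prod.mk.injEq]; omega), if_neg (by simp only [Prod.mk.injEq]; omega)]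
      simp
  have hsum : ∀ g : ℕ → ℕ → ℝ → ℂ, (∀ i j, MemLp (g i j) 2) →
      (∀ i j, A i j = 0 ∧ c i j = 0 ∧ d i j = 0 → g i j = 0) →
      ∑' (i : ℕ) (j : ℕ), ∫⁻ x, ‖g i j x‖ₑ ^ 2 < ⊤ := by
    intro g hg hg0
    rw [← ENNReal.tsum_prod (f := fun i j => ∫⁻ x, ‖g i j x‖ₑ ^ 2),
      tsum_eq_sum (s := Finset.range (m + 2) ×ˢ Finset.range (n + 2))]
    · exact ENNReal.sum_lt_top.2 fun i _ => (memLp_two_iff_lintegral (hg _ _).1).1 (hg _ _)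
    · intro i hi
      rw [Finset.mem_product, not_and_or] at hi
      rw [hg0 _ _ (hzero _ _ hi)]
      simp
  have hfm : ∀ i j, MemLp (f i j) 2 := fun i j =>
    (((m₀ i j).const_mul _).add ((m₁ i j).const_mul _)).add ((m₂ i j).const_mul _)
  have hfs := hsum f hfm fun i j h0 => by
    funext x; simp [hf, h0.1, h0.2.1, h0.2.2]
  obtain ⟨U, hU⟩ := exists_represents (fun i j => (hup i j).memLp_u)
    (hsum u (fun i j => (hup i j).memLp_u) fun i j h0 => by
      funext x; simp [hu, h0.1, h0.2.1, h0.2.2])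
  obtain ⟨F, hF⟩ := exists_represents hfm hfs
  have hUF := h (U, F) ⟨u, f, hU, isAdmissible_of_piecewiseH2 (fun i j => ⟨_, hup i j⟩) hfs, hF⟩
  have s1 := (hW.hasSum_inner hU).sub (hV.hasSum_inner hF)
  rw [hUF, sub_self] at s1
  have s2 := (hasSum_ite_mul (m, n) fun i =>
    greenPairing (level νp νm i.1 i.2) (v i.1 i.2) (w i.1 i.2) a₀ q₀).add
    ((hasSum_jumpRight_unitFamily (αp := αp) m n fun i j =>
      greenPairing (level νp νm i j) (v i j) (w i j) a₁ q₁).mul_left (a₀ 1)) |>.add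
    ((hasSum_jumpLeft_unitFamily (αm := αm) m n fun i j =>
      greenPairing (level νp νm i j) (v i j) (w i j) a₂ q₂).mul_left (a₀ (-1)))
  refine s2.unique (s1.congr_fun fun i => ?_)
  simp only [hu, hf]
  rw [integral_conj_mul_add_add (hW.memLp _ _) h₀.memLp_u h₁.memLp_u h₂.memLp_u,
    integral_conj_mul_add_add (hV.memLp _ _) (m₀ _ _) (m₁ _ _) (m₂ _ _)]
  simp only [greenPairing, hc, hd, hA, hr, unitFamily]
  ring

/-! ### Regularity and matching conditions for elements of the adjoint -/

variable {αp αm νp νm : ℝ} {u f u' f' v w : ℕ → ℕ → ℝ → ℂ} {U F U' F' V W : H}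

theorem greenPairing_congr {r : ℝ} {v w v' w' a q : ℝ → ℂ} (hv : v =ᵐ[volume] v')
    (hw : w =ᵐ[volume] w') : greenPairing r v w a q = greenPairing r v' w' a q := by
  unfold greenPairing
  congr 1 <;> refine integral_congr_ae ?_
  · filter_upwards [hw] with x hx
    rw [hx]
  · filter_upwards [hv] with x hx
    rw [hx]

/-- Because a vanishes at ±1, the jumps of v drop out of Green's formula; a profile with a unit jump
at one point therefore reads off the trace of v there. -/
theorem PiecewiseH2.greenPairing_eq {r : ℝ} {v p f a p' q : ℝ → ℂ} {c₁ c₂ d₁ d₂ : ℂ}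
    (hv : PiecewiseH2 v p (fun x => (r : ℂ) * v x - f x) c₁ c₂) (hf : MemLp f 2)
    (ha : PiecewiseH2 a p' q d₁ d₂) (h1 : a 1 = 0) (h2 : a (-1) = 0) :
    greenPairing r v f a q =
      -(d₁ * (starRingEnd ℂ) (v 1)) - d₂ * (starRingEnd ℂ) (v (-1)) := by
  have e : q = fun x => (r : ℂ) * a x - ((r : ℂ) * a x - q x) := by funext x; ring
  rw [e] at ha
  have := hv.green_sub hf ha ((ha.memLp_u.const_mul _).sub (by rw [← e] at ha; exact ha.memLp_w))
  rw [greenPairing, this, h1, h2]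
  ring

/-- Since φ and r are real, conjugation turns the pairing into the distribution v'' - (rv - w)
evaluated at φ. -/
theorem conj_greenPairing_test {r : ℝ} {v w : ℝ → ℂ} (hv : MemLp v 2) (hw : MemLp w 2) {φ : ℝ → ℝ}
    (hφ : ContDiff ℝ ∞ φ) (hc : HasCompactSupport φ) :
    (starRingEnd ℂ) (greenPairing r v w (fun x => (φ x : ℂ))
      fun x => ((deriv (deriv φ) x : ℝ) : ℂ)) =
      (∫ x, deriv (deriv φ) x • v x) - ∫ x, φ x • ((r : ℂ) * v x - w x) := by
  have T := piecewiseH2_of_test hφ hc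
  have i1 := integrable_conj_mul_of_memLp hw T.memLp_u
  have i2 : Integrable fun x => (starRingEnd ℂ) (v x) *
      ((r : ℂ) * (φ x : ℂ) - ((deriv (deriv φ) x : ℝ) : ℂ)) :=
    integrable_conj_mul_of_memLp hv ((T.memLp_u.const_mul (r : ℂ)).sub T.memLp_w)
  have i3 : Integrable fun x => deriv (deriv φ) x • v x := by
    simp only [Complex.real_smul]
    exact T.memLp_w.integrable_mul hv
  have i4 : Integrable fun x => φ x • ((r : ℂ) * v x - w x) := by
    simp only [Complex.real_smul]
    exact T.memLp_u.integrable_mul ((hv.const_mul (r : ℂ)).sub hw)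
  rw [greenPairing, ← integral_sub i1 i2, ← integral_conj, ← integral_sub i3 i4]
  refine integral_congr_ae (Eventually.of_forall fun x => ?_)
  simp only [map_sub, map_mul, Complex.conj_conj, Complex.conj_ofReal, Complex.real_smul]
  ring

/-- The graph of the adjoint of `A_α` is contained in the graph of `A_α`. -/
theorem mem_operatorGraph_of_inner_eq
    (h : ∀ P ∈ operatorGraph αp αm νp νm, inner ℂ W P.1 = inner ℂ V P.2) :
    (V, W) ∈ operatorGraph αp αm νp νm := by
  obtain ⟨a₁, p₁, q₁, h₁, h₁₁, h₁₂⟩ := exists_piecewiseH2_jump_one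
  obtain ⟨a₂, p₂, q₂, h₂, h₂₁, h₂₂⟩ := exists_piecewiseH2_jump_neg_one
  set v₀ := hermiteCoeff V
  set w₀ := hermiteCoeff W
  have hV : Represents V v₀ := fun m n => EventuallyEq.rfl
  have hW : Represents W w₀ := fun m n => EventuallyEq.rfl
  -- Stand-ins for the traces of v, which have no meaning before regularity is known. They turn out
  -- to be -conj v(1), and E₂ to be -conj v(-1).
  set E₁ : ℕ → ℕ → ℝ → ℂ := fun i j _ => greenPairing (level νp νm i j) (v₀ i j) (w₀ i j) a₁ q₁
    with hE₁
  set E₂ : ℕ → ℕ → ℝ → ℂ := fun i j _ => greenPairing (level νp νm i j) (v₀ i j) (w₀ i j) a₂ q₂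
    with hE₂
  have key : ∀ m n, ∃ v p, v₀ m n =ᵐ[volume] v ∧ PiecewiseH2 v p
      (fun x => (level νp νm m n : ℂ) * v₀ m n x - w₀ m n x)
      (-(starRingEnd ℂ) (jumpRight αp E₁ m n)) (-(starRingEnd ℂ) (jumpLeft αm E₂ m n)) := by
    intro m n
    -- With a₀ = φ, the conjugated relation is an equation for v'' with delta terms at ±1, whose
    -- coefficients come from the stand-ins at the neighbouring indices.
    refine exists_piecewiseH2_of_distribution (hV.memLp m n)
      (((hV.memLp m n).const_mul _).sub (hW.memLp m n)) fun φ hφ hc => ?_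
    have e := congrArg (starRingEnd ℂ) (greenPairing_add_add_eq_zero hV hW h
      (piecewiseH2_of_test hφ hc) h₁ h₁₁ h₁₂ h₂ h₂₁ h₂₂ m n)
    rw [map_add, map_add, conj_greenPairing_test (hV.memLp m n) (hW.memLp m n) hφ hc, map_mul,
      map_mul, Complex.conj_ofReal, Complex.conj_ofReal, map_zero] at e
    linear_combination e
  choose v p hv hp using key
  -- Chosen so that r v - f is everywhere the second derivative already found, although v agrees
  -- with v₀ only almost everywhere; f still represents W.
  set f : ℕ → ℕ → ℝ → ℂ := fun m n x => (level νp νm m n : ℂ) * v m n x -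
    ((level νp νm m n : ℂ) * v₀ m n x - w₀ m n x) with hf
  have hVv : Represents V v := hv
  have hWf : Represents W f := fun m n => by
    filter_upwards [hv m n] with x hx
    rw [hf]
    simp only
    rw [← hx]
    ring
  have hp' : ∀ m n, PiecewiseH2 (v m n) (p m n)
      (fun x => (level νp νm m n : ℂ) * v m n x - f m n x)
      (-(starRingEnd ℂ) (jumpRight αp E₁ m n)) (-(starRingEnd ℂ) (jumpLeft αm E₂ m n)) := by
    intro m n
    convert hp m n using 2 with x
    simp only [hf]
    ring
  have e₁ : ∀ m n x, E₁ m n x = -(starRingEnd ℂ) (v m n 1) := fun m n x => by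
    rw [hE₁]
    simp only
    rw [greenPairing_congr (hv m n) (hWf m n),
      (hp' m n).greenPairing_eq (hWf.memLp m n) h₁ h₁₁ h₁₂]
    ring
  have e₂ : ∀ m n x, E₂ m n x = -(starRingEnd ℂ) (v m n (-1)) := fun m n x => by
    rw [hE₂]
    simp only
    rw [greenPairing_congr (hv m n) (hWf m n),
      (hp' m n).greenPairing_eq (hWf.memLp m n) h₂ h₂₁ h₂₂]
    ring
  refine ⟨v, f, hVv, isAdmissible_of_piecewiseH2 (fun m n => ⟨p m n, ?_⟩) hWf.tsum_lt_top, hWf⟩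
  convert hp' m n using 1
  · simp only [jumpRight, e₁, map_mul, map_add, map_neg, Complex.conj_conj, Complex.conj_ofReal]
    ring
  · simp only [jumpLeft, e₂, map_mul, map_add, map_neg, Complex.conj_conj, Complex.conj_ofReal]
    ring

/-! ### From the graph to the self-adjoint operator -/

theorem snd_eq_zero_of_mem_operatorGraph :
    ∀ P ∈ operatorGraph αp αm νp νm, P.1 = 0 → P.2 = 0 :=
  fun _ => operatorGraph_snd_eq_zero

theorem graph_smilanskyOperator :
    (smilanskyOperator αp αm νp νm).graph = operatorGraph αp αm νp νm :=
  Submodule.toLinearPMap_graph_eq _ snd_eq_zero_of_mem_operatorGraph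

theorem smilanskyOperator_apply {x : (smilanskyOperator αp αm νp νm).domain}
    (h : ((x : H), W) ∈ operatorGraph αp αm νp νm) : smilanskyOperator αp αm νp νm x = W := by
  rw [← graph_smilanskyOperator] at h
  obtain ⟨y, h1, h2⟩ := (LinearPMap.mem_graph_iff _).1 h
  exact (congrArg _ (Subtype.ext h1.symm)).trans h2

theorem apply_mem_operatorGraph (x : (smilanskyOperator αp αm νp νm).domain) :
    ((x : H), smilanskyOperator αp αm νp νm x) ∈ operatorGraph αp αm νp νm := by
  rw [← graph_smilanskyOperator]
  exact LinearPMap.mem_graph _ x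

theorem mem_domain_of_mem_operatorGraph (h : (V, W) ∈ operatorGraph αp αm νp νm) :
    V ∈ (smilanskyOperator αp αm νp νm).domain := by
  rw [← graph_smilanskyOperator] at h
  exact LinearPMap.mem_domain_of_mem_graph h

/-- By Riesz–Fischer, the summability in condition 2 is what provides the image in L²(ℝ³). -/
theorem IsAdmissible.exists_mem_operatorGraph (h : IsAdmissible αp αm νp νm u f)
    (hU : Represents U u) : ∃ W, Represents W f ∧ (U, W) ∈ operatorGraph αp αm νp νm := by
  obtain ⟨W, hW⟩ := exists_represents h.memLp h.sum_lt_top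
  exact ⟨W, hW, u, f, hU, h, hW⟩

theorem coe_domain_smilanskyOperator :
    ((smilanskyOperator αp αm νp νm).domain : Set H) = domainSet αp αm νp νm := by
  ext U
  constructor
  · intro hU
    obtain ⟨u, f, h1, h2, -⟩ := apply_mem_operatorGraph ⟨U, hU⟩
    exact ⟨u, f, h1, h2⟩
  · rintro ⟨u, f, h1, h2⟩
    obtain ⟨W, -, hW⟩ := h2.exists_mem_operatorGraph h1
    exact mem_domain_of_mem_operatorGraph hW

/-- A vector W orthogonal to the domain satisfies the adjoint relation with V = 0, so (0, W) lies in
the graph, and single-valuedness gives W = 0. -/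
theorem dense_domain_smilanskyOperator :
    Dense ((smilanskyOperator αp αm νp νm).domain : Set H) := by
  rw [Submodule.dense_iff_topologicalClosure_eq_top, Submodule.topologicalClosure_eq_top_iff,
    Submodule.eq_bot_iff]
  intro W hW
  refine operatorGraph_snd_eq_zero (αp := αp) (αm := αm) (νp := νp) (νm := νm) (P := (0, W)) (
    mem_operatorGraph_of_inner_eq fun P hP => ?_) rfl
  rw [inner_zero_left]
  exact (Submodule.mem_orthogonal' _ _).1 hW _ (mem_domain_of_mem_operatorGraph hP)

theorem isFormalAdjoint_smilanskyOperator :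
    (smilanskyOperator αp αm νp νm).IsFormalAdjoint (smilanskyOperator αp αm νp νm) := by
  intro x y
  obtain ⟨u, f, h1, h2, h3⟩ := apply_mem_operatorGraph x
  obtain ⟨u', f', h1', h2', h3'⟩ := apply_mem_operatorGraph y
  exact inner_eq_of_isAdmissible h2 h1 h3 h2' h1' h3'

/-- Symmetry makes the adjoint an extension. For V in the domain of the adjoint, the pair of V and
its image satisfies the orthogonality relation and so lies in the graph; hence the domains agree. -/
theorem isSelfAdjoint_smilanskyOperator : IsSelfAdjoint (smilanskyOperator αp αm νp νm) := by
  rw [LinearPMap.isSelfAdjoint_def]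
  refine (LinearPMap.eq_of_le_of_domain_eq (isFormalAdjoint_smilanskyOperator.le_adjoint
    dense_domain_smilanskyOperator) (le_antisymm
      (isFormalAdjoint_smilanskyOperator.le_adjoint dense_domain_smilanskyOperator).1
      fun V hV => ?_)).symm
  refine mem_domain_of_mem_operatorGraph
    (mem_operatorGraph_of_inner_eq (W := LinearPMap.adjoint _ ⟨V, hV⟩) fun P hP => ?_)
  have hd := mem_domain_of_mem_operatorGraph hP
  have := LinearPMap.adjoint_isFormalAdjoint dense_domain_smilanskyOperator ⟨V, hV⟩ ⟨P.1, hd⟩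
  rw [smilanskyOperator_apply (x := ⟨P.1, hd⟩) hP] at this
  exact this

end Smilansky

end

/-- For `α₊, α₋ ≥ 0` the operator `A_α` in `L²(ℝ³)` is well defined, with domain exactly `𝒟_α` and
action `{u_{m,n}} ↦ {L_{m,n} u_{m,n}}` in terms of Hermite expansions, and it is self-adjoint. -/
theorem theorem2p2 (αp αm νp νm : ℝ) (hαp : 0 ≤ αp) (hαm : 0 ≤ αm) (hνp : νp ≠ 0) (hνm : νm ≠ 0) :
    ((Smilansky.smilanskyOperator αp αm νp νm).domain : Set Smilansky.H)
        = Smilansky.domainSet αp αm νp νm ∧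
      (∀ (U : (Smilansky.smilanskyOperator αp αm νp νm).domain) (u f : ℕ → ℕ → ℝ → ℂ),
        Smilansky.Represents (U : Smilansky.H) u → Smilansky.IsAdmissible αp αm νp νm u f →
          Smilansky.Represents (Smilansky.smilanskyOperator αp αm νp νm U) f) ∧
      IsSelfAdjoint (Smilansky.smilanskyOperator αp αm νp νm) := by
  refine ⟨Smilansky.coe_domain_smilanskyOperator, fun U u f hu h => ?_,
    Smilansky.isSelfAdjoint_smilanskyOperator⟩
  obtain ⟨W, hW, hUW⟩ := h.exists_mem_operatorGraph hu
  rwa [Smilansky.smilanskyOperator_apply hUW]
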